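/- **Setting.** Fix a finite set $\Lambda$ of labels with arities $ar:\Lambda\to\mathbb N$. A *graph* $G$ is a finite hypergraph: finite sets $V_G,E_G$ of nodes and edges, a labelling $E_G\to\Lambda$ and a connection map $E_G\to V_G^*$ sending an edge labelled $\ell$ to a sequence of $ar(\ell)$ nodes. A *morphism* $G\rightharpoonup H$ is a pair of partial functions on nodes and edges which, wherever defined on an edge, is defined on all nodes incident to it and preserves its label and connection sequence; pushouts are taken in the category of graphs and (partial) morphisms. All graphs are considered up to isomorphism. A *subgraph morphism* is an injective and surjective (partial) morphism; $G_1\sqsubseteq G_2$ means that there is a subgraph morphism $G_2\rightharpoonup G_1$. For a set $\mathcal S$ of graphs, $\uparrow\!\mathcal S=\{G'\mid \exists G\in\mathcal S:\ G\sqsubseteq G'\}$; $\mathcal B$ is a *basis* of $\mathcal S$ if $\mathcal S=\uparrow\!\mathcal B$. A *universally quantified rule* $\rho=(r,U)$ consists of a morphism $r:L\rightharpoonup R$ and a finite set $U$ of pairs $u=(p_u:L\to L_u,\ q_u:L_u\rightharpoonup R_u)$ with $p_u$ total and injective, such that for each node or edge $x$ of $L$, $q_u(p_u(x))$ is defined and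 has exactly one preimage in $L_u$, and such that the set $\mathrm{qn}(u)$ of nodes $v$ of $L$ for which $p_u(v)$ is incident to an edge without preimage in $L$ is non-empty; $\mathrm{qn}(\rho)=\bigcup_{u\in U}\mathrm{qn}(u)$. *Instantiations* of $\rho$ are defined recursively: $(\mathrm{id}_L,r)$ is one of length $0$; if $(\pi:L\to\overline L,\gamma:\overline L\rightharpoonup\overline R)$ is one of length $k$ and $u\in U$, and $\overline L_u$ is the pushout of $\pi,p_u$ with $p_u':\overline L\to\overline L_u$, and $\overline R_u$ the pushout of $\gamma\circ\pi,\ q_u\circ p_u$, then $(p_u'\circ\pi,\ \eta:\overline L_u\rightharpoonup\overline R_u)$ is one of length $k+1$, where $\eta$ is the mediating morphism. For a finite set $\mathcal R$ of rules, $G\Rightarrow H$ holds if, for some $\rho\in\mathcal R$, some instantiation $(\pi,\gamma)$ of $\rho$ and some total injective $m:\overline L\to G$ satisfying the *application condition* (every edge of $G$ incident to $m(\pi(x))$ for some $x\in\mathrm{qn}(\rho)$ has a preimage under $m$), $H$ is the pushout of $\gamma$ and $m$. Put $\mathrm{Pred}(\mathcal S)=\{G'\mid\exists G\in\mathcal S:\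 G'\Rightarrow G\}$. A graph $F$ is *coverable* from $G$ if $G\Rightarrow^*H$ for some $H$ with $F\sqsubseteq H$. *Backward step (without path bound).* The graphs computed from $G$ by backward application of an instantiation $(\pi,\gamma)$ of $\rho$ are the graphs $G'$ obtained as follows: take a subgraph morphism $\mu:\overline R\rightharpoonup R'$, a total injective $m':R'\to G$, and a minimal pushout complement $(G',m:\overline L\to G')$ of $\mu\circ\gamma$ and $m'$ with $m$ total and injective (minimal with respect to subgraph morphisms commuting with the pushout diagrams); keep $G'$ if $m$ satisfies the application condition. A *bounding function* is a computable function $b$ assigning to each rule $\rho$ and graph $G$ a number such that every graph computed from $G$ by backward application of an instantiation of $\rho$ of any length has a subgraph that is computed from $G$ by backward application of an instantiation of $\rho$ of length at most $b(\rho,G)$. Then $\mathrm{predBasis}(G)$ is the set of all graphs computed from $G$ by backward application of instantiations of rules $\rho\in\mathcal R$ of length at most $b(\rho,G)$. *Backward search.* Given $\mathcal R$ and a finite set $\mathcal F$ of final graphs, start with $\mathcal W=\mathcal F$. In each round add all graphs of $\mathrm{predBasis}(G)$, $G\in\mathcal W$, to $\mathcal W$ and then minimize $\mathcal W$ (keep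 one representative of each isomorphism class of $\sqsubseteq$-minimal graphs). Stop when a further round does not change $\mathcal W$. **Proposition.** Bounding functions exist; $b(\rho,G)=|V_G|+|E_G|$ is one. For every bounding function $b$ the following hold. 1. For all $\mathcal R$ and $G$, $\mathrm{predBasis}(G)$ is an effective pred-basis: it is a finite basis of $\uparrow\!\mathrm{Pred}(\uparrow\!\{G\})$, and it is computable from $\mathcal R$ and $G$. 2. The backward search using $\mathrm{predBasis}$ is an algorithm computing an over-approximation of the set of all graphs from which a final graph is coverable. That is: every round can be carried out; the search is a partial recursive procedure in $(\mathcal R,\mathcal F)$ that halts exactly when the working sets become stationary and then returns the stationary set; if it halts with $\mathcal W$, then every graph from which some $F\in\mathcal F$ is coverable lies in $\uparrow\!\mathcal W$; and whether or not it halts, the upward closures of the successive working sets $\mathcal W_0,\mathcal W_1,\dots$ increase and every graph from which some $F\in\mathcal F$ is coverable lies in $\bigcup_i\uparrow\!\mathcal W_i$. Termination is not guaranteed: there are $\Lambda$, $ar$, $\mathcal R$ and $\mathcal F$ such that, for every bounding function, the backward search does not terminate. -/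

import Mathlib

namespace UGTS

open CategoryTheory

/-! ### Hypergraphs and partial morphisms -/

/-- A finite hypergraph over a label set `Λ` with arity function `ar`. All notions below are
invariant under isomorphism, so the finite sets of nodes and edges are taken to be
`Fin nV` and `Fin nE`. -/
structure HGraph {Λ : Type} (ar : Λ → ℕ) where
  nV : ℕ
  nE : ℕ
  lab : Fin nE → Λ
  conn : Fin nE → List (Fin nV)
  length_conn : ∀ e, (conn e).length = ar (lab e)

variable {Λ : Type} {ar : Λ → ℕ}

/-- The edge `e` is incident to the node `v`. -/
def HGraph.Incident (G : HGraph ar) (e : Fin G.nE) (v : Fin G.nV) : Prop :=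
  v ∈ G.conn e

/-- The number of nodes and edges of a graph. -/
def HGraph.size (G : HGraph ar) : ℕ := G.nV + G.nE

/-- A partial hypergraph morphism: a pair of partial functions such that, where it is defined on
an edge, it is defined on all the nodes incident to it and preserves label and connection. -/
@[ext]
structure PHom (G H : HGraph ar) where
  onV : Fin G.nV → Option (Fin H.nV)
  onE : Fin G.nE → Option (Fin H.nE)
  lab_eq : ∀ e e', onE e = some e' → G.lab e = H.lab e'
  conn_eq : ∀ e e', onE e = some e' → (G.conn e).map onV = (H.conn e').map some

/-- The identity morphism. -/
def PHom.id (G : HGraph ar) : PHom G G where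
  onV := some
  onE := some
  lab_eq := by
    intro e e' h
    rw [Option.some.inj h]
  conn_eq := by
    intro e e' h
    rw [Option.some.inj h]

/-- Composition of partial morphisms (first `f`, then `g`). -/
def PHom.comp {G H K : HGraph ar} (f : PHom G H) (g : PHom H K) : PHom G K where
  onV v := (f.onV v).bind g.onV
  onE e := (f.onE e).bind g.onE
  lab_eq := by
    intro e e'' h
    obtain ⟨e', h1, h2⟩ := Option.bind_eq_some_iff.1 h
    exact (f.lab_eq e e' h1).trans (g.lab_eq e' e'' h2)
  conn_eq := by
    intro e e'' h
    obtain ⟨e', h1, h2⟩ := Option.bind_eq_some_iff.1 h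
    have h3 := congrArg (List.map (fun o => o.bind g.onV)) (f.conn_eq e e' h1)
    rw [List.map_map, List.map_map] at h3
    exact h3.trans (g.conn_eq e' e'' h2)

/-- The category of finite hypergraphs and partial morphisms. -/
instance : Category (HGraph ar) where
  Hom := PHom
  id := PHom.id
  comp := PHom.comp
  id_comp := by
    intro G H f
    rfl
  comp_id := by
    intro G H f
    apply PHom.ext
    · funext v
      exact Option.bind_fun_some _
    · funext e
      exact Option.bind_fun_some _
  assoc := by
    intro G H K M f g h
    apply PHom.ext
    · funext v
      exact Option.bind_assoc _ _ _
    · funext e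
      exact Option.bind_assoc _ _ _

/-- The action of a morphism on nodes. -/
abbrev nodeMap {G H : HGraph ar} (f : G ⟶ H) : Fin G.nV → Option (Fin H.nV) := PHom.onV f

/-- The action of a morphism on edges. -/
abbrev edgeMap {G H : HGraph ar} (f : G ⟶ H) : Fin G.nE → Option (Fin H.nE) := PHom.onE f

/-- The morphism is total. -/
def IsTotalHom {G H : HGraph ar} (f : G ⟶ H) : Prop :=
  (∀ v, ∃ w, nodeMap f v = some w) ∧ (∀ e, ∃ d, edgeMap f e = some d)

/-- The morphism is injective (where it is defined). -/
def IsInjHom {G H : HGraph ar} (f : G ⟶ H) : Prop :=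
  (∀ v v' w, nodeMap f v = some w → nodeMap f v' = some w → v = v') ∧
    (∀ e e' d, edgeMap f e = some d → edgeMap f e' = some d → e = e')

/-- The morphism is surjective. -/
def IsSurjHom {G H : HGraph ar} (f : G ⟶ H) : Prop :=
  (∀ w, ∃ v, nodeMap f v = some w) ∧ (∀ d, ∃ e, edgeMap f e = some d)

/-- Subgraph morphisms: partial, injective and surjective. -/
def IsSubgraphHom {G H : HGraph ar} (f : G ⟶ H) : Prop := IsInjHom f ∧ IsSurjHom f

/-- The subgraph ordering: `G₁` is a subgraph of `G₂`. -/
def SubOrder (G₁ G₂ : HGraph ar) : Prop := ∃ f : G₂ ⟶ G₁, IsSubgraphHom f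

/-- The upward closure of a set of graphs. -/
def upClosure (S : Set (HGraph ar)) : Set (HGraph ar) := {G' | ∃ G ∈ S, SubOrder G G'}

/-- `B` is a basis of the (upward-closed) set `S`. -/
def IsBasis (B S : Set (HGraph ar)) : Prop := S = upClosure B

/-! ### Universally quantified rules and rewriting -/

/-- A universal quantification on a left-hand side `L`: a total injective `p : L ⟶ Lu` and a
partial `q : Lu ⟶ Ru` such that, for all nodes and edges `x` of `L`, `q (p x)` is defined and has
exactly one preimage in `Lu`; moreover some node of `L` is quantified. -/
structure UQuant (L : HGraph ar) where
  Lu : HGraph ar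
  Ru : HGraph ar
  p : L ⟶ Lu
  q : Lu ⟶ Ru
  p_total : IsTotalHom p
  p_inj : IsInjHom p
  node_unique : ∀ v y, nodeMap p v = some y →
    ∃ z, nodeMap q y = some z ∧ ∀ y', nodeMap q y' = some z → y' = y
  edge_unique : ∀ e y, edgeMap p e = some y →
    ∃ z, edgeMap q y = some z ∧ ∀ y', edgeMap q y' = some z → y' = y
  exists_quantified : ∃ v y, nodeMap p v = some y ∧
    ∃ d, Lu.Incident d y ∧ ∀ e, edgeMap p e ≠ some d

/-- The quantified nodes of `u`: those `v` in `L` for which `p v` is incident to an edge without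
preimage in `L`. -/
def UQuant.qNodes {L : HGraph ar} (u : UQuant L) : Set (Fin L.nV) :=
  {v | ∃ y, nodeMap u.p v = some y ∧ ∃ d, u.Lu.Incident d y ∧ ∀ e, edgeMap u.p e ≠ some d}

/-- A universally quantified rule `(r : L ⇀ R, U)`. The finite set `U` is given by a list of its
elements. -/
structure URule {Λ : Type} (ar : Λ → ℕ) where
  L : HGraph ar
  R : HGraph ar
  r : L ⟶ R
  U : List (UQuant L)

/-- The quantified nodes of a rule. -/
def URule.qNodes (ρ : URule ar) : Set (Fin ρ.L.nV) := {v | ∃ u ∈ ρ.U, v ∈ u.qNodes}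

/-- `Instantiation ρ k π γ`: the pair `(π, γ)` is an instantiation of `ρ` of length `k`. -/
inductive Instantiation (ρ : URule ar) :
    ℕ → {L' R' : HGraph ar} → (ρ.L ⟶ L') → (L' ⟶ R') → Prop
  | base : Instantiation ρ 0 (𝟙 ρ.L) ρ.r
  | step {k : ℕ} {L' R' Lu' Ru' : HGraph ar} {π : ρ.L ⟶ L'} {γ : L' ⟶ R'} (u : UQuant ρ.L)
      (p' : L' ⟶ Lu') (π' : u.Lu ⟶ Lu') (j : R' ⟶ Ru') (q' : u.Ru ⟶ Ru') (η : Lu' ⟶ Ru')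
      (h : Instantiation ρ k π γ) (hu : u ∈ ρ.U)
      (hL : IsPushout π u.p p' π') (hR : IsPushout (π ≫ γ) (u.p ≫ u.q) j q')
      (h₁ : p' ≫ η = γ ≫ j) (h₂ : π' ≫ η = u.q ≫ q') :
      Instantiation ρ (k + 1) (π ≫ p') η

/-- The application condition of a match `m : L' ⟶ G` of an instantiation: every edge of `G`
incident to the image of a quantified node is matched. -/
def AppCond (ρ : URule ar) {L' G : HGraph ar} (π : ρ.L ⟶ L') (m : L' ⟶ G) : Prop :=
  ∀ x ∈ ρ.qNodes, ∀ v, nodeMap (π ≫ m) x = some v →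
    ∀ e, G.Incident e v → ∃ e', edgeMap m e' = some e

/-- `G` can be rewritten to `H` in one step with the rule `ρ`. -/
def Applies (ρ : URule ar) (G H : HGraph ar) : Prop :=
  ∃ (k : ℕ) (L' R' : HGraph ar) (π : ρ.L ⟶ L') (γ : L' ⟶ R') (m : L' ⟶ G),
    Instantiation ρ k π γ ∧ IsTotalHom m ∧ IsInjHom m ∧ AppCond ρ π m ∧
      ∃ (n : R' ⟶ H) (γ' : G ⟶ H), IsPushout γ m n γ'

/-- The rewriting relation of a finite set of rules (given by a list). -/
def Rewrites (rules : List (URule ar)) (G H : HGraph ar) : Prop := ∃ ρ ∈ rules, Applies ρ G H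

/-- The predecessors of a set of graphs. -/
def Pred (rules : List (URule ar)) (S : Set (HGraph ar)) : Set (HGraph ar) :=
  {G' | ∃ G ∈ S, Rewrites rules G' G}

/-- From `G` one can reach a graph that contains `F` as a subgraph (general coverability). -/
def CanCover (rules : List (URule ar)) (G F : HGraph ar) : Prop :=
  ∃ H, Relation.ReflTransGen (Rewrites rules) G H ∧ SubOrder F H

/-! ### The backward step -/

/-- `(G', m, g)` is a pushout complement of `δ : L' ⇀ R'` and `m' : R' ⟶ G` with a total injective
match `m`. -/
def IsPOC {L' R' G G' : HGraph ar} (δ : L' ⟶ R') (m' : R' ⟶ G) (m : L' ⟶ G') (g : G' ⟶ G) :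
    Prop :=
  IsTotalHom m ∧ IsInjHom m ∧ IsPushout δ m m' g

/-- A minimal such pushout complement: every pushout complement that is a subgraph of it (by a
subgraph morphism that commutes with the diagrams) is isomorphic to it. -/
def IsMinimalPOC {L' R' G G' : HGraph ar} (δ : L' ⟶ R') (m' : R' ⟶ G) (m : L' ⟶ G')
    (g : G' ⟶ G) : Prop :=
  IsPOC δ m' m g ∧
    ∀ (H : HGraph ar) (n : L' ⟶ H) (h : H ⟶ G) (ν : G' ⟶ H), IsPOC δ m' n h →
      IsSubgraphHom ν → m ≫ ν = n → ν ≫ h = g → IsIso ν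

/-- The graphs computed from `G` by backward application of instantiations of `ρ` of length `k`,
without any bound on paths. -/
def backApply (ρ : URule ar) (G : HGraph ar) (k : ℕ) : Set (HGraph ar) :=
  {G' | ∃ (L' R' R'' : HGraph ar) (π : ρ.L ⟶ L') (γ : L' ⟶ R') (μ : R' ⟶ R'') (m' : R'' ⟶ G)
    (m : L' ⟶ G') (g : G' ⟶ G),
      Instantiation ρ k π γ ∧ IsSubgraphHom μ ∧ IsTotalHom m' ∧ IsInjHom m' ∧
        IsMinimalPOC (γ ≫ μ) m' m g ∧ AppCond ρ π m}

/-- `N` is an upper bound on the length of the instantiations of `ρ` that are needed for a backward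
step from `G`: whatever an instantiation of any length yields is represented by the result of an
instantiation of length at most `N`. -/
def IsInstBound (ρ : URule ar) (G : HGraph ar) (N : ℕ) : Prop :=
  ∀ k, ∀ G' ∈ backApply ρ G k, ∃ k' ≤ N, ∃ G'' ∈ backApply ρ G k', SubOrder G'' G'

/-- The result of the backward step from `G` without path bound, where instantiations of `ρ` are
used up to the length `b ρ G`. -/
def predBasis (b : URule ar → HGraph ar → ℕ) (rules : List (URule ar)) (G : HGraph ar) :
    Set (HGraph ar) :=
  {G' | ∃ ρ ∈ rules, ∃ k ≤ b ρ G, G' ∈ backApply ρ G k}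

/-! ### The backward search

Working sets are finite sets of graphs up to isomorphism; they are given by lists, of which only
the members matter. -/

/-- `W` results from the set `C` by minimization: from each isomorphism class of minimal graphs
of `C` one representative is kept, and all other graphs are removed. -/
def IsMinimization (C : Set (HGraph ar)) (W : List (HGraph ar)) : Prop :=
  (∀ H ∈ W, H ∈ C) ∧ (∀ H ∈ W, ∀ H' ∈ W, SubOrder H' H → H' = H) ∧
    (∀ H ∈ C, ∃ H' ∈ W, SubOrder H' H)

/-- One round of the search: the results of the backward steps from all members of the working set
are added to the working set, which is then minimized. -/
def SearchStep (b : URule ar → HGraph ar → ℕ) (rules : List (URule ar))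
    (W W' : List (HGraph ar)) : Prop :=
  IsMinimization {H | H ∈ W ∨ ∃ G ∈ W, H ∈ predBasis b rules G} W'

/-- The search that starts with the final graphs `F` stops with the working set `W`: it is reached
by finitely many rounds and a further round does not change it. -/
def SearchResult (b : URule ar → HGraph ar → ℕ) (rules : List (URule ar))
    (F W : List (HGraph ar)) : Prop :=
  Relation.ReflTransGen (SearchStep b rules) F W ∧ SearchStep b rules W W

/-! ### Codes, for computability -/

/-- Codes of graphs: the number of nodes and the list of edges. -/
abbrev GCode (Λ : Type) := ℕ × List (Λ × List ℕ)

/-- Codes of morphisms: the value tables on nodes and on edges. -/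
abbrev MCode := List (Option ℕ) × List (Option ℕ)

/-- Codes of rules: left- and right-hand side, the rule morphism, and the quantifications. -/
abbrev RCode (Λ : Type) :=
  (GCode Λ × GCode Λ × MCode) × List (GCode Λ × GCode Λ × MCode × MCode)

def HGraph.code (G : HGraph ar) : GCode Λ :=
  (G.nV, List.ofFn fun e => (G.lab e, (G.conn e).map Fin.val))

def homCode {G H : HGraph ar} (f : G ⟶ H) : MCode :=
  (List.ofFn fun v => (nodeMap f v).map Fin.val, List.ofFn fun e => (edgeMap f e).map Fin.val)

def UQuant.code {L : HGraph ar} (u : UQuant L) : GCode Λ × GCode Λ × MCode × MCode :=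
  (u.Lu.code, u.Ru.code, homCode u.p, homCode u.q)

def URule.code (ρ : URule ar) : RCode Λ :=
  ((ρ.L.code, ρ.R.code, homCode ρ.r), ρ.U.map UQuant.code)

/-- A bounding function for instantiations: a computable function of rule and graph that gives an
upper bound on the length of the instantiations needed for the backward step. -/
def IsBoundingFunction [Primcodable Λ] (b : URule ar → HGraph ar → ℕ) : Prop :=
  (∀ ρ G, IsInstBound ρ G (b ρ G)) ∧
    ∃ β : RCode Λ × GCode Λ → ℕ, Computable β ∧ ∀ ρ G, β (ρ.code, G.code) = b ρ G

end UGTS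

open UGTS

namespace UGTS
open CategoryTheory
variable {Λ : Type} {ar : Λ → ℕ}

/-! ### Elements of graphs -/

/-! All the categorical data is reduced to statements about single nodes and edges. A pushout of `δ`
along a total injective `m` is a gluing: the target of `δ`, together with the unmatched elements,
minus the unmatched edges that touch a deleted node (`isPushout_iff_isGluing`). In a backward step
the subgraph morphism and the map `m'` compose to one partial injection `h`, and minimality of the
complement says exactly that `g` is defined on every unmatched element (`mem_backApply_iff`). An
instantiation of length `k` amounts to `k` copies of quantified graphs that overlap only in the
elements coming from the rule itself, so a backward step becomes a family of `k` cells inside the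
two given graphs (`mem_backApply_iff_fam`).

Bound. A cell is alive if it contributes to `G` an element beyond those of the rule. Different alive
cells contribute different elements, so there are at most `G.size` of them. On the private elements
of a dead cell `g` is undefined; deleting them leaves a backward step with fewer cells whose result
is a subgraph of the old one (`IsBackFam.drop_dead`).

Basis. A result of a backward step from `G` can be rewritten to the pushout of its match, and the
mediating morphism shows that this pushout lies above `G`. Conversely, a step from `G'` to some `H`
above `G`, followed by the projection of `H` onto `G`, becomes a backward step once the unmatched
elements without image are cut off (`isBasis_predBasis`).

Search. Induction along a rewriting sequence gives the over-approximation. The upward closure of a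
working set depends only on the number of rounds, so halting does not depend on which
representatives minimization keeps (`searchStep_self_of_searchResult`).

Computability. Each element of a result lies in the copy of the left-hand side, lies in a cell, or
is determined by its image in `G`. This bounds the size of results (`IsBackFam.size_le`), and all
graphs up to that size can be tested, since the families of cells are finite objects ranging over
finite lists. Everything is primitive recursive except the bounding function; the search is an
unbounded search for the first stationary round.

Non-termination. A single rule moves a token along a directed step, and the final graph has token
and goal on one node. Every graph that the search finds contains a walk from a token to a goal, and
a subgraph of the directed path of length `n` that contains such a walk uses all `n + 1` nodes.
Since all these paths can cover the final graph, no finite working set represents them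
(`Walk.not_searchResult`). -/

/-- The elements of a graph: its nodes and its edges. -/
abbrev HGraph.Elt (G : HGraph ar) : Type := Fin G.nV ⊕ Fin G.nE

/-- The action of a morphism on nodes and edges. -/
def act {G H : HGraph ar} (f : G ⟶ H) : G.Elt → Option H.Elt
  | .inl v => (nodeMap f v).map .inl
  | .inr e => (edgeMap f e).map .inr

/-- The range of a morphism, as a set of elements. -/
def ran {G H : HGraph ar} (f : G ⟶ H) : Set H.Elt := {y | ∃ x, act f x = some y}

variable {G H K : HGraph ar}

theorem act_id (x : G.Elt) : act (𝟙 G) x = some x := by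
  cases x <;> rfl

theorem act_comp (f : G ⟶ H) (g : H ⟶ K) (x : G.Elt) :
    act (f ≫ g) x = (act f x).bind (act g) := by
  cases x with
  | inl v =>
    change ((nodeMap f v).bind (nodeMap g)).map _ = ((nodeMap f v).map _).bind _
    cases nodeMap f v <;> rfl
  | inr v =>
    change ((edgeMap f v).bind (edgeMap g)).map _ = ((edgeMap f v).map _).bind _
    cases edgeMap f v <;> rfl

theorem act_comp_some {f : G ⟶ H} {g : H ⟶ K} {x : G.Elt} {z : K.Elt} :
    act (f ≫ g) x = some z ↔ ∃ y, act f x = some y ∧ act g y = some z := by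
  rw [act_comp, Option.bind_eq_some_iff]

theorem act_comp_of_some {f : G ⟶ H} {x : G.Elt} {y : H.Elt} (h : act f x = some y) (g : H ⟶ K) :
    act (f ≫ g) x = act g y := by
  rw [act_comp, h]; rfl

theorem act_comp_of_none {f : G ⟶ H} {x : G.Elt} (h : act f x = none) (g : H ⟶ K) :
    act (f ≫ g) x = none := by
  rw [act_comp, h]; rfl

theorem act_inl_eq {f : G ⟶ H} {v : Fin G.nV} {w : Fin H.nV} :
    act f (.inl v) = some (.inl w) ↔ nodeMap f v = some w := by
  simp [act]

theorem act_inr_eq {f : G ⟶ H} {v : Fin G.nE} {w : Fin H.nE} :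
    act f (.inr v) = some (.inr w) ↔ edgeMap f v = some w := by
  simp [act]

theorem act_inl_some {f : G ⟶ H} {v : Fin G.nV} {y : H.Elt} (h : act f (.inl v) = some y) :
    ∃ w, y = .inl w ∧ nodeMap f v = some w := by
  simp only [act, Option.map_eq_some_iff] at h
  obtain ⟨w, h1, h2⟩ := h
  exact ⟨w, h2.symm, h1⟩

theorem act_inr_some {f : G ⟶ H} {v : Fin G.nE} {y : H.Elt} (h : act f (.inr v) = some y) :
    ∃ w, y = .inr w ∧ edgeMap f v = some w := by
  simp only [act, Option.map_eq_some_iff] at h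
  obtain ⟨w, h1, h2⟩ := h
  exact ⟨w, h2.symm, h1⟩

theorem act_eq_inl {f : G ⟶ H} {x : G.Elt} {w : Fin H.nV} (h : act f x = some (.inl w)) :
    ∃ v, x = .inl v ∧ nodeMap f v = some w := by
  cases x with
  | inl v => exact ⟨v, rfl, act_inl_eq.1 h⟩
  | inr v => obtain ⟨w, h, -⟩ := act_inr_some h; cases h

theorem act_eq_inr {f : G ⟶ H} {x : G.Elt} {w : Fin H.nE} (h : act f x = some (.inr w)) :
    ∃ v, x = .inr v ∧ edgeMap f v = some w := by
  cases x with
  | inr v => exact ⟨v, rfl, act_inr_eq.1 h⟩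
  | inl v => obtain ⟨w, h, -⟩ := act_inl_some h; cases h

theorem hom_ext_act {f g : G ⟶ H} (h : ∀ x, act f x = act g x) : f = g := by
  apply PHom.ext
  · funext v
    exact Option.map_injective Sum.inl_injective (h (.inl v))
  · funext v
    exact Option.map_injective Sum.inr_injective (h (.inr v))

theorem isTotalHom_iff {f : G ⟶ H} : IsTotalHom f ↔ ∀ x, ∃ y, act f x = some y := by
  simp [IsTotalHom, act]

theorem isInjHom_iff {f : G ⟶ H} :
    IsInjHom f ↔ ∀ x x' y, act f x = some y → act f x' = some y → x = x' := by
  constructor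
  · rintro ⟨h1, h2⟩ x x' y hx hx'
    cases y with
    | inl w =>
      obtain ⟨v, rfl, hv⟩ := act_eq_inl hx
      obtain ⟨v', rfl, hv'⟩ := act_eq_inl hx'
      rw [h1 v v' w hv hv']
    | inr w =>
      obtain ⟨v, rfl, hv⟩ := act_eq_inr hx
      obtain ⟨v', rfl, hv'⟩ := act_eq_inr hx'
      rw [h2 v v' w hv hv']
  · intro h
    exact ⟨fun v v' w hv hv' => Sum.inl_injective (h _ _ _ (act_inl_eq.2 hv) (act_inl_eq.2 hv')),
      fun v v' w hv hv' => Sum.inr_injective (h _ _ _ (act_inr_eq.2 hv) (act_inr_eq.2 hv'))⟩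

theorem isSurjHom_iff {f : G ⟶ H} : IsSurjHom f ↔ ∀ y, ∃ x, act f x = some y := by
  simp [IsSurjHom, act]

/-- The condition for a map on elements to preserve type, label and connection where `x` is sent
to `y`. -/
def Compat (a : G.Elt → Option H.Elt) : G.Elt → H.Elt → Prop
  | .inl _, .inl _ => True
  | .inr e, .inr e' => G.lab e = H.lab e' ∧
      (G.conn e).map (fun v => a (.inl v)) = (H.conn e').map (fun v => some (.inl v))
  | _, _ => False

theorem compat_act {f : G ⟶ H} {x : G.Elt} {y : H.Elt} (h : act f x = some y) :
    Compat (act f) x y := by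
  cases y with
  | inl w =>
    obtain ⟨v, rfl, hv⟩ := act_eq_inl h
    trivial
  | inr w =>
    obtain ⟨v, rfl, hv⟩ := act_eq_inr h
    refine ⟨f.lab_eq _ _ hv, ?_⟩
    have := congrArg (List.map (Option.map (Sum.inl (β := Fin H.nE)))) (f.conn_eq _ _ hv)
    simpa [List.map_map, Function.comp_def, act] using this

/-- `Compat` is false between a node and an edge, so `a` splits into a node part and an edge part.
Morphisms can therefore be built by a uniform argument on elements. -/
theorem exists_hom_of_compat (a : G.Elt → Option H.Elt) (h : ∀ x y, a x = some y → Compat a x y) :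
    ∃ f : G ⟶ H, ∀ x, act f x = a x := by
  have hV : ∀ v, ∃ o : Option (Fin H.nV), a (.inl v) = o.map .inl := by
    intro v
    cases hv : a (.inl v) with
    | none => exact ⟨none, rfl⟩
    | some y =>
      cases y with
      | inl w => exact ⟨some w, rfl⟩
      | inr w => exact (h _ _ hv).elim
  have hE : ∀ v, ∃ o : Option (Fin H.nE), a (.inr v) = o.map .inr := by
    intro v
    cases hv : a (.inr v) with
    | none => exact ⟨none, rfl⟩
    | some y =>
      cases y with
      | inr w => exact ⟨some w, rfl⟩
      | inl w => exact (h _ _ hv).elim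
  choose fV hfV using hV
  choose fE hfE using hE
  let f : PHom G H :=
    { onV := fV
      onE := fE
      lab_eq := fun e e' he => (h (.inr e) (.inr e') (by rw [hfE, he]; rfl)).1
      conn_eq := fun e e' he => by
        have h2 := (h (.inr e) (.inr e') (by rw [hfE, he]; rfl)).2
        apply List.map_injective_iff.2 (Option.map_injective (Sum.inl_injective (β := Fin H.nE)))
        simpa [List.map_map, Function.comp_def, hfV] using h2 }
  refine ⟨f, fun x => ?_⟩
  cases x with
  | inl v => exact (hfV v).symm
  | inr v => exact (hfE v).symm

theorem map_eq_map_some_of_factor {α β γ : Type*} {f : α → Option β} {g : α → Option γ}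
    {u : β → Option γ} (hu : ∀ a b, f a = some b → u b = g a) :
    ∀ {l : List α} {l' : List β} {l'' : List γ}, l.map f = l'.map some → l.map g = l''.map some →
      l'.map u = l''.map some
  | [], [], l'', _, h2 => by simpa using h2
  | a :: l, b :: l', [], _, h2 => by simp at h2
  | a :: l, b :: l', c :: l'', h1, h2 => by
    simp only [List.map_cons, List.cons.injEq] at h1 h2 ⊢
    exact ⟨(hu a b h1.1).trans h2.1, map_eq_map_some_of_factor hu h1.2 h2.2⟩
  | [], b :: l', _, h1, _ => by simp at h1
  | a :: l, [], _, h1, _ => by simp at h1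

/-- Structure that is preserved by `a` and by `b` is preserved by the factor `u`: labels agree with
those of the common source, and connection sequences are compared entry by entry. Gluing and partial
inversion both rest on this. -/
theorem compat_of_factor {a : G.Elt → Option H.Elt} {b : G.Elt → Option K.Elt}
    {u : H.Elt → Option K.Elt} (hu : ∀ x y, a x = some y → u y = b x) {x : G.Elt} {y : H.Elt}
    {z : K.Elt} (hy : Compat a x y) (hz : Compat b x z) : Compat u y z := by
  cases x with
  | inl v =>
    cases y with
    | inr _ => exact hy.elim
    | inl _ =>
      cases z with
      | inr _ => exact hz.elim
      | inl _ => trivial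
  | inr v =>
    cases y with
    | inl _ => exact hy.elim
    | inr e =>
      cases z with
      | inl _ => exact hz.elim
      | inr e' =>
        refine ⟨hy.1.symm.trans hz.1, ?_⟩
        have h1 := hy.2
        have h2 := hz.2
        have h1' : (G.conn v).map (fun v => a (.inl v)) = ((H.conn e).map .inl).map some := by
          simpa [List.map_map, Function.comp_def] using h1
        have h2' : (G.conn v).map (fun v => b (.inl v)) = ((K.conn e').map .inl).map some := by
          simpa [List.map_map, Function.comp_def] using h2
        simpa [List.map_map, Function.comp_def] using
          map_eq_map_some_of_factor (u := u) (fun _ _ h => hu _ _ h) h1' h2'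

/-- Gluing of morphisms along a jointly surjective family. -/
theorem exists_glue {I : Type} {S : I → HGraph ar} (s : ∀ i, S i ⟶ H) (t : ∀ i, S i ⟶ K)
    (cover : ∀ w : H.Elt, ∃ i x, act (s i) x = some w)
    (cons : ∀ i j x x' w, act (s i) x = some w → act (s j) x' = some w →
      act (t i) x = act (t j) x') :
    ∃ u : H ⟶ K, ∀ i x w, act (s i) x = some w → act u w = act (t i) x := by
  choose ci cx hc using cover
  have key : ∀ i x w, act (s i) x = some w → act (t (ci w)) (cx w) = act (t i) x :=
    fun i x w h => cons _ _ _ _ w (hc w) h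
  -- Each element takes its value from one chosen preimage. For an edge, the incident nodes have
  -- preimages in the same piece, and `key` says that their values may be computed there although
  -- other preimages were chosen for them.
  obtain ⟨u, hu⟩ := exists_hom_of_compat (fun w => act (t (ci w)) (cx w)) (by
    intro w y hy
    exact compat_of_factor (fun x y h => key (ci w) x y h) (compat_act (hc w)) (compat_act hy))
  exact ⟨u, fun i x w h => (hu w).trans (key i x w h)⟩

/-- Injective morphisms have partial inverses. -/
theorem exists_partialInverse (f : G ⟶ H) (hf : IsInjHom f) :
    ∃ f' : H ⟶ G, ∀ x y, act f' y = some x ↔ act f x = some y := by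
  classical
  rw [isInjHom_iff] at hf
  have h1 : ∀ y, ∃ o : Option G.Elt, ∀ x, o = some x ↔ act f x = some y := by
    intro y
    by_cases hy : ∃ x, act f x = some y
    · obtain ⟨x, hx⟩ := hy
      exact ⟨some x, fun x' => ⟨fun h => by cases h; exact hx,
        fun h => by rw [hf _ _ _ hx h]⟩⟩
    · push Not at hy
      exact ⟨none, fun x => ⟨fun h => (by cases h), fun h => (hy x h).elim⟩⟩
  choose a ha using h1
  obtain ⟨f', hf'⟩ := exists_hom_of_compat a (by
    intro y x hx
    have hx' := (ha _ _).1 hx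
    -- The inverse is the factor of the identity through `f`.
    exact compat_of_factor (b := act (𝟙 G)) (fun x y h => by rw [act_id, (ha _ _).2 h])
      (compat_act hx') (compat_act (act_id x)))
  exact ⟨f', fun x y => by rw [hf', ha]⟩

/-- Morphisms that are defined on an element are defined on the nodes incident to it. -/
theorem act_inl_of_conn {f : G ⟶ H} {e : Fin G.nE} {d : Fin H.nE}
    (h : act f (.inr e) = some (.inr d)) {v : Fin G.nV} (hv : v ∈ G.conn e) :
    ∃ w ∈ H.conn d, act f (.inl v) = some (.inl w) := by
  have h2 := (compat_act h).2
  have : act f (.inl v) ∈ (H.conn d).map (fun v => some (Sum.inl v)) := by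
    rw [← h2]; exact List.mem_map_of_mem hv
  obtain ⟨w, hw, hw'⟩ := List.mem_map.1 this
  exact ⟨w, hw, hw'.symm⟩

theorem exists_conn_of_act {f : G ⟶ H} {e : Fin G.nE} {d : Fin H.nE}
    (h : act f (.inr e) = some (.inr d)) {w : Fin H.nV} (hw : w ∈ H.conn d) :
    ∃ v ∈ G.conn e, act f (.inl v) = some (.inl w) := by
  have h2 := (compat_act h).2
  have : some (Sum.inl w) ∈ (G.conn e).map (fun v => act f (.inl v)) := by
    rw [h2]; exact List.mem_map_of_mem (f := fun v => some (Sum.inl v)) hw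
  obtain ⟨v, hv, hv'⟩ := List.mem_map.1 this
  exact ⟨v, hv, hv'⟩

theorem isTotalHom_comp {f : G ⟶ H} {g : H ⟶ K} (hf : IsTotalHom f) (hg : IsTotalHom g) :
    IsTotalHom (f ≫ g) := by
  rw [isTotalHom_iff] at *
  intro x
  obtain ⟨y, hy⟩ := hf x
  obtain ⟨z, hz⟩ := hg y
  exact ⟨z, act_comp_some.2 ⟨y, hy, hz⟩⟩

theorem isInjHom_comp {f : G ⟶ H} {g : H ⟶ K} (hf : IsInjHom f) (hg : IsInjHom g) :
    IsInjHom (f ≫ g) := by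
  rw [isInjHom_iff] at *
  intro x x' z hx hx'
  obtain ⟨y, h1, h2⟩ := act_comp_some.1 hx
  obtain ⟨y', h1', h2'⟩ := act_comp_some.1 hx'
  cases hg _ _ _ h2 h2'
  exact hf _ _ _ h1 h1'

theorem isSurjHom_comp {f : G ⟶ H} {g : H ⟶ K} (hf : IsSurjHom f) (hg : IsSurjHom g) :
    IsSurjHom (f ≫ g) := by
  rw [isSurjHom_iff] at *
  intro z
  obtain ⟨y, hy⟩ := hg z
  obtain ⟨x, hx⟩ := hf y
  exact ⟨x, act_comp_some.2 ⟨y, hx, hy⟩⟩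

theorem isTotalHom_id (G : HGraph ar) : IsTotalHom (𝟙 G) :=
  isTotalHom_iff.2 fun x => ⟨x, act_id x⟩

theorem isInjHom_id (G : HGraph ar) : IsInjHom (𝟙 G) := by
  rw [isInjHom_iff]
  intro x x' y h h'
  rw [act_id] at h h'
  cases h; cases h'; rfl

theorem isSurjHom_id (G : HGraph ar) : IsSurjHom (𝟙 G) :=
  isSurjHom_iff.2 fun x => ⟨x, act_id x⟩

theorem subOrder_refl (G : HGraph ar) : SubOrder G G :=
  ⟨𝟙 G, isInjHom_id G, isSurjHom_id G⟩

theorem subOrder_trans {G H K : HGraph ar} (h : SubOrder G H) (h' : SubOrder H K) :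
    SubOrder G K := by
  obtain ⟨f, hf⟩ := h
  obtain ⟨g, hg⟩ := h'
  exact ⟨g ≫ f, isInjHom_comp hg.1 hf.1, isSurjHom_comp hg.2 hf.2⟩

/-- The subgraph ordering in terms of total injective morphisms. -/
theorem subOrder_iff {G H : HGraph ar} :
    SubOrder G H ↔ ∃ f : G ⟶ H, IsTotalHom f ∧ IsInjHom f := by
  constructor
  · rintro ⟨f, hf, hf'⟩
    obtain ⟨g, hg⟩ := exists_partialInverse f hf
    rw [isInjHom_iff] at hf
    rw [isSurjHom_iff] at hf'
    refine ⟨g, isTotalHom_iff.2 fun x => ?_, isInjHom_iff.2 fun x x' y h h' => ?_⟩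
    · obtain ⟨y, hy⟩ := hf' x
      exact ⟨y, (hg _ _).2 hy⟩
    · rw [hg] at h h'
      exact Option.some_injective _ (h.symm.trans h')
  · rintro ⟨f, hf, hf'⟩
    obtain ⟨g, hg⟩ := exists_partialInverse f hf'
    rw [isInjHom_iff] at hf'
    rw [isTotalHom_iff] at hf
    refine ⟨g, isInjHom_iff.2 fun x x' y h h' => ?_, isSurjHom_iff.2 fun x => ?_⟩
    · rw [hg] at h h'
      exact Option.some_injective _ (h.symm.trans h')
    · obtain ⟨y, hy⟩ := hf x
      exact ⟨y, (hg _ _).2 hy⟩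

theorem isIso_of_bijective {f : G ⟶ H} (h1 : IsTotalHom f) (h2 : IsInjHom f) (h3 : IsSurjHom f) :
    IsIso f := by
  obtain ⟨g, hg⟩ := exists_partialInverse f h2
  rw [isTotalHom_iff] at h1
  rw [isSurjHom_iff] at h3
  refine ⟨g, hom_ext_act fun x => ?_, hom_ext_act fun y => ?_⟩
  · obtain ⟨y, hy⟩ := h1 x
    rw [act_id, act_comp_some]
    exact ⟨y, hy, (hg _ _).2 hy⟩
  · obtain ⟨x, hx⟩ := h3 y
    rw [act_id, act_comp_some]
    exact ⟨x, (hg _ _).2 hx, hx⟩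

theorem act_iso {f : G ⟶ H} {g : H ⟶ G} (h1 : f ≫ g = 𝟙 G) (x : G.Elt) :
    ∃ y, act f x = some y ∧ act g y = some x := by
  have : act (f ≫ g) x = some x := by rw [h1, act_id]
  exact act_comp_some.1 this

theorem isTotalHom_of_isIso (f : G ⟶ H) [IsIso f] : IsTotalHom f :=
  isTotalHom_iff.2 fun x => (act_iso (IsIso.hom_inv_id f) x).imp fun _ h => h.1

theorem isInjHom_of_isIso (f : G ⟶ H) [IsIso f] : IsInjHom f := by
  rw [isInjHom_iff]
  intro x x' y hx hx'
  obtain ⟨z, h1, h2⟩ := act_iso (IsIso.hom_inv_id f) x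
  obtain ⟨z', h1', h2'⟩ := act_iso (IsIso.hom_inv_id f) x'
  cases hx.symm.trans h1
  cases hx'.symm.trans h1'
  exact Option.some_injective _ (h2.symm.trans h2')

theorem isSurjHom_of_isIso (f : G ⟶ H) [IsIso f] : IsSurjHom f :=
  isSurjHom_iff.2 fun y => (act_iso (IsIso.inv_hom_id f) y).imp fun _ h => h.2

/-! ### Graphs on arbitrary finite types, and subgraphs -/

/-- Transport along numberings of `V` and `E`; it makes subtypes and sums available as carriers of
graphs. -/
theorem exists_graph {V E : Type} [Finite V] [Finite E] (lab : E → Λ) (conn : E → List V)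
    (len : ∀ e, (conn e).length = ar (lab e)) :
    ∃ (H : HGraph ar) (eV : V ≃ Fin H.nV) (eE : E ≃ Fin H.nE),
      ∀ e, H.lab (eE e) = lab e ∧ H.conn (eE e) = (conn e).map eV := by
  obtain ⟨n, ⟨eV⟩⟩ := Finite.exists_equiv_fin V
  obtain ⟨k, ⟨eE⟩⟩ := Finite.exists_equiv_fin E
  refine ⟨⟨n, k, fun e => lab (eE.symm e), fun e => (conn (eE.symm e)).map eV, fun e => by
    simp [len]⟩, eV, eE, fun e => by simp⟩

/-- The subgraph on a set of elements that contains the nodes incident to its edges. -/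
theorem exists_subgraph (G : HGraph ar) (P : Set G.Elt)
    (hP : ∀ e, Sum.inr e ∈ P → ∀ v ∈ G.conn e, Sum.inl v ∈ P) :
    ∃ (H : HGraph ar) (i : H ⟶ G), IsTotalHom i ∧ IsInjHom i ∧ ran i = P := by
  classical
  obtain ⟨H, eV, eE, hH⟩ := exists_graph (ar := ar) (V := {v // Sum.inl v ∈ P})
    (E := {e // Sum.inr e ∈ P}) (fun e => G.lab e.1)
    (fun e => (G.conn e.1).pmap Subtype.mk (hP e.1 e.2)) (fun e => by simp [G.length_conn])
  have hH' : ∀ d, H.lab d = G.lab (eE.symm d).1 ∧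
      (H.conn d).map (fun w => (eV.symm w).1) = G.conn (eE.symm d).1 := by
    intro d
    obtain ⟨e, rfl⟩ := eE.surjective d
    rw [(hH e).1, (hH e).2]
    simp [List.map_pmap]
  let i : PHom H G :=
    { onV := fun w => some (eV.symm w).1
      onE := fun d => some (eE.symm d).1
      lab_eq := fun d e h => by
        cases h
        exact (hH' d).1
      conn_eq := fun d e h => by
        cases h
        rw [← (hH' d).2, List.map_map]
        rfl }
  refine ⟨H, i, ⟨fun v => ⟨_, rfl⟩, fun e => ⟨_, rfl⟩⟩, ⟨?_, ?_⟩, ?_⟩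
  · intro v v' w h h'
    have : (eV.symm v).1 = (eV.symm v').1 := Option.some_injective _ (h.trans h'.symm)
    exact eV.symm.injective (Subtype.ext this)
  · intro v v' w h h'
    have : (eE.symm v).1 = (eE.symm v').1 := Option.some_injective _ (h.trans h'.symm)
    exact eE.symm.injective (Subtype.ext this)
  · ext y
    constructor
    · rintro ⟨x, hx⟩
      cases x with
      | inl v => cases hx; exact (eV.symm v).2
      | inr v => cases hx; exact (eE.symm v).2
    · intro hy
      cases y with
      | inl v => exact ⟨.inl (eV ⟨v, hy⟩), by simp [act, nodeMap, i]⟩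
      | inr v => exact ⟨.inr (eE ⟨v, hy⟩), by simp [act, edgeMap, i]⟩

/-- Subgraphs together with the partial projection onto them. -/
theorem exists_subgraph_proj (G : HGraph ar) (P : Set G.Elt)
    (hP : ∀ e, Sum.inr e ∈ P → ∀ v ∈ G.conn e, Sum.inl v ∈ P) :
    ∃ (H : HGraph ar) (i : H ⟶ G) (s : G ⟶ H), IsTotalHom i ∧ IsInjHom i ∧ ran i = P ∧
      IsSubgraphHom s ∧ ∀ x y, act s y = some x ↔ act i x = some y := by
  obtain ⟨H, i, h1, h2, h3⟩ := exists_subgraph G P hP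
  obtain ⟨s, hs⟩ := exists_partialInverse i h2
  refine ⟨H, i, s, h1, h2, h3, ⟨?_, ?_⟩, hs⟩
  · rw [isInjHom_iff]
    intro y y' x h h'
    rw [hs] at h h'
    exact Option.some_injective _ (h.symm.trans h')
  · rw [isSurjHom_iff]
    intro x
    obtain ⟨y, hy⟩ := isTotalHom_iff.1 h1 x
    exact ⟨y, (hs _ _).2 hy⟩

/-- Injective partial morphisms factor through a subgraph morphism and a total injective one. -/
theorem exists_image (f : G ⟶ H) (hf : IsInjHom f) :
    ∃ (K : HGraph ar) (s : G ⟶ K) (i : K ⟶ H), IsSubgraphHom s ∧ IsTotalHom i ∧ IsInjHom i ∧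
      s ≫ i = f := by
  -- The range of a morphism is closed under passing from an edge to its nodes, because a morphism
  -- defined on an edge is defined on the incident nodes.
  obtain ⟨K, i, s, h1, h2, h3, h4, h5⟩ := exists_subgraph_proj H (ran f) (by
    rintro e ⟨x, hx⟩ v hv
    obtain ⟨d, rfl, hd⟩ := act_eq_inr hx
    obtain ⟨w, -, hw⟩ := exists_conn_of_act hx hv
    exact ⟨_, hw⟩)
  refine ⟨K, f ≫ s, i, ⟨isInjHom_comp hf h4.1, isSurjHom_iff.2 fun x => ?_⟩, h1, h2, ?_⟩
  · obtain ⟨y, hy⟩ := isTotalHom_iff.1 h1 x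
    have : y ∈ ran f := h3 ▸ ⟨x, hy⟩
    obtain ⟨z, hz⟩ := this
    exact ⟨z, act_comp_some.2 ⟨y, hz, (h5 _ _).2 hy⟩⟩
  · apply hom_ext_act
    intro x
    cases hx : act f x with
    | none => exact act_comp_of_none (act_comp_of_none hx _) _
    | some y =>
      have : y ∈ ran i := h3 ▸ ⟨x, hx⟩
      obtain ⟨z, hz⟩ := this
      exact act_comp_some.2 ⟨z, act_comp_some.2 ⟨y, hx, (h5 _ _).2 hz⟩, hz⟩

end UGTS

namespace UGTS
open CategoryTheory
variable {Λ : Type} {ar : Λ → ℕ}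

/-! ### Pushouts along total injective morphisms -/

/-- Elementwise description of the pushout of a partial morphism `δ` and a total injective
morphism `m`: the elements outside of the range of `m` are added to `B`, except for the edges
with a node that is deleted. -/
structure IsGluing {A B C D : HGraph ar} (δ : A ⟶ B) (m : A ⟶ C) (n : B ⟶ D) (d : C ⟶ D) :
    Prop where
  comm : δ ≫ n = m ≫ d
  total : IsTotalHom n
  inj : IsInjHom n
  node_defined : ∀ v, Sum.inl v ∉ ran m → ∃ w, act d (.inl v) = some w
  edge_defined : ∀ e, Sum.inr e ∉ ran m → (∀ v ∈ C.conn e, ∃ w, act d (.inl v) = some w) →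
    ∃ w, act d (.inr e) = some w
  inj_outside : ∀ x x' w, x ∉ ran m → x' ∉ ran m → act d x = some w → act d x' = some w → x = x'
  disjoint : ∀ x w, x ∉ ran m → act d x = some w → w ∉ ran n
  cover : ∀ w, w ∈ ran n ∨ ∃ x, x ∉ ran m ∧ act d x = some w

variable {A B C D X : HGraph ar} {δ : A ⟶ B} {m : A ⟶ C} {n : B ⟶ D} {d : C ⟶ D}

namespace IsGluing

theorem jointly_epi (h : IsGluing δ m n d) {u u' : D ⟶ X} (h1 : n ≫ u = n ≫ u')
    (h2 : d ≫ u = d ≫ u') : u = u' := by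
  apply hom_ext_act
  intro w
  rcases h.cover w with ⟨b, hb⟩ | ⟨x, -, hx⟩
  · rw [← act_comp_of_some hb, h1, act_comp_of_some hb]
  · rw [← act_comp_of_some hx, h2, act_comp_of_some hx]

/-- An element of `D` is the image of an element of `B` or of an unmatched element of `C`, which
prescribes its value by `f` or by `g`; where both apply they agree by commutativity. The delicate
part is `d ≫ u = g` where `d` is undefined: there `g` has to be undefined as well. -/
theorem exists_desc (h : IsGluing δ m n d) (f : B ⟶ X) (g : C ⟶ X)
    (hfg : δ ≫ f = m ≫ g) : ∃ u : D ⟶ X, n ≫ u = f ∧ d ≫ u = g := by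
  have hinj := isInjHom_iff.1 h.inj
  have hdn : ∀ x b w, act d x = some w → act n b = some w → act g x = act f b := by
    intro x b w hx hb
    by_cases hxm : x ∈ ran m
    · obtain ⟨a, ha⟩ := hxm
      have h1 : act (δ ≫ n) a = some w := by rw [h.comm, act_comp_of_some ha, hx]
      obtain ⟨b', h2, h3⟩ := act_comp_some.1 h1
      cases hinj _ _ _ hb h3
      rw [← act_comp_of_some ha, ← hfg, act_comp_of_some h2]
    · exact (h.disjoint x w hxm hx ⟨b, hb⟩).elim
  have hdd : ∀ x x' w, act d x = some w → act d x' = some w → act g x = act g x' := by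
    intro x x' w hx hx'
    by_cases hw : w ∈ ran n
    · obtain ⟨b, hb⟩ := hw
      rw [hdn x b w hx hb, hdn x' b w hx' hb]
    · have : ∀ x, act d x = some w → x ∉ ran m := by
        rintro x hx ⟨a, ha⟩
        have h1 : act (δ ≫ n) a = some w := by rw [h.comm, act_comp_of_some ha, hx]
        obtain ⟨b', h2, h3⟩ := act_comp_some.1 h1
        exact hw ⟨b', h3⟩
      rw [h.inj_outside x x' w (this x hx) (this x' hx') hx hx']
  let S : Bool → HGraph ar := fun i => cond i B C
  let s : ∀ i, S i ⟶ D := fun i => match i with | true => n | false => d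
  let t : ∀ i, S i ⟶ X := fun i => match i with | true => f | false => g
  obtain ⟨u, hu⟩ := exists_glue s t (by
    intro w
    rcases h.cover w with ⟨b, hb⟩ | ⟨x, -, hx⟩
    · exact ⟨true, b, hb⟩
    · exact ⟨false, x, hx⟩) (by
    intro i j x x' w hx hx'
    cases i <;> cases j
    · exact hdd x x' w hx hx'
    · exact hdn x x' w hx hx'
    · exact (hdn x' x w hx' hx).symm
    · cases hinj x x' w hx hx'
      rfl)
  have hun := hu true
  have hud := hu false
  refine ⟨u, hom_ext_act fun b => ?_, hom_ext_act fun x => ?_⟩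
  · obtain ⟨w, hw⟩ := isTotalHom_iff.1 h.total b
    rw [act_comp_of_some hw, hun b w hw]
  · cases hx : act d x with
    | some w => rw [act_comp_of_some hx, hud x w hx]
    | none =>
      rw [act_comp_of_none hx]
      -- A matched element on which `d` is undefined is deleted by `δ`, since `n` is total; then
      -- commutativity makes `g` undefined on it.
      have hran : ∀ x, x ∈ ran m → act d x = none → act g x = none := by
        rintro x ⟨a, ha⟩ hx
        have h1 : act (δ ≫ n) a = none := by rw [h.comm, act_comp_of_some ha, hx]
        have h2 : act δ a = none := by
          cases hb : act δ a with
          | none => rfl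
          | some b =>
            obtain ⟨w, hw⟩ := isTotalHom_iff.1 h.total b
            rw [act_comp_of_some hb, hw] at h1
            cases h1
        rw [← act_comp_of_some ha, ← hfg, act_comp_of_none h2]
      by_cases hxm : x ∈ ran m
      · exact (hran x hxm hx).symm
      · cases x with
        | inl v =>
          obtain ⟨w, hw⟩ := h.node_defined v hxm
          rw [hx] at hw; cases hw
        | inr e =>
          -- An unmatched edge disappears only because of an incident node. That node is matched and
          -- deleted, so `g` is undefined on it and cannot be defined on the edge.
          have : ∃ v ∈ C.conn e, act d (.inl v) = none := by
            by_contra hcon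
            push Not at hcon
            obtain ⟨w, hw⟩ := h.edge_defined e hxm fun v hv =>
              Option.ne_none_iff_exists'.1 (hcon v hv)
            rw [hx] at hw; cases hw
          obtain ⟨v, hv, hvn⟩ := this
          have hvm : Sum.inl v ∈ ran m := by
            by_contra hvm
            obtain ⟨w, hw⟩ := h.node_defined v hvm
            rw [hvn] at hw; cases hw
          have hgv := hran _ hvm hvn
          cases hge : act g (.inr e) with
          | none => rfl
          | some y =>
            obtain ⟨e', rfl, -⟩ := act_inr_some hge
            obtain ⟨w, -, hw⟩ := act_inl_of_conn hge hv
            rw [hgv] at hw; cases hw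

theorem isPushout (h : IsGluing δ m n d) : IsPushout δ m n d := by
  refine ⟨⟨h.comm⟩, ⟨Limits.PushoutCocone.IsColimit.mk _
    (fun s => (h.exists_desc s.inl s.inr s.condition).choose)
    (fun s => (h.exists_desc s.inl s.inr s.condition).choose_spec.1)
    (fun s => (h.exists_desc s.inl s.inr s.condition).choose_spec.2)
    (fun s u h1 h2 => h.jointly_epi ?_ ?_)⟩⟩
  · rw [h1, (h.exists_desc s.inl s.inr s.condition).choose_spec.1]
  · rw [h2, (h.exists_desc s.inl s.inr s.condition).choose_spec.2]

end IsGluing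

theorem exists_map_some {α β : Type*} {f : α → Option β} {l : List α}
    (h : ∀ a ∈ l, ∃ b, f a = some b) : l.map f = (l.filterMap f).map some := by
  induction l with
  | nil => rfl
  | cons a l ih =>
    obtain ⟨b, hb⟩ := h a (by simp)
    rw [List.filterMap_cons_some hb, List.map_cons, List.map_cons, hb,
      ih fun a' ha' => h a' (by simp [ha'])]

/-- Pushouts along total injective morphisms exist. -/
theorem exists_gluing (δ : A ⟶ B) (m : A ⟶ C) (hm : IsTotalHom m) (hm' : IsInjHom m) :
    ∃ (D : HGraph ar) (n : B ⟶ D) (d : C ⟶ D), IsGluing δ m n d := by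
  classical
  obtain ⟨m', hmm⟩ := exists_partialInverse m hm'
  -- On matched elements `d` has to undo `m` and then apply `δ`; unmatched nodes survive as
  -- themselves, and unmatched edges survive if all their nodes do.
  let V := Fin B.nV ⊕ {v : Fin C.nV // Sum.inl v ∉ ran m}
  let dV : Fin C.nV → Option V := fun v =>
    if h : Sum.inl v ∈ ran m then ((nodeMap (m' ≫ δ) v).map .inl) else some (.inr ⟨v, h⟩)
  let E := Fin B.nE ⊕
    {e : Fin C.nE // Sum.inr e ∉ ran m ∧ ∀ v ∈ C.conn e, ∃ w, dV v = some w}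
  let dE : Fin C.nE → Option E := fun e =>
    if h : Sum.inr e ∈ ran m then ((edgeMap (m' ≫ δ) e).map .inl) else
      if h' : ∀ v ∈ C.conn e, ∃ w, dV v = some w then some (.inr ⟨e, h, h'⟩) else none
  let lab : E → Λ := Sum.elim B.lab (fun e => C.lab e.1)
  let conn : E → List V := Sum.elim (fun e => (B.conn e).map .inl)
    (fun e => (C.conn e.1).filterMap dV)
  obtain ⟨D, eV, eE, hD⟩ := exists_graph (ar := ar) lab conn (by
    rintro (e | e)
    · simp [conn, lab, B.length_conn]
    · have := congrArg List.length (exists_map_some e.2.2)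
      simp only [List.length_map] at this
      simp only [conn, lab, Sum.elim_inr]
      rw [← this, C.length_conn])
  have hV1 : ∀ v, Sum.inl v ∈ ran m → dV v = (nodeMap (m' ≫ δ) v).map .inl := fun v h => dif_pos h
  have hV2 : ∀ v (h : Sum.inl v ∉ ran m), dV v = some (.inr ⟨v, h⟩) := fun v h => dif_neg h
  have hE1 : ∀ e, Sum.inr e ∈ ran m → dE e = (edgeMap (m' ≫ δ) e).map .inl := fun v h => dif_pos h
  have hE2 : ∀ e (h : Sum.inr e ∉ ran m) (h' : ∀ v ∈ C.conn e, ∃ w, dV v = some w),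
      dE e = some (.inr ⟨e, h, h'⟩) := fun v h h' => by
    simp only [dE]
    rw [dif_neg h, dif_pos h']
  have hE3 : ∀ e, Sum.inr e ∉ ran m → ¬ (∀ v ∈ C.conn e, ∃ w, dV v = some w) →
      dE e = none := fun v h h' => by
    simp only [dE]
    rw [dif_neg h, dif_neg h']
  have hm'ran : ∀ x y, act m' y = some x → y ∈ ran m := fun x y h => ⟨x, (hmm _ _).1 h⟩
  let n : PHom B D :=
    { onV := fun b => some (eV (.inl b))
      onE := fun b => some (eE (.inl b))
      lab_eq := fun e e' h => by
        cases h
        rw [(hD _).1]; rfl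
      conn_eq := fun e e' h => by
        cases h
        rw [(hD _).2]
        simp [conn] }
  have hdEcases : ∀ e w, dE e = some w → lab w = C.lab e ∧ (C.conn e).map dV = (conn w).map some := by
    intro e w hw
    by_cases he : Sum.inr e ∈ ran m
    · rw [hE1 e he, Option.map_eq_some_iff] at hw
      obtain ⟨b, hb, rfl⟩ := hw
      refine ⟨((m' ≫ δ).lab_eq _ _ hb).symm, ?_⟩
      have h1 := (m' ≫ δ).conn_eq _ _ hb
      have h2 : ∀ v ∈ C.conn e, dV v = ((m' ≫ δ).onV v).map .inl := by
        intro v hv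
        obtain ⟨w, -, hw⟩ := act_inl_of_conn (act_inr_eq.2 hb) hv
        obtain ⟨x, hx, -⟩ := act_comp_some.1 hw
        exact hV1 v (hm'ran _ _ hx)
      rw [List.map_congr_left h2]
      have h3 := congrArg (List.map (Option.map (Sum.inl : Fin B.nV → V))) h1
      rw [List.map_map] at h3
      refine h3.trans ?_
      simp [conn]
    · by_cases h' : ∀ v ∈ C.conn e, ∃ w, dV v = some w
      · rw [hE2 e he h'] at hw
        cases hw
        exact ⟨rfl, exists_map_some h'⟩
      · rw [hE3 e he h'] at hw
        cases hw
  let d : PHom C D :=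
    { onV := fun v => (dV v).map eV
      onE := fun e => (dE e).map eE
      lab_eq := fun e e' h => by
        obtain ⟨w, hw, rfl⟩ := Option.map_eq_some_iff.1 h
        rw [(hD _).1, (hdEcases e w hw).1]
      conn_eq := fun e e' h => by
        obtain ⟨w, hw, rfl⟩ := Option.map_eq_some_iff.1 h
        have h3 := congrArg (List.map (Option.map eV)) (hdEcases e w hw).2
        rw [List.map_map] at h3
        rw [(hD _).2]
        refine h3.trans ?_
        simp }
  have actdV : ∀ v, act (G := C) (H := D) d (.inl v) = (dV v).map (fun w => .inl (eV w)) := by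
    intro v
    simp [act, nodeMap, d, Function.comp_def]
  have actdE : ∀ v, act (G := C) (H := D) d (.inr v) = (dE v).map (fun w => .inr (eE w)) := by
    intro v
    simp [act, edgeMap, d, Function.comp_def]
  have out : ∀ x y, x ∉ ran m → act (G := C) (H := D) d x = some y →
      (∃ v h, x = .inl v ∧ y = .inl (eV (.inr ⟨v, h⟩))) ∨
        (∃ e h, x = .inr e ∧ y = .inr (eE (.inr ⟨e, h⟩))) := by
    intro x y hx hy
    cases x with
    | inl v =>
      rw [actdV, hV2 v hx] at hy
      cases hy
      exact .inl ⟨v, hx, rfl, rfl⟩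
    | inr e =>
      rw [actdE] at hy
      by_cases h' : ∀ v ∈ C.conn e, ∃ w, dV v = some w
      · rw [hE2 e hx h'] at hy
        cases hy
        exact .inr ⟨e, ⟨hx, h'⟩, rfl, rfl⟩
      · rw [hE3 e hx h'] at hy
        cases hy
  refine ⟨D, n, d, ?_, ?_, ?_, ?_, ?_, ?_, ?_, ?_⟩
  · apply hom_ext_act
    intro a
    obtain ⟨x, hx⟩ := isTotalHom_iff.1 hm a
    have hx' := (hmm _ _).2 hx
    rw [act_comp_of_some hx]
    have h1 := act_comp_of_some hx' δ
    cases x with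
    | inl v =>
      obtain ⟨a, rfl, -⟩ := act_eq_inl hx
      rw [actdV, hV1 v ⟨_, hx⟩, act_comp, ← h1]
      simp only [act]
      cases nodeMap (m' ≫ δ) v <;> rfl
    | inr v =>
      obtain ⟨a, rfl, -⟩ := act_eq_inr hx
      rw [actdE, hE1 v ⟨_, hx⟩, act_comp, ← h1]
      simp only [act]
      cases edgeMap (m' ≫ δ) v <;> rfl
  · exact ⟨fun v => ⟨_, rfl⟩, fun v => ⟨_, rfl⟩⟩
  · refine ⟨fun v v' w h h' => ?_, fun v v' w h h' => ?_⟩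
    · exact Sum.inl_injective (eV.injective (Option.some_injective _ (h.trans h'.symm)))
    · exact Sum.inl_injective (eE.injective (Option.some_injective _ (h.trans h'.symm)))
  · intro v hv
    exact ⟨_, by rw [actdV, hV2 v hv]; rfl⟩
  · intro e he hc
    refine ⟨_, by
      rw [actdE, hE2 e he fun v hv => ?_]
      · rfl
      obtain ⟨w, hw⟩ := hc v hv
      rw [actdV, Option.map_eq_some_iff] at hw
      exact ⟨_, hw.choose_spec.1⟩⟩
  · intro x x' w hx hx' hw hw'
    rcases out x w hx hw with ⟨v, h, rfl, rfl⟩ | ⟨v, h, rfl, rfl⟩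
    · rcases out x' _ hx' hw' with ⟨v', h', rfl, h2⟩ | ⟨v', h', rfl, h2⟩
      · cases eV.injective (Sum.inl_injective h2)
        rfl
      · cases h2
    · rcases out x' _ hx' hw' with ⟨v', h', rfl, h2⟩ | ⟨v', h', rfl, h2⟩
      · cases h2
      · cases eE.injective (Sum.inr_injective h2)
        rfl
  · rintro x w hx hw ⟨b, hb⟩
    rcases out x w hx hw with ⟨v, h, rfl, rfl⟩ | ⟨v, h, rfl, rfl⟩
    · obtain ⟨b, rfl, hb'⟩ := act_eq_inl hb
      have := eV.injective (Option.some_injective _ hb')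
      cases this
    · obtain ⟨b, rfl, hb'⟩ := act_eq_inr hb
      have := eE.injective (Option.some_injective _ hb')
      cases this
  · rintro (w | w)
    · obtain ⟨w, rfl⟩ := eV.surjective w
      rcases w with w | w
      · exact .inl ⟨.inl w, rfl⟩
      · exact .inr ⟨.inl w.1, w.2, by rw [actdV, hV2 _ w.2]; rfl⟩
    · obtain ⟨w, rfl⟩ := eE.surjective w
      rcases w with w | w
      · exact .inl ⟨.inr w, rfl⟩
      · exact .inr ⟨.inr w.1, w.2.1, by rw [actdE, hE2 _ w.2.1 w.2.2]; rfl⟩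

theorem IsGluing.comp_iso (h : IsGluing δ m n d) (f : D ⟶ X) [IsIso f] :
    IsGluing δ m (n ≫ f) (d ≫ f) := by
  have h1 := isTotalHom_iff.1 (isTotalHom_of_isIso f)
  have h2 := isInjHom_iff.1 (isInjHom_of_isIso f)
  have h3 := isSurjHom_iff.1 (isSurjHom_of_isIso f)
  refine ⟨by rw [← Category.assoc, h.comm, Category.assoc],
    isTotalHom_comp h.total (isTotalHom_of_isIso f), isInjHom_comp h.inj (isInjHom_of_isIso f),
    ?_, ?_, ?_, ?_, ?_⟩
  · intro v hv
    obtain ⟨w, hw⟩ := h.node_defined v hv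
    rw [act_comp_of_some hw]
    exact h1 w
  · intro e he hc
    obtain ⟨w, hw⟩ := h.edge_defined e he fun v hv => by
      obtain ⟨w, hw⟩ := hc v hv
      obtain ⟨y, hy, -⟩ := act_comp_some.1 hw
      exact ⟨y, hy⟩
    rw [act_comp_of_some hw]
    exact h1 w
  · intro x x' w hx hx' hw hw'
    obtain ⟨y, hy, hyw⟩ := act_comp_some.1 hw
    obtain ⟨y', hy', hyw'⟩ := act_comp_some.1 hw'
    cases h2 _ _ _ hyw hyw'
    exact h.inj_outside x x' y hx hx' hy hy'
  · rintro x w hx hw ⟨b, hb⟩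
    obtain ⟨y, hy, hyw⟩ := act_comp_some.1 hw
    obtain ⟨y', hy', hyw'⟩ := act_comp_some.1 hb
    cases h2 _ _ _ hyw hyw'
    exact h.disjoint x y hx hy ⟨b, hy'⟩
  · intro w
    obtain ⟨y, hy⟩ := h3 w
    rcases h.cover y with ⟨b, hb⟩ | ⟨x, hx, hxy⟩
    · exact .inl ⟨b, act_comp_some.2 ⟨y, hb, hy⟩⟩
    · exact .inr ⟨x, hx, act_comp_some.2 ⟨y, hxy, hy⟩⟩

/-- Pushouts along total injective morphisms are given by the elementwise description. -/
theorem isPushout_iff_isGluing (hm : IsTotalHom m) (hm' : IsInjHom m) :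
    IsPushout δ m n d ↔ IsGluing δ m n d := by
  refine ⟨fun h => ?_, fun h => h.isPushout⟩
  -- Pushouts are unique up to isomorphism and the elementwise conditions are invariant under it, so
  -- the constructed gluing describes every pushout.
  obtain ⟨D', n', d', h'⟩ := exists_gluing δ m hm hm'
  let i := h'.isPushout.isoIsPushout _ _ h
  have h1 : n' ≫ i.hom = n := IsPushout.inl_isoIsPushout_hom _ _ _ _
  have h2 : d' ≫ i.hom = d := IsPushout.inr_isoIsPushout_hom _ _ _ _
  rw [← h1, ← h2]
  exact h'.comp_iso i.hom

end UGTS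

namespace UGTS
open CategoryTheory
variable {Λ : Type} {ar : Λ → ℕ}

/-! ### Backward steps, elementwise -/

/-- A match `m`, a partial injective `h` and a partial `g` that form a commutative square in which
the elements outside of the range of `m` are mapped injectively by `g`, onto the complement of the
range of `h`, as far as `g` is defined. -/
structure IsPreStep {L' R' G G' : HGraph ar} (γ : L' ⟶ R') (h : R' ⟶ G) (m : L' ⟶ G')
    (g : G' ⟶ G) : Prop where
  inj_h : IsInjHom h
  total : IsTotalHom m
  inj : IsInjHom m
  comm : γ ≫ h = m ≫ g
  inj_outside : ∀ x x' w, x ∉ ran m → x' ∉ ran m → act g x = some w → act g x' = some w → x = x'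
  disjoint : ∀ x w, x ∉ ran m → act g x = some w → w ∉ ran h
  cover : ∀ w, w ∈ ran h ∨ ∃ x, x ∉ ran m ∧ act g x = some w

/-- The elementwise description of backward steps with a given instantiation: `g` is defined on
all elements that are not matched. -/
structure IsBackStep {L' R' G G' : HGraph ar} (γ : L' ⟶ R') (h : R' ⟶ G) (m : L' ⟶ G')
    (g : G' ⟶ G) : Prop extends IsPreStep γ h m g where
  defined : ∀ x, x ∉ ran m → ∃ w, act g x = some w

variable {L' R' R'' G G' : HGraph ar} {γ : L' ⟶ R'} {h : R' ⟶ G} {m : L' ⟶ G'} {g : G' ⟶ G}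

theorem appCond_iff {ρ : URule ar} {π : ρ.L ⟶ L'} :
    AppCond ρ π m ↔ ∀ x ∈ ρ.qNodes, ∀ v, act (π ≫ m) (.inl x) = some (.inl v) →
      ∀ e, v ∈ G'.conn e → Sum.inr e ∈ ran m := by
  simp only [AppCond, act_inl_eq]
  constructor
  · intro h x hx v hv e he
    obtain ⟨e', he'⟩ := h x hx v hv e he
    exact ⟨.inr e', act_inr_eq.2 he'⟩
  · intro h x hx v hv e he
    obtain ⟨y, hy⟩ := h x hx v hv e he
    obtain ⟨e', rfl, he'⟩ := act_eq_inr hy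
    exact ⟨e', he'⟩

/-- The unmatched elements on which `g` is undefined can be removed. -/
theorem IsPreStep.exists_backStep (hs : IsPreStep γ h m g) :
    ∃ (G'' : HGraph ar) (i : G'' ⟶ G') (s : G' ⟶ G''), IsSubgraphHom s ∧ IsTotalHom i ∧
      (∀ x y, act s y = some x ↔ act i x = some y) ∧ IsBackStep γ h (m ≫ s) (i ≫ g) ∧
      s ≫ i ≫ g = g := by
  -- What is kept is the range of the match and the domain of `g`. Both contain the nodes of their
  -- edges.
  obtain ⟨G'', i, s, h1, h2, h3, h4, h5⟩ := exists_subgraph_proj G'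
    (ran m ∪ {x | ∃ w, act g x = some w}) (by
      rintro e he v hv
      rcases he with ⟨x, hx⟩ | ⟨w, hw⟩
      · obtain ⟨d, rfl, -⟩ := act_eq_inr hx
        obtain ⟨w, -, hw⟩ := exists_conn_of_act hx hv
        exact .inl ⟨_, hw⟩
      · obtain ⟨d, rfl, -⟩ := act_inr_some hw
        obtain ⟨w, -, hw⟩ := act_inl_of_conn hw hv
        exact .inr ⟨_, hw⟩)
  have hsran : ∀ x, x ∈ ran m ∪ {x | ∃ w, act g x = some w} → ∃ y, act s x = some y := by
    intro x hx
    rw [← h3] at hx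
    exact hx.imp fun y hy => (h5 _ _).2 hy
  have hm_s : ∀ x y, act i x = some y → (x ∈ ran (m ≫ s) ↔ y ∈ ran m) := by
    intro x y hxy
    constructor
    · rintro ⟨a, ha⟩
      obtain ⟨y', hy', hs'⟩ := act_comp_some.1 ha
      rw [h5, hxy] at hs'
      cases hs'
      exact ⟨a, hy'⟩
    · rintro ⟨a, ha⟩
      exact ⟨a, act_comp_some.2 ⟨y, ha, (h5 _ _).2 hxy⟩⟩
  have hi := isTotalHom_iff.1 h1
  have hi' := isInjHom_iff.1 h2
  have hsig : s ≫ i ≫ g = g := by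
    apply hom_ext_act
    intro x
    cases hx : act g x with
    | some w =>
      obtain ⟨y, hy⟩ := hsran x (.inr ⟨w, hx⟩)
      rw [act_comp_of_some hy, act_comp_of_some ((h5 _ _).1 hy), hx]
    | none =>
      cases hy : act s x with
      | none => exact act_comp_of_none hy _
      | some y => rw [act_comp_of_some hy, act_comp_of_some ((h5 _ _).1 hy), hx]
  refine ⟨G'', i, s, h4, h1, h5, ⟨⟨hs.inj_h, ?_, isInjHom_comp hs.inj h4.1, ?_, ?_, ?_, ?_⟩, ?_⟩, hsig⟩
  · rw [isTotalHom_iff]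
    intro a
    obtain ⟨x, hx⟩ := isTotalHom_iff.1 hs.total a
    obtain ⟨y, hy⟩ := hsran x (.inl ⟨a, hx⟩)
    exact ⟨y, act_comp_some.2 ⟨x, hx, hy⟩⟩
  · rw [Category.assoc, hsig, hs.comm]
  · intro x x' w hx hx' hw hw'
    obtain ⟨y, hy, hyw⟩ := act_comp_some.1 hw
    obtain ⟨y', hy', hyw'⟩ := act_comp_some.1 hw'
    rw [hm_s x y hy] at hx
    rw [hm_s x' y' hy'] at hx'
    cases hs.inj_outside y y' w hx hx' hyw hyw'
    exact hi' _ _ _ hy hy'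
  · intro x w hx hw
    obtain ⟨y, hy, hyw⟩ := act_comp_some.1 hw
    rw [hm_s x y hy] at hx
    exact hs.disjoint y w hx hyw
  · intro w
    rcases hs.cover w with hw | ⟨y, hy, hyw⟩
    · exact .inl hw
    · obtain ⟨x, hx⟩ := hsran y (.inr ⟨w, hyw⟩)
      rw [h5] at hx
      exact .inr ⟨x, by rwa [hm_s x y hx], act_comp_some.2 ⟨y, hx, hyw⟩⟩
  · intro x hx
    obtain ⟨y, hy⟩ := hi x
    rw [hm_s x y hy] at hx
    have : y ∈ ran i := ⟨x, hy⟩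
    rw [h3] at this
    rcases this with h | ⟨w, hw⟩
    · exact (hx h).elim
    · exact ⟨w, act_comp_some.2 ⟨y, hy, hw⟩⟩

/-- Passing to a subgraph creates no new edges at a quantified node, and the edges that remain keep
their preimages under the match. -/
theorem AppCond.restrict {ρ : URule ar} {π : ρ.L ⟶ L'} (hm : AppCond ρ π m) {G'' : HGraph ar}
    {i : G'' ⟶ G'} {s : G' ⟶ G''} (hi : IsTotalHom i)
    (his : ∀ x y, act s y = some x ↔ act i x = some y) : AppCond ρ π (m ≫ s) := by
  rw [appCond_iff] at *
  intro x hx v hv e he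
  rw [← Category.assoc] at hv
  obtain ⟨v0, h1, h2⟩ := act_comp_some.1 hv
  rw [his] at h2
  obtain ⟨v0, rfl, -⟩ := act_inl_some h2
  obtain ⟨e0, h3⟩ := isTotalHom_iff.1 hi (.inr e)
  obtain ⟨e0, rfl, -⟩ := act_inr_some h3
  obtain ⟨w, hw, hw'⟩ := act_inl_of_conn h3 he
  cases h2.symm.trans hw'
  obtain ⟨a, ha⟩ := hm x hx v0 h1 e0 hw
  exact ⟨a, act_comp_some.2 ⟨_, ha, (his _ _).2 h3⟩⟩

theorem IsGluing.isPreStep {μ : R' ⟶ R''} {m' : R'' ⟶ G} (hμ : IsSubgraphHom μ)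
    (hm : IsTotalHom m) (hm' : IsInjHom m) (hg : IsGluing (γ ≫ μ) m m' g) :
    IsPreStep γ (μ ≫ m') m g := by
  refine ⟨isInjHom_comp hμ.1 hg.inj, hm, hm', ?_, hg.inj_outside, ?_, ?_⟩
  · rw [← hg.comm, Category.assoc]
  · rintro x w hx hw ⟨a, ha⟩
    obtain ⟨b, -, hb⟩ := act_comp_some.1 ha
    exact hg.disjoint x w hx hw ⟨b, hb⟩
  · intro w
    rcases hg.cover w with ⟨b, hb⟩ | hw
    · obtain ⟨a, ha⟩ := isSurjHom_iff.1 hμ.2 b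
      exact .inl ⟨a, act_comp_some.2 ⟨b, ha, hb⟩⟩
    · exact .inr hw

/-- As `μ` is surjective, `m'` and `μ ≫ m'` have the same range, so it does not matter which of them
is used to say what is covered. -/
theorem IsBackStep.isGluing {μ : R' ⟶ R''} {m' : R'' ⟶ G} (hμ : IsSubgraphHom μ)
    (hm : IsTotalHom m') (hm' : IsInjHom m') (hs : IsBackStep γ (μ ≫ m') m g) :
    IsGluing (γ ≫ μ) m m' g := by
  have key : ∀ w, w ∈ ran m' → w ∈ ran (μ ≫ m') := by
    rintro w ⟨b, hb⟩
    obtain ⟨a, ha⟩ := isSurjHom_iff.1 hμ.2 b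
    exact ⟨a, act_comp_some.2 ⟨b, ha, hb⟩⟩
  refine ⟨by rw [Category.assoc, hs.comm], hm, hm', fun v hv => hs.defined _ hv,
    fun e he _ => hs.defined _ he, hs.inj_outside, ?_, ?_⟩
  · intro x w hx hw hw'
    exact hs.disjoint x w hx hw (key w hw')
  · intro w
    rcases hs.cover w with ⟨a, ha⟩ | hw
    · obtain ⟨b, -, hb⟩ := act_comp_some.1 ha
      exact .inl ⟨b, hb⟩
    · exact .inr hw

/-- If `g` were undefined on an unmatched element, `IsPreStep.exists_backStep` would cut it off and
leave a properly smaller pushout complement, against minimality. Conversely, if `g` is defined on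
all unmatched elements, a subgraph morphism `ν` that commutes with the match and with `g` is total,
hence an isomorphism. The partial injection `h` stands for `μ ≫ m'`, which is recovered from it by
`exists_image`. -/
theorem mem_backApply_iff {ρ : URule ar} {k : ℕ} :
    G' ∈ backApply ρ G k ↔ ∃ (L' R' : HGraph ar) (π : ρ.L ⟶ L') (γ : L' ⟶ R') (h : R' ⟶ G)
      (m : L' ⟶ G') (g : G' ⟶ G), Instantiation ρ k π γ ∧ IsBackStep γ h m g ∧ AppCond ρ π m := by
  constructor
  · rintro ⟨L', R', R'', π, γ, μ, m', m, g, hI, hμ, hm, hm', ⟨⟨h1, h2, h3⟩, hmin⟩, hA⟩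
    have hpre := ((isPushout_iff_isGluing h1 h2).1 h3).isPreStep hμ h1 h2
    obtain ⟨G'', i, s, hs, hi, his, hb, hg⟩ := hpre.exists_backStep
    have hiso : IsIso s := hmin G'' (m ≫ s) (i ≫ g) s ⟨hb.total, hb.inj,
      (hb.isGluing hμ hm hm').isPushout⟩ hs rfl hg
    refine ⟨L', R', π, γ, μ ≫ m', m, g, hI, ⟨hpre, fun x hx => ?_⟩, hA⟩
    obtain ⟨y, hy⟩ := isTotalHom_iff.1 (isTotalHom_of_isIso s) x
    have hy' := (his _ _).1 hy
    obtain ⟨w, hw⟩ := hb.defined y (by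
      rintro ⟨a, ha⟩
      obtain ⟨x', hx', hs'⟩ := act_comp_some.1 ha
      rw [his, hy'] at hs'
      cases hs'
      exact hx ⟨a, hx'⟩)
    rw [act_comp_of_some hy'] at hw
    exact ⟨w, hw⟩
  · rintro ⟨L', R', π, γ, h, m, g, hI, hb, hA⟩
    obtain ⟨R'', μ, m', hμ, hm, hm', rfl⟩ := exists_image h hb.inj_h
    refine ⟨L', R', R'', π, γ, μ, m', m, g, hI, hμ, hm, hm', ⟨⟨hb.total, hb.inj,
      (hb.isGluing hμ hm hm').isPushout⟩, ?_⟩, hA⟩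
    intro H n h' ν ⟨hn, hn', _⟩ hν h1 h2
    refine isIso_of_bijective (isTotalHom_iff.2 fun x => ?_) hν.1 hν.2
    by_cases hx : x ∈ ran m
    · obtain ⟨a, ha⟩ := hx
      obtain ⟨y, hy⟩ := isTotalHom_iff.1 hn a
      rw [← h1, act_comp_of_some ha] at hy
      exact ⟨y, hy⟩
    · obtain ⟨w, hw⟩ := hb.defined x hx
      rw [← h2] at hw
      obtain ⟨y, hy, -⟩ := act_comp_some.1 hw
      exact ⟨y, hy⟩

/-! ### Families of cells -/

theorem UQuant.act_unique {L : HGraph ar} (u : UQuant L) {x : L.Elt} {y : u.Lu.Elt}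
    (h : act u.p x = some y) :
    ∃ z, act u.q y = some z ∧ ∀ y', act u.q y' = some z → y' = y := by
  cases y with
  | inl y =>
    obtain ⟨x, rfl, hx⟩ := act_eq_inl h
    obtain ⟨z, hz, hz'⟩ := u.node_unique x y hx
    refine ⟨.inl z, act_inl_eq.2 hz, fun y' hy' => ?_⟩
    obtain ⟨y', rfl, hq⟩ := act_eq_inl hy'
    rw [hz' _ hq]
  | inr y =>
    obtain ⟨x, rfl, hx⟩ := act_eq_inr h
    obtain ⟨z, hz, hz'⟩ := u.edge_unique x y hx
    refine ⟨.inr z, act_inr_eq.2 hz, fun y' hy' => ?_⟩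
    obtain ⟨y', rfl, hq⟩ := act_eq_inr hy'
    rw [hz' _ hq]

/-- Together with `UQuant.isInjHom_pq` this brings the right-hand pushouts of an instantiation under
the gluing description, whatever the rule morphism deletes or merges. -/
theorem UQuant.isTotalHom_pq {L : HGraph ar} (u : UQuant L) : IsTotalHom (u.p ≫ u.q) := by
  rw [isTotalHom_iff]
  intro x
  obtain ⟨y, hy⟩ := isTotalHom_iff.1 u.p_total x
  obtain ⟨z, hz, -⟩ := u.act_unique hy
  exact ⟨z, act_comp_some.2 ⟨y, hy, hz⟩⟩

/-- Uniqueness of preimages over the copy of `L`. Read contrapositively, `u.q` never sends a new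
element to an old one. -/
theorem UQuant.mem_ran_p {L : HGraph ar} (u : UQuant L) {y : u.Lu.Elt} {z : u.Ru.Elt}
    (h : act u.q y = some z) (hz : z ∈ ran (u.p ≫ u.q)) : y ∈ ran u.p := by
  obtain ⟨x, hx⟩ := hz
  obtain ⟨y', h1, h2⟩ := act_comp_some.1 hx
  obtain ⟨z', h3, h4⟩ := u.act_unique h1
  cases h2.symm.trans h3
  rw [h4 y h]
  exact ⟨x, h1⟩

theorem UQuant.isInjHom_pq {L : HGraph ar} (u : UQuant L) : IsInjHom (u.p ≫ u.q) := by
  rw [isInjHom_iff]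
  intro x x' z hx hx'
  obtain ⟨y, h1, h2⟩ := act_comp_some.1 hx
  obtain ⟨y', h1', h2'⟩ := act_comp_some.1 hx'
  obtain ⟨z', h3, h4⟩ := u.act_unique h1
  cases h2.symm.trans h3
  cases h4 y' h2'
  exact isInjHom_iff.1 u.p_inj _ _ _ h1 h1'

/-- A copy of a universal quantification in a pair of graphs. -/
structure Cell (ρ : URule ar) (X Y : HGraph ar) where
  u : UQuant ρ.L
  m : u.Lu ⟶ X
  h : u.Ru ⟶ Y

variable {ρ : URule ar} {X Y X' Y' : HGraph ar}

/-- Composition of a cell with morphisms. -/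
def Cell.map (c : Cell ρ X Y) (a : X ⟶ X') (b : Y ⟶ Y') : Cell ρ X' Y' := ⟨c.u, c.m ≫ a, c.h ≫ b⟩

/-- The conditions for a cell to be attached to `m₀`, `h₀` and `g`. -/
structure IsCell (m₀ : ρ.L ⟶ X) (h₀ : ρ.R ⟶ Y) (g : X ⟶ Y) (c : Cell ρ X Y) : Prop where
  mem : c.u ∈ ρ.U
  total : IsTotalHom c.m
  inj : IsInjHom c.m
  p_m : c.u.p ≫ c.m = m₀
  pq_h : (c.u.p ≫ c.u.q) ≫ c.h = ρ.r ≫ h₀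
  m_g : c.m ≫ g = c.u.q ≫ c.h
  -- Injectivity can be asked for new elements only: on the copy of `L` the map `c.h` acts as `ρ.r ≫
  -- h₀`, and `ρ.r` may merge or delete elements.
  inj_new : ∀ y y' w, y ∉ ran (c.u.p ≫ c.u.q) → y' ∉ ran (c.u.p ≫ c.u.q) →
    act c.h y = some w → act c.h y' = some w → y = y'
  disj_new : ∀ y w, y ∉ ran (c.u.p ≫ c.u.q) → act c.h y = some w → w ∉ ran h₀

/-- Two cells do not overlap except for the elements that come from the rule. -/
def Cell.Disj (c c' : Cell ρ X Y) : Prop :=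
  (∀ y z w, act c.m y = some w → act c'.m z = some w → y ∈ ran c.u.p) ∧
    (∀ y z w, act c.h y = some w → act c'.h z = some w → y ∈ ran (c.u.p ≫ c.u.q))

/-- Families of cells that represent an instantiation in the graphs `X` and `Y`. -/
structure IsFam (m₀ : ρ.L ⟶ X) (h₀ : ρ.R ⟶ Y) (g : X ⟶ Y) (fam : List (Cell ρ X Y)) : Prop where
  total : IsTotalHom m₀
  inj : IsInjHom m₀
  inj_h : IsInjHom h₀
  comm : ρ.r ≫ h₀ = m₀ ≫ g
  cell : ∀ c ∈ fam, IsCell m₀ h₀ g c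
  pairwise : fam.Pairwise Cell.Disj

/-- The elements covered on the left-hand side. -/
def covM (m₀ : ρ.L ⟶ X) (fam : List (Cell ρ X Y)) : Set X.Elt :=
  {x | x ∈ ran m₀ ∨ ∃ c ∈ fam, x ∈ ran c.m}

/-- The elements covered on the right-hand side. -/
def covH (h₀ : ρ.R ⟶ Y) (fam : List (Cell ρ X Y)) : Set Y.Elt :=
  {y | y ∈ ran h₀ ∨ ∃ c ∈ fam, y ∈ ran c.h}

variable {m₀ : ρ.L ⟶ X} {h₀ : ρ.R ⟶ Y} {γ' : X ⟶ Y} {fam : List (Cell ρ X Y)}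

theorem ran_comp_of_inj {A B C : HGraph ar} {f : A ⟶ B} {g : B ⟶ C} (hg : IsInjHom g) {y : B.Elt}
    {z : C.Elt} (h : act g y = some z) : z ∈ ran (f ≫ g) ↔ y ∈ ran f := by
  constructor
  · rintro ⟨x, hx⟩
    obtain ⟨y', h1, h2⟩ := act_comp_some.1 hx
    cases isInjHom_iff.1 hg _ _ _ h h2
    exact ⟨x, h1⟩
  · rintro ⟨x, hx⟩
    exact ⟨x, act_comp_some.2 ⟨y, hx, h⟩⟩

theorem isTotalHom_comp_of_ran {A B C : HGraph ar} {f : A ⟶ B} {g : B ⟶ C} (hf : IsTotalHom f)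
    (hg : ∀ y ∈ ran f, ∃ z, act g y = some z) : IsTotalHom (f ≫ g) := by
  rw [isTotalHom_iff] at *
  intro x
  obtain ⟨y, hy⟩ := hf x
  obtain ⟨z, hz⟩ := hg y ⟨x, hy⟩
  exact ⟨z, act_comp_some.2 ⟨y, hy, hz⟩⟩

/-- The morphism `a` has to be defined only on covered elements and `b` may be partial, so the lemma
serves both for embeddings into larger graphs and for projections onto subgraphs that contain the
cells. -/
theorem IsFam.map (hf : IsFam m₀ h₀ γ' fam) {a : X ⟶ X'} {b : Y ⟶ Y'} {g : X' ⟶ Y'}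
    (ha : ∀ x ∈ covM m₀ fam, ∃ y, act a x = some y) (ha' : IsInjHom a) (hb : IsInjHom b)
    (hg : γ' ≫ b = a ≫ g) : IsFam (m₀ ≫ a) (h₀ ≫ b) g (fam.map fun c => c.map a b) := by
  refine ⟨isTotalHom_comp_of_ran hf.total fun x hx => ha x (.inl hx), isInjHom_comp hf.inj ha', isInjHom_comp hf.inj_h hb, ?_,
    ?_, ?_⟩
  · rw [← Category.assoc, hf.comm, Category.assoc, Category.assoc, hg]
  · intro c' hc'
    obtain ⟨c, hc, rfl⟩ := List.mem_map.1 hc'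
    have h := hf.cell c hc
    refine ⟨h.mem, isTotalHom_comp_of_ran h.total fun x hx => ha x (.inr ⟨c, hc, hx⟩),
      isInjHom_comp h.inj ha', ?_, ?_, ?_, ?_, ?_⟩
    · change c.u.p ≫ c.m ≫ a = m₀ ≫ a
      rw [← Category.assoc, h.p_m]
    · change (c.u.p ≫ c.u.q) ≫ c.h ≫ b = ρ.r ≫ h₀ ≫ b
      rw [← Category.assoc, h.pq_h, Category.assoc]
    · change (c.m ≫ a) ≫ g = c.u.q ≫ c.h ≫ b
      rw [Category.assoc, ← hg, ← Category.assoc, h.m_g, Category.assoc]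
    · intro y y' w hy hy' hw hw'
      obtain ⟨z, h1, h2⟩ := act_comp_some.1 hw
      obtain ⟨z', h1', h2'⟩ := act_comp_some.1 hw'
      cases isInjHom_iff.1 hb _ _ _ h2 h2'
      exact h.inj_new y y' z hy hy' h1 h1'
    · intro y w hy hw
      obtain ⟨z, h1, h2⟩ := act_comp_some.1 hw
      rw [ran_comp_of_inj hb h2]
      exact h.disj_new y z hy h1
  · rw [List.pairwise_map]
    refine hf.pairwise.imp ?_
    rintro c c' ⟨h1, h2⟩
    refine ⟨fun y z w hy hz => ?_, fun y z w hy hz => ?_⟩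
    · obtain ⟨x, h3, h4⟩ := act_comp_some.1 hy
      obtain ⟨x', h3', h4'⟩ := act_comp_some.1 hz
      cases isInjHom_iff.1 ha' _ _ _ h4 h4'
      exact h1 y z x h3 h3'
    · obtain ⟨x, h3, h4⟩ := act_comp_some.1 hy
      obtain ⟨x', h3', h4'⟩ := act_comp_some.1 hz
      cases isInjHom_iff.1 hb _ _ _ h4 h4'
      exact h2 y z x h3 h3'

theorem mem_covM_map {a : X ⟶ X'} {b : Y ⟶ Y'} {x' : X'.Elt} :
    x' ∈ covM (m₀ ≫ a) (fam.map fun c => c.map a b) ↔ ∃ x ∈ covM m₀ fam, act a x = some x' := by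
  simp only [covM, Set.mem_ofPred_eq, List.mem_map]
  constructor
  · rintro (⟨y, hy⟩ | ⟨c, ⟨c, hc, rfl⟩, y, hy⟩)
    · obtain ⟨x, h1, h2⟩ := act_comp_some.1 hy
      exact ⟨x, .inl ⟨y, h1⟩, h2⟩
    · obtain ⟨x, h1, h2⟩ := act_comp_some.1 hy
      exact ⟨x, .inr ⟨c, hc, y, h1⟩, h2⟩
  · rintro ⟨x, ⟨y, hy⟩ | ⟨c, hc, y, hy⟩, hx⟩
    · exact .inl ⟨y, act_comp_some.2 ⟨x, hy, hx⟩⟩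
    · exact .inr ⟨_, ⟨c, hc, rfl⟩, y, act_comp_some.2 ⟨x, hy, hx⟩⟩

theorem mem_covH_map {a : X ⟶ X'} {b : Y ⟶ Y'} {y' : Y'.Elt} :
    y' ∈ covH (h₀ ≫ b) (fam.map fun c => c.map a b) ↔ ∃ y ∈ covH h₀ fam, act b y = some y' := by
  simp only [covH, Set.mem_ofPred_eq, List.mem_map]
  constructor
  · rintro (⟨y, hy⟩ | ⟨c, ⟨c, hc, rfl⟩, y, hy⟩)
    · obtain ⟨x, h1, h2⟩ := act_comp_some.1 hy
      exact ⟨x, .inl ⟨y, h1⟩, h2⟩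
    · obtain ⟨x, h1, h2⟩ := act_comp_some.1 hy
      exact ⟨x, .inr ⟨c, hc, y, h1⟩, h2⟩
  · rintro ⟨x, ⟨y, hy⟩ | ⟨c, hc, y, hy⟩, hx⟩
    · exact .inl ⟨y, act_comp_some.2 ⟨x, hy, hx⟩⟩
    · exact .inr ⟨_, ⟨c, hc, rfl⟩, y, act_comp_some.2 ⟨x, hy, hx⟩⟩

theorem IsFam.cons (hf : IsFam m₀ h₀ γ' fam) {c : Cell ρ X Y} (hc : IsCell m₀ h₀ γ' c)
    (hd : ∀ c' ∈ fam, c.Disj c') : IsFam m₀ h₀ γ' (c :: fam) := by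
  refine ⟨hf.total, hf.inj, hf.inj_h, hf.comm, ?_, List.pairwise_cons.2 ⟨hd, hf.pairwise⟩⟩
  intro c' hc'
  rcases List.mem_cons.1 hc' with rfl | h
  · exact hc
  · exact hf.cell c' h

/-- Only elements deleted by `δ` and unmatched edges at deleted nodes are lost, and a total `δ`
deletes nothing. -/
theorem IsGluing.total_right {A B C D : HGraph ar} {δ : A ⟶ B} {m : A ⟶ C} {n : B ⟶ D} {d : C ⟶ D}
    (h : IsGluing δ m n d) (hδ : IsTotalHom δ) : IsTotalHom d := by
  have key : ∀ x, x ∈ ran m → ∃ w, act d x = some w := by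
    rintro x ⟨a, ha⟩
    obtain ⟨w, hw⟩ := isTotalHom_iff.1 (isTotalHom_comp hδ h.total) a
    rw [h.comm, act_comp_of_some ha] at hw
    exact ⟨w, hw⟩
  have hV : ∀ v, ∃ w, act d (.inl v) = some w := fun v => by
    by_cases hv : Sum.inl v ∈ ran m
    · exact key _ hv
    · exact h.node_defined v hv
  rw [isTotalHom_iff]
  rintro (v | e)
  · exact hV v
  · by_cases he : Sum.inr e ∈ ran m
    · exact key _ he
    · exact h.edge_defined e he fun v _ => hV v

/-- The gluing square is a weak pullback on elements: an overlap of the two legs comes from `A`. For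
cells this says that a new copy meets the earlier graph in elements of the rule only. -/
theorem IsGluing.mem_ran_left {A B C D : HGraph ar} {δ : A ⟶ B} {m : A ⟶ C} {n : B ⟶ D}
    {d : C ⟶ D} (h : IsGluing δ m n d) {x : C.Elt} {b : B.Elt} {w : D.Elt} (hx : act d x = some w)
    (hb : act n b = some w) : ∃ a, act m a = some x ∧ act δ a = some b := by
  by_cases hxm : x ∈ ran m
  · obtain ⟨a, ha⟩ := hxm
    have h1 : act (δ ≫ n) a = some w := by rw [h.comm, act_comp_of_some ha, hx]
    obtain ⟨b', h2, h3⟩ := act_comp_some.1 h1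
    cases isInjHom_iff.1 h.inj _ _ _ hb h3
    exact ⟨a, ha, h2⟩
  · exact (h.disjoint x w hxm hx ⟨b, hb⟩).elim

theorem IsGluing.inj_right {A B C D : HGraph ar} {δ : A ⟶ B} {m : A ⟶ C} {n : B ⟶ D} {d : C ⟶ D}
    (h : IsGluing δ m n d) (hδ' : IsInjHom δ) : IsInjHom d := by
  rw [isInjHom_iff] at *
  intro x x' w hx hx'
  have key : ∀ x, x ∈ ran m → act d x = some w → ∃ b, act n b = some w := by
    rintro x ⟨a, ha⟩ hx
    have h1 : act (δ ≫ n) a = some w := by rw [h.comm, act_comp_of_some ha, hx]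
    obtain ⟨b', h2, h3⟩ := act_comp_some.1 h1
    exact ⟨b', h3⟩
  by_cases hw : ∃ b, act n b = some w
  · obtain ⟨b, hb⟩ := hw
    obtain ⟨a, h1, h2⟩ := h.mem_ran_left hx hb
    obtain ⟨a', h1', h2'⟩ := h.mem_ran_left hx' hb
    cases hδ' _ _ _ h2 h2'
    exact Option.some_injective _ (h1.symm.trans h1')
  · exact h.inj_outside x x' w (fun hx2 => hw (key x hx2 hx)) (fun hx2 => hw (key x' hx2 hx')) hx hx'

/-- An instantiation is represented by a family of cells in its own two graphs. -/
theorem Instantiation.exists_fam {k : ℕ} {L' R' : HGraph ar} {π : ρ.L ⟶ L'} {γ : L' ⟶ R'}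
    (hI : Instantiation ρ k π γ) :
    ∃ (j : ρ.R ⟶ R') (fam : List (Cell ρ L' R')), IsFam π j γ fam ∧ fam.length = k ∧
      (∀ x, x ∈ covM π fam) ∧ ∀ y, y ∈ covH j fam := by
  induction hI with
  | base =>
    refine ⟨𝟙 _, [], ⟨isTotalHom_id _, isInjHom_id _, isInjHom_id _, ?_, ?_, List.Pairwise.nil⟩,
      rfl, fun x => .inl ⟨x, act_id x⟩, fun x => .inl ⟨x, act_id x⟩⟩
    · rw [Category.comp_id, Category.id_comp]
    · intro c hc; cases hc
  | step u p' π' j' q' η hI hu hL hR h₁ h₂ ih =>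
    rename_i k L' R' Lu' Ru' π γ
    obtain ⟨j, fam, hf, hk, hM, hH⟩ := ih
    rw [isPushout_iff_isGluing u.p_total u.p_inj] at hL
    rw [isPushout_iff_isGluing u.isTotalHom_pq u.isInjHom_pq] at hR
    -- The earlier cells are pushed along the pushout legs `p'` and `j'`; the copy `π'`, `q'` of `u`
    -- is the additional cell.
    have hmap := hf.map (fun x _ => isTotalHom_iff.1 hL.total x) hL.inj hR.inj h₁.symm
    refine ⟨j ≫ j', ⟨u, π', q'⟩ :: fam.map (fun c => c.map p' j'), hmap.cons ?_ ?_, ?_, ?_, ?_⟩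
    · refine ⟨hu, hL.total_right hf.total, hL.inj_right hf.inj, hL.comm.symm, ?_, h₂,
        hR.inj_outside, ?_⟩
      · change (u.p ≫ u.q) ≫ q' = ρ.r ≫ j ≫ j'
        rw [← hR.comm, ← hf.comm, Category.assoc]
      · rintro y w hy hw ⟨a, ha⟩
        obtain ⟨b, -, hb⟩ := act_comp_some.1 ha
        exact hR.disjoint y w hy hw ⟨b, hb⟩
    · intro c' hc'
      obtain ⟨c, hc, rfl⟩ := List.mem_map.1 hc'
      -- The earlier cells factor through `p'` and `j'`, so an overlap with the new cell is an
      -- overlap of the two pushout legs.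
      refine ⟨fun y z w hy hz => ?_, fun y z w hy hz => ?_⟩
      · obtain ⟨b, -, hb⟩ := act_comp_some.1 hz
        obtain ⟨a, ha, -⟩ := hL.mem_ran_left hy hb
        exact ⟨a, ha⟩
      · obtain ⟨b, -, hb⟩ := act_comp_some.1 hz
        obtain ⟨a, ha, -⟩ := hR.mem_ran_left hy hb
        exact ⟨a, ha⟩
    · simp [hk]
    · intro x
      rcases hL.cover x with ⟨b, hb⟩ | ⟨y, -, hy⟩
      · rcases mem_covM_map.2 ⟨b, hM b, hb⟩ with h | ⟨c, hc, h⟩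
        · exact .inl h
        · exact .inr ⟨c, List.mem_cons_of_mem _ hc, h⟩
      · exact .inr ⟨_, List.mem_cons_self, y, hy⟩
    · intro x
      rcases hR.cover x with ⟨b, hb⟩ | ⟨y, -, hy⟩
      · rcases mem_covH_map.2 ⟨b, hH b, hb⟩ with h | ⟨c, hc, h⟩
        · exact .inl h
        · exact .inr ⟨c, List.mem_cons_of_mem _ hc, h⟩
      · exact .inr ⟨_, List.mem_cons_self, y, hy⟩

/-- Families of cells give rise to instantiations. -/
theorem IsFam.exists_instantiation (hf : IsFam m₀ h₀ γ' fam) :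
    ∃ (L' R' : HGraph ar) (π : ρ.L ⟶ L') (γ : L' ⟶ R') (m : L' ⟶ X) (h : R' ⟶ Y),
      Instantiation ρ fam.length π γ ∧ IsTotalHom π ∧ IsInjHom π ∧ IsTotalHom m ∧ IsInjHom m ∧
        IsInjHom h ∧ γ ≫ h = m ≫ γ' ∧ π ≫ m = m₀ ∧ ran m = covM m₀ fam ∧ ran h = covH h₀ fam := by
  induction fam with
  | nil =>
    refine ⟨ρ.L, ρ.R, 𝟙 _, ρ.r, m₀, h₀, .base, isTotalHom_id _, isInjHom_id _, hf.total, hf.inj,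
      hf.inj_h, hf.comm, Category.id_comp _, ?_, ?_⟩
    · ext x; simp [covM]
    · ext x; simp [covH]
  | cons c fam ih =>
    obtain ⟨hd, hpw⟩ := List.pairwise_cons.1 hf.pairwise
    obtain ⟨L', R', π, γ, m, h, hI, hπ, hπ', hm, hm', hh, hgh, hπm, hran, hranh⟩ :=
      ih ⟨hf.total, hf.inj, hf.inj_h, hf.comm, fun c' hc' => hf.cell c' (List.mem_cons_of_mem _ hc'),
        hpw⟩
    have hc := hf.cell c List.mem_cons_self
    -- The cells are glued back by actual pushouts. The mediating morphisms `mext` and `hext` into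
    -- `X` and `Y` have to be shown injective, which is where disjointness of the cells enters.
    obtain ⟨Lu', p', π', hL⟩ := exists_gluing π c.u.p c.u.p_total c.u.p_inj
    obtain ⟨Ru', j', q', hR⟩ := exists_gluing (π ≫ γ) (c.u.p ≫ c.u.q) c.u.isTotalHom_pq
      c.u.isInjHom_pq
    obtain ⟨mext, hm1, hm2⟩ := hL.exists_desc m c.m (by rw [hπm, hc.p_m])
    obtain ⟨hext, hh1, hh2⟩ := hR.exists_desc h c.h (by
      rw [hc.pq_h, hf.comm, Category.assoc, hgh, ← Category.assoc, hπm])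
    obtain ⟨η, hη1, hη2⟩ := hL.exists_desc (γ ≫ j') (c.u.q ≫ q') (by
      rw [← Category.assoc, hR.comm, Category.assoc])
    have hm1' : ∀ b w, act p' b = some w → act mext w = act m b := fun b w hb => by
      rw [← act_comp_of_some hb, hm1]
    have hm2' : ∀ b w, act π' b = some w → act mext w = act c.m b := fun b w hb => by
      rw [← act_comp_of_some hb, hm2]
    have hh1' : ∀ b w, act j' b = some w → act hext w = act h b := fun b w hb => by
      rw [← act_comp_of_some hb, hh1]
    have hh2' : ∀ b w, act q' b = some w → act hext w = act c.h b := fun b w hb => by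
      rw [← act_comp_of_some hb, hh2]
    -- The head cell meets what the other cells already cover only in its copy of `L`; the pushout
    -- has identified exactly these elements, so `mext` identifies nothing further.
    have mixm : ∀ b y x, act m b = some x → act c.m y = some x → y ∈ ran c.u.p := by
      intro b y x hb hy
      have : x ∈ covM m₀ fam := hran ▸ ⟨b, hb⟩
      rcases this with ⟨a, ha⟩ | ⟨c', hc', z, hz⟩
      · rw [← hc.p_m] at ha
        obtain ⟨y', h1, h2⟩ := act_comp_some.1 ha
        cases isInjHom_iff.1 hc.inj _ _ _ hy h2
        exact ⟨a, h1⟩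
      · exact (hd c' hc').1 y z x hy hz
    -- The same on the right, where a collision with the copy of `R` is excluded by `disj_new`.
    have mixh : ∀ b y x, act h b = some x → act c.h y = some x → y ∈ ran (c.u.p ≫ c.u.q) := by
      intro b y x hb hy
      have : x ∈ covH h₀ fam := hranh ▸ ⟨b, hb⟩
      rcases this with hx | ⟨c', hc', z, hz⟩
      · by_contra hcon
        exact hc.disj_new y x hcon hy hx
      · exact (hd c' hc').2 y z x hy hz
    refine ⟨Lu', Ru', π ≫ p', η, mext, hext, .step c.u p' π' j' q' η hI hc.mem hL.isPushout
      hR.isPushout hη1 hη2, isTotalHom_comp hπ hL.total, isInjHom_comp hπ' hL.inj, ?_, ?_, ?_, ?_,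
      ?_, ?_, ?_⟩
    · rw [isTotalHom_iff]
      intro w
      rcases hL.cover w with ⟨b, hb⟩ | ⟨y, -, hy⟩
      · rw [hm1' b w hb]; exact isTotalHom_iff.1 hm b
      · rw [hm2' y w hy]; exact isTotalHom_iff.1 hc.total y
    · rw [isInjHom_iff]
      intro w w' x hw hw'
      rcases hL.cover w with ⟨b, hb⟩ | ⟨y, hy0, hy⟩ <;>
      rcases hL.cover w' with ⟨b', hb'⟩ | ⟨y', hy0', hy'⟩
      · rw [hm1' b w hb] at hw
        rw [hm1' b' w' hb'] at hw'
        cases isInjHom_iff.1 hm' _ _ _ hw hw'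
        exact Option.some_injective _ (hb.symm.trans hb')
      · rw [hm1' b w hb] at hw
        rw [hm2' y' w' hy'] at hw'
        exact (hy0' (mixm _ _ _ hw hw')).elim
      · rw [hm2' y w hy] at hw
        rw [hm1' b' w' hb'] at hw'
        exact (hy0 (mixm _ _ _ hw' hw)).elim
      · rw [hm2' y w hy] at hw
        rw [hm2' y' w' hy'] at hw'
        cases isInjHom_iff.1 hc.inj _ _ _ hw hw'
        exact Option.some_injective _ (hy.symm.trans hy')
    · rw [isInjHom_iff]
      intro w w' x hw hw'
      rcases hR.cover w with ⟨b, hb⟩ | ⟨y, hy0, hy⟩ <;>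
      rcases hR.cover w' with ⟨b', hb'⟩ | ⟨y', hy0', hy'⟩
      · rw [hh1' b w hb] at hw
        rw [hh1' b' w' hb'] at hw'
        cases isInjHom_iff.1 hh _ _ _ hw hw'
        exact Option.some_injective _ (hb.symm.trans hb')
      · rw [hh1' b w hb] at hw
        rw [hh2' y' w' hy'] at hw'
        exact (hy0' (mixh _ _ _ hw hw')).elim
      · rw [hh2' y w hy] at hw
        rw [hh1' b' w' hb'] at hw'
        exact (hy0 (mixh _ _ _ hw' hw)).elim
      · rw [hh2' y w hy] at hw
        rw [hh2' y' w' hy'] at hw'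
        cases hc.inj_new _ _ _ hy0 hy0' hw hw'
        exact Option.some_injective _ (hy.symm.trans hy')
    · apply hL.jointly_epi
      · rw [← Category.assoc, hη1, Category.assoc, hh1, ← Category.assoc, hm1, hgh]
      · rw [← Category.assoc, hη2, Category.assoc, hh2, ← Category.assoc, hm2, hc.m_g]
    · rw [Category.assoc, hm1, hπm]
    · ext x
      constructor
      · rintro ⟨w, hw⟩
        rcases hL.cover w with ⟨b, hb⟩ | ⟨y, -, hy⟩
        · rw [hm1' b w hb] at hw
          have : x ∈ covM m₀ fam := hran ▸ ⟨b, hw⟩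
          rcases this with h | ⟨c', hc', h⟩
          · exact .inl h
          · exact .inr ⟨c', List.mem_cons_of_mem _ hc', h⟩
        · rw [hm2' y w hy] at hw
          exact .inr ⟨c, List.mem_cons_self, y, hw⟩
      · have old : x ∈ covM m₀ fam → x ∈ ran mext := by
          intro hx
          rw [← hran] at hx
          obtain ⟨b, hb⟩ := hx
          obtain ⟨w, hw⟩ := isTotalHom_iff.1 hL.total b
          exact ⟨w, by rw [hm1' b w hw, hb]⟩
        rintro (h | ⟨c', hc', y, hy⟩)
        · exact old (.inl h)
        · rcases List.mem_cons.1 hc' with rfl | hc'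
          · obtain ⟨w, hw⟩ := isTotalHom_iff.1 (hL.total_right hπ) y
            exact ⟨w, by rw [hm2' y w hw, hy]⟩
          · exact old (.inr ⟨c', hc', y, hy⟩)
    · ext x
      constructor
      · rintro ⟨w, hw⟩
        rcases hR.cover w with ⟨b, hb⟩ | ⟨y, -, hy⟩
        · rw [hh1' b w hb] at hw
          have : x ∈ covH h₀ fam := hranh ▸ ⟨b, hw⟩
          rcases this with h | ⟨c', hc', h⟩
          · exact .inl h
          · exact .inr ⟨c', List.mem_cons_of_mem _ hc', h⟩
        · rw [hh2' y w hy] at hw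
          exact .inr ⟨c, List.mem_cons_self, y, hw⟩
      · have old : x ∈ covH h₀ fam → x ∈ ran hext := by
          intro hx
          rw [← hranh] at hx
          obtain ⟨b, hb⟩ := hx
          obtain ⟨w, hw⟩ := isTotalHom_iff.1 hR.total b
          exact ⟨w, by rw [hh1' b w hw, hb]⟩
        rintro (h | ⟨c', hc', y, hy⟩)
        · exact old (.inl h)
        · rcases List.mem_cons.1 hc' with rfl | hc'
          · rw [← hh2] at hy
            obtain ⟨w, hw, hw'⟩ := act_comp_some.1 hy
            exact ⟨w, hw'⟩
          · exact old (.inr ⟨c', hc', y, hy⟩)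

/-- Families of cells that represent a backward step. -/
structure IsBackFam (m₀ : ρ.L ⟶ X) (h₀ : ρ.R ⟶ Y) (g : X ⟶ Y) (fam : List (Cell ρ X Y)) : Prop
    extends IsFam m₀ h₀ g fam where
  defined : ∀ x, x ∉ covM m₀ fam → ∃ w, act g x = some w ∧ w ∉ covH h₀ fam
  inj_outside : ∀ x x' w, x ∉ covM m₀ fam → x' ∉ covM m₀ fam → act g x = some w →
    act g x' = some w → x = x'
  cover : ∀ w, w ∈ covH h₀ fam ∨ ∃ x, x ∉ covM m₀ fam ∧ act g x = some w
  app : ∀ x ∈ ρ.qNodes, ∀ v, act m₀ (.inl x) = some (.inl v) →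
    ∀ e, v ∈ X.conn e → Sum.inr e ∈ covM m₀ fam

/-- Pushing the cells of an instantiation along `m` and `h` makes the covered sets equal to the
ranges of `m` and `h`, so the conditions on the step become conditions on the family; the converse
rebuilds the instantiation. The intermediate graphs `L'` and `R'` disappear, and with them the only
unbounded data. -/
theorem mem_backApply_iff_fam {k : ℕ} :
    G' ∈ backApply ρ G k ↔ ∃ (m₀ : ρ.L ⟶ G') (h₀ : ρ.R ⟶ G) (g : G' ⟶ G)
      (fam : List (Cell ρ G' G)), fam.length = k ∧ IsBackFam m₀ h₀ g fam := by
  rw [mem_backApply_iff]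
  constructor
  · rintro ⟨L', R', π, γ, h, m, g, hI, hb, hA⟩
    obtain ⟨j, fam, hf, hk, hM, hH⟩ := hI.exists_fam
    have h1 : covM (π ≫ m) (fam.map fun c => c.map m h) = ran m := by
      ext x
      rw [mem_covM_map]
      exact ⟨fun ⟨y, _, hy⟩ => ⟨y, hy⟩, fun ⟨y, hy⟩ => ⟨y, hM y, hy⟩⟩
    have h2 : covH (j ≫ h) (fam.map fun c => c.map m h) = ran h := by
      ext x
      rw [mem_covH_map]
      exact ⟨fun ⟨y, _, hy⟩ => ⟨y, hy⟩, fun ⟨y, hy⟩ => ⟨y, hH y, hy⟩⟩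
    refine ⟨π ≫ m, j ≫ h, g, fam.map fun c => c.map m h, by simp [hk],
      ⟨hf.map (fun x _ => isTotalHom_iff.1 hb.total x) hb.inj hb.inj_h hb.comm, ?_, ?_, ?_, ?_⟩⟩
    · rw [h1, h2]
      intro x hx
      obtain ⟨w, hw⟩ := hb.defined x hx
      exact ⟨w, hw, hb.disjoint x w hx hw⟩
    · rw [h1]
      exact hb.inj_outside
    · rw [h1, h2]
      exact hb.cover
    · rw [h1]
      exact appCond_iff.1 hA
  · rintro ⟨m₀, h₀, g, fam, rfl, hf⟩
    obtain ⟨L', R', π, γ, m, h, hI, -, -, hm, hm', hh, hgh, hπm, hran, hranh⟩ :=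
      hf.toIsFam.exists_instantiation
    refine ⟨L', R', π, γ, h, m, g, hI, ⟨⟨hh, hm, hm', hgh, ?_, ?_, ?_⟩, ?_⟩, ?_⟩
    · rw [hran]
      exact hf.inj_outside
    · rw [hran, hranh]
      intro x w hx hw
      obtain ⟨w', hw', h'⟩ := hf.defined x hx
      cases hw.symm.trans hw'
      exact h'
    · rw [hran, hranh]
      exact hf.cover
    · rw [hran]
      intro x hx
      obtain ⟨w, hw, -⟩ := hf.defined x hx
      exact ⟨w, hw⟩
    · rw [appCond_iff, hπm, hran]
      exact hf.app

end UGTS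

namespace UGTS
open CategoryTheory
variable {Λ : Type} {ar : Λ → ℕ}

/-! ### A bound on the length of instantiations -/

theorem card_elt (G : HGraph ar) : Fintype.card G.Elt = G.size := by
  simp [HGraph.size]

variable {ρ : URule ar} {X Y : HGraph ar} {m₀ : ρ.L ⟶ X} {h₀ : ρ.R ⟶ Y} {g : X ⟶ Y}
  {fam : List (Cell ρ X Y)}

/-- A cell that contributes an element to the right-hand side. -/
def Cell.Alive (c : Cell ρ X Y) : Prop :=
  ∃ y w, y ∉ ran (c.u.p ≫ c.u.q) ∧ act c.h y = some w

theorem IsFam.sublist (hf : IsFam m₀ h₀ g fam) {fam' : List (Cell ρ X Y)}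
    (h : fam'.Sublist fam) : IsFam m₀ h₀ g fam' :=
  ⟨hf.total, hf.inj, hf.inj_h, hf.comm, fun c hc => hf.cell c (h.subset hc), hf.pairwise.sublist h⟩

theorem IsCell.mem_ran_of_p {c : Cell ρ X Y} (hc : IsCell m₀ h₀ g c) {y : c.u.Lu.Elt} {x : X.Elt}
    (hy : act c.m y = some x) : x ∈ ran m₀ ↔ y ∈ ran c.u.p := by
  rw [← hc.p_m]
  exact ran_comp_of_inj hc.inj hy

/-- Each alive cell picks a new element that it contributes to `Y`. Two cells cannot pick the same
one, since by `Cell.Disj` a shared element is not new. -/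
theorem IsFam.length_le (hf : IsFam m₀ h₀ g fam) (h : ∀ c ∈ fam, c.Alive) :
    fam.length ≤ Y.size := by
  classical
  let pick : Cell ρ X Y → Option Y.Elt := fun c =>
    if hc : c.Alive then some hc.choose_spec.choose else none
  have hpick : ∀ c ∈ fam, ∃ y w, pick c = some w ∧ y ∉ ran (c.u.p ≫ c.u.q) ∧
      act c.h y = some w := fun c hc =>
    ⟨_, _, dif_pos (h c hc), (h c hc).choose_spec.choose_spec⟩
  have hnd : (fam.filterMap pick).Nodup := by
    rw [List.Nodup, List.pairwise_filterMap]
    refine hf.pairwise.imp_of_mem ?_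
    rintro c c' hc hc' hd w hw w' hw' rfl
    obtain ⟨y, v, h1, h2, h3⟩ := hpick c hc
    obtain ⟨y', v', h1', h2', h3'⟩ := hpick c' hc'
    cases hw.symm.trans h1
    cases hw'.symm.trans h1'
    exact h2 (hd.2 y y' w h3 h3')
  have hlen : fam.length = (fam.filterMap pick).length := by
    have := congrArg List.length (exists_map_some (f := pick) (l := fam) fun c hc => by
      obtain ⟨y, w, h1, -⟩ := hpick c hc
      exact ⟨w, h1⟩)
    simpa using this
  rw [hlen, ← card_elt]
  exact hnd.length_le_card

/-- `Cell.Disj` is stated one-sidedly and `pairwise` knows it in list order only, so one of the two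
directions is all that is available directly. -/
theorem IsFam.disj_or (hf : IsFam m₀ h₀ g fam) {c c' : Cell ρ X Y} (hc : c ∈ fam) (hc' : c' ∈ fam)
    (hne : c ≠ c') : c.Disj c' ∨ c'.Disj c := by
  have : Std.Symm (fun c c' : Cell ρ X Y => c.Disj c' ∨ c'.Disj c) := ⟨fun _ _ h => h.symm⟩
  exact List.Pairwise.forall (R := fun c c' : Cell ρ X Y => c.Disj c' ∨ c'.Disj c)
    (hf.pairwise.imp fun h => .inl h) hc hc' hne

/-- The cells that contribute nothing to the right-hand side can be dropped from a backward step,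
which leads to a subgraph. -/
theorem IsBackFam.drop_dead (hf : IsBackFam m₀ h₀ g fam) :
    ∃ (X' : HGraph ar) (m₀' : ρ.L ⟶ X') (h₀' : ρ.R ⟶ Y) (g' : X' ⟶ Y) (fam' : List (Cell ρ X' Y)),
      IsBackFam m₀' h₀' g' fam' ∧ (∀ c ∈ fam', c.Alive) ∧ SubOrder X' X := by
  classical
  let fam' := fam.filter (fun c => decide c.Alive)
  have hmem : ∀ c, c ∈ fam' ↔ c ∈ fam ∧ c.Alive := fun c => by simp [fam']
  have hf' : IsFam m₀ h₀ g fam' := hf.toIsFam.sublist List.filter_sublist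
  -- `Q` consists of the private left-hand elements of dead cells. It avoids the copy of `L` and all
  -- alive cells, so deleting it damages no remaining cell.
  let Q : Set X.Elt := {x | ∃ c ∈ fam, ¬ c.Alive ∧ ∃ y, y ∉ ran c.u.p ∧ act c.m y = some x}
  have hQm : ∀ x ∈ ran m₀, x ∉ Q := by
    rintro x hx ⟨c, hc, -, y, hy, hyx⟩
    exact hy (((hf.cell c hc).mem_ran_of_p hyx).1 hx)
  have hcov1 : ∀ x, x ∈ covM m₀ fam → x ∉ Q → x ∈ covM m₀ fam' := by
    rintro x (hx | ⟨c, hc, y, hy⟩) hQ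
    · exact .inl hx
    · by_cases ha : c.Alive
      · exact .inr ⟨c, (hmem c).2 ⟨hc, ha⟩, y, hy⟩
      · refine .inl (((hf.cell c hc).mem_ran_of_p hy).2 ?_)
        by_contra hcon
        exact hQ ⟨c, hc, ha, y, hcon, hy⟩
  have hcov2 : ∀ x, x ∈ covM m₀ fam' → x ∉ Q := by
    rintro x (hx | ⟨c', hc', z, hz⟩)
    · exact hQm x hx
    · rintro ⟨c, hc, ha, y, hy, hyx⟩
      obtain ⟨hc', ha'⟩ := (hmem c').1 hc'
      rcases hf.disj_or hc hc' (fun h => ha (h ▸ ha')) with h | h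
      · exact hy (h.1 y z x hyx hz)
      · have hx := ((hf.cell c' hc').mem_ran_of_p hz).2 (h.1 z y x hz hyx)
        exact hy (((hf.cell c hc).mem_ran_of_p hyx).1 hx)
  have hcov3 : ∀ x, x ∈ covM m₀ fam' → x ∈ covM m₀ fam := by
    rintro x (hx | ⟨c, hc, h⟩)
    · exact .inl hx
    · exact .inr ⟨c, ((hmem c).1 hc).1, h⟩
  -- An image under `g` would factor through `c.u.q` and `c.h`, and by `UQuant.mem_ran_p` it would
  -- arise from a new right-hand element, making the cell alive.
  have hQg : ∀ x ∈ Q, act g x = none := by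
    rintro x ⟨c, hc, ha, y, hy, hyx⟩
    cases hw : act g x with
    | none => rfl
    | some w =>
      rw [← act_comp_of_some hyx, (hf.cell c hc).m_g] at hw
      obtain ⟨z, h1, h2⟩ := act_comp_some.1 hw
      exact (ha ⟨z, w, fun hz => hy (c.u.mem_ran_p h1 hz), h2⟩).elim
  -- A dead cell covers on the right only images of its copy of `L`, and these lie in the range of
  -- `h₀`.
  have hcovH : covH h₀ fam = covH h₀ fam' := by
    ext w
    constructor
    · rintro (hw | ⟨c, hc, y, hy⟩)
      · exact .inl hw
      · by_cases ha : c.Alive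
        · exact .inr ⟨c, (hmem c).2 ⟨hc, ha⟩, y, hy⟩
        · have hyr : y ∈ ran (c.u.p ≫ c.u.q) := by
            by_contra hcon
            exact ha ⟨y, w, hcon, hy⟩
          obtain ⟨a, h1⟩ := hyr
          rw [← act_comp_of_some h1, (hf.cell c hc).pq_h] at hy
          obtain ⟨b, -, hb⟩ := act_comp_some.1 hy
          exact .inl ⟨b, hb⟩
    · rintro (hw | ⟨c, hc, h⟩)
      · exact .inl hw
      · exact .inr ⟨c, ((hmem c).1 hc).1, h⟩
  have hedge : ∀ {A : HGraph ar} (f : A ⟶ X) e v, Sum.inr e ∈ ran f → v ∈ X.conn e →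
      Sum.inl v ∈ ran f := by
    rintro A f e v ⟨a, ha⟩ hv
    obtain ⟨d, rfl, -⟩ := act_eq_inr ha
    obtain ⟨w, -, hw⟩ := exists_conn_of_act ha hv
    exact ⟨_, hw⟩
  -- No surviving edge loses a node: a covered edge outside `Q` belongs to the copy of `L` or to an
  -- alive cell together with its nodes, and on an uncovered edge `g` is defined, hence also on its
  -- nodes, while it is undefined on `Q`.
  obtain ⟨X', i, s, h1, h2, h3, h4, h5⟩ := exists_subgraph_proj X Qᶜ (by
    intro e he v hv
    by_cases hec : Sum.inr e ∈ covM m₀ fam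
    · apply hcov2
      rcases hcov1 _ hec he with h | ⟨c, hc, h⟩
      · exact .inl (hedge _ e v h hv)
      · exact .inr ⟨c, hc, hedge _ e v h hv⟩
    · intro hvQ
      obtain ⟨w, hw, -⟩ := hf.defined _ hec
      obtain ⟨e', rfl, -⟩ := act_inr_some hw
      obtain ⟨w, -, hw⟩ := act_inl_of_conn hw hv
      rw [hQg _ hvQ] at hw
      cases hw)
  have hsran : ∀ x, x ∉ Q → ∃ y, act i y = some x := by
    intro x hx
    have : x ∈ ran i := h3 ▸ hx
    exact this
  have hiQ : ∀ y x, act i y = some x → x ∉ Q := by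
    intro y x hy
    have : x ∈ Qᶜ := h3 ▸ ⟨y, hy⟩
    exact this
  have hsig : g ≫ 𝟙 Y = s ≫ i ≫ g := by
    rw [Category.comp_id]
    apply hom_ext_act
    intro x
    cases hy : act s x with
    | none =>
      rw [act_comp_of_none hy]
      by_cases hx : x ∈ Q
      · exact hQg x hx
      · obtain ⟨y, hy'⟩ := hsran x hx
        rw [← h5, hy] at hy'
        cases hy'
    | some y => rw [act_comp_of_some hy, act_comp_of_some ((h5 _ _).1 hy)]
  have hcovM : ∀ y x, act i y = some x →
      (y ∈ covM (m₀ ≫ s) (fam'.map fun c => c.map s (𝟙 Y)) ↔ x ∈ covM m₀ fam) := by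
    intro y x hy
    rw [mem_covM_map]
    constructor
    · rintro ⟨x', hx', hs⟩
      rw [h5, hy] at hs
      cases hs
      exact hcov3 _ hx'
    · intro hx
      exact ⟨x, hcov1 x hx (hiQ y x hy), (h5 _ _).2 hy⟩
  have hcovH' : covH (h₀ ≫ 𝟙 Y) (fam'.map fun c => c.map s (𝟙 Y)) = covH h₀ fam := by
    rw [hcovH]
    ext y
    rw [mem_covH_map]
    constructor
    · rintro ⟨y', hy', h⟩
      rw [act_id] at h
      cases h
      exact hy'
    · intro hy
      exact ⟨y, hy, act_id y⟩
  have hi := isTotalHom_iff.1 h1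
  have hmap := hf'.map (fun x hx => (hsran x (hcov2 x hx)).imp fun y hy => (h5 _ _).2 hy) h4.1
    (isInjHom_id Y) hsig
  refine ⟨X', m₀ ≫ s, h₀ ≫ 𝟙 Y, i ≫ g, fam'.map fun c => c.map s (𝟙 Y), ⟨hmap, ?_, ?_, ?_, ?_⟩,
    ?_, ⟨s, h4⟩⟩
  · intro y hy
    obtain ⟨x, hx⟩ := hi y
    rw [hcovM y x hx] at hy
    rw [hcovH', act_comp_of_some hx]
    exact hf.defined x hy
  · intro y y' w hy hy' hw hw'
    obtain ⟨x, hx⟩ := hi y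
    obtain ⟨x', hx'⟩ := hi y'
    rw [hcovM y x hx] at hy
    rw [hcovM y' x' hx'] at hy'
    rw [act_comp_of_some hx] at hw
    rw [act_comp_of_some hx'] at hw'
    cases hf.inj_outside x x' w hy hy' hw hw'
    exact isInjHom_iff.1 h2 _ _ _ hx hx'
  · intro w
    rw [hcovH']
    rcases hf.cover w with hw | ⟨x, hx, hw⟩
    · exact .inl hw
    · obtain ⟨y, hy⟩ := hsran x fun hQ => by rw [hQg x hQ] at hw; cases hw
      exact .inr ⟨y, by rwa [hcovM y x hy], by rw [act_comp_of_some hy, hw]⟩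
  · intro x hx v hv e he
    obtain ⟨v0, h6, h7⟩ := act_comp_some.1 hv
    rw [h5] at h7
    obtain ⟨v0, rfl, -⟩ := act_inl_some h7
    obtain ⟨e0, h8⟩ := hi (.inr e)
    obtain ⟨e0, rfl, -⟩ := act_inr_some h8
    obtain ⟨w, hw, hw'⟩ := act_inl_of_conn h8 he
    cases h7.symm.trans hw'
    rw [hcovM _ _ h8]
    exact hf.app x hx v0 h6 e0 hw
  · intro c' hc'
    obtain ⟨c, hc, rfl⟩ := List.mem_map.1 hc'
    obtain ⟨y, w, hy, hw⟩ := ((hmem c).1 hc).2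
    exact ⟨y, w, hy, act_comp_some.2 ⟨w, hw, act_id w⟩⟩

theorem isInstBound_size (ρ : URule ar) (G : HGraph ar) : IsInstBound ρ G G.size := by
  intro k G' hG'
  obtain ⟨m₀, h₀, g, fam, -, hf⟩ := mem_backApply_iff_fam.1 hG'
  obtain ⟨G'', m₀', h₀', g', fam', hf', ha, hs⟩ := hf.drop_dead
  exact ⟨fam'.length, hf'.toIsFam.length_le ha, G'',
    mem_backApply_iff_fam.2 ⟨m₀', h₀', g', fam', rfl, hf'⟩, hs⟩

/-! ### The results of backward steps form a basis -/

/-- The same instantiation and match apply forwards. The morphism from the pushout `H` to `G`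
induced by `h` and `g` is injective because `h`, and `g` on unmatched elements, are injective with
disjoint images; it is surjective because these images exhaust `G`. -/
theorem backApply_subset_pred {G G' : HGraph ar} {k : ℕ} (h : G' ∈ backApply ρ G k) :
    ∃ H, Applies ρ G' H ∧ SubOrder G H := by
  obtain ⟨L', R', π, γ, h, m, g, hI, hb, hA⟩ := mem_backApply_iff.1 h
  obtain ⟨H, n, d, hH⟩ := exists_gluing γ m hb.total hb.inj
  refine ⟨H, ⟨k, L', R', π, γ, m, hI, hb.total, hb.inj, hA, n, d, hH.isPushout⟩, ?_⟩
  obtain ⟨s, h1, h2⟩ := hH.exists_desc h g hb.comm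
  have h1' : ∀ b w, act n b = some w → act s w = act h b := fun b w hb => by
    rw [← act_comp_of_some hb, h1]
  have h2' : ∀ b w, act d b = some w → act s w = act g b := fun b w hb => by
    rw [← act_comp_of_some hb, h2]
  refine ⟨s, isInjHom_iff.2 ?_, isSurjHom_iff.2 ?_⟩
  · intro w w' x hw hw'
    rcases hH.cover w with ⟨b, hb1⟩ | ⟨y, hy0, hy⟩ <;>
    rcases hH.cover w' with ⟨b', hb'⟩ | ⟨y', hy0', hy'⟩
    · rw [h1' b w hb1] at hw
      rw [h1' b' w' hb'] at hw'
      cases isInjHom_iff.1 hb.inj_h _ _ _ hw hw'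
      exact Option.some_injective _ (hb1.symm.trans hb')
    · rw [h1' b w hb1] at hw
      rw [h2' y' w' hy'] at hw'
      exact (hb.disjoint y' x hy0' hw' ⟨b, hw⟩).elim
    · rw [h2' y w hy] at hw
      rw [h1' b' w' hb'] at hw'
      exact (hb.disjoint y x hy0 hw ⟨b', hw'⟩).elim
    · rw [h2' y w hy] at hw
      rw [h2' y' w' hy'] at hw'
      cases hb.inj_outside _ _ _ hy0 hy0' hw hw'
      exact Option.some_injective _ (hy.symm.trans hy')
  · intro x
    rcases hb.cover x with ⟨b, hb1⟩ | ⟨y, -, hy⟩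
    · obtain ⟨w, hw⟩ := isTotalHom_iff.1 hH.total b
      exact ⟨w, by rw [h1' b w hw, hb1]⟩
    · rw [← h2] at hy
      obtain ⟨w, -, hw⟩ := act_comp_some.1 hy
      exact ⟨w, hw⟩

/-- Following the pushout by the projection `σ` of `H` onto `G` keeps everything but definedness of
`g` on unmatched elements. Cutting off the undefined ones gives a subgraph of `G'` on which the
application condition still holds. -/
theorem exists_backApply_of_applies {G G' H : HGraph ar} (h : Applies ρ G' H) (hG : SubOrder G H) :
    ∃ k, ∃ G'' ∈ backApply ρ G k, SubOrder G'' G' := by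
  obtain ⟨k, L', R', π, γ, m, hI, hm, hm', hA, n, d, hP⟩ := h
  obtain ⟨σ, hσ, hσ'⟩ := hG
  rw [isPushout_iff_isGluing hm hm'] at hP
  have hpre : IsPreStep γ (n ≫ σ) m (d ≫ σ) := by
    refine ⟨isInjHom_comp hP.inj hσ, hm, hm', ?_, ?_, ?_, ?_⟩
    · rw [← Category.assoc, hP.comm, Category.assoc]
    · intro x x' w hx hx' hw hw'
      obtain ⟨y, h1, h2⟩ := act_comp_some.1 hw
      obtain ⟨y', h1', h2'⟩ := act_comp_some.1 hw'
      cases isInjHom_iff.1 hσ _ _ _ h2 h2'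
      exact hP.inj_outside x x' y hx hx' h1 h1'
    · intro x w hx hw
      obtain ⟨y, h1, h2⟩ := act_comp_some.1 hw
      rw [ran_comp_of_inj hσ h2]
      exact hP.disjoint x y hx h1
    · intro w
      obtain ⟨y, hy⟩ := isSurjHom_iff.1 hσ' w
      rcases hP.cover y with ⟨b, hb⟩ | ⟨x, hx, hxy⟩
      · exact .inl ⟨b, act_comp_some.2 ⟨y, hb, hy⟩⟩
      · exact .inr ⟨x, hx, act_comp_some.2 ⟨y, hxy, hy⟩⟩
  obtain ⟨G'', i, s, hs, hi, his, hb, -⟩ := hpre.exists_backStep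
  exact ⟨k, G'', mem_backApply_iff.2 ⟨L', R', π, γ, _, _, _, hI, hb, hA.restrict hi his⟩, s, hs⟩

theorem isBasis_predBasis {b : URule ar → HGraph ar → ℕ} (hb : ∀ ρ G, IsInstBound ρ G (b ρ G))
    (rules : List (URule ar)) (G : HGraph ar) :
    IsBasis (predBasis b rules G) (upClosure (Pred rules (upClosure {G}))) := by
  apply Set.eq_of_subset_of_subset
  · rintro G₁ ⟨G', ⟨H, ⟨_, rfl, hGH⟩, ρ, hρ, happ⟩, hs⟩
    obtain ⟨k, G'', h1, h2⟩ := exists_backApply_of_applies happ hGH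
    obtain ⟨k', hk', G₃, h3, h4⟩ := hb _ _ k G'' h1
    exact ⟨G₃, ⟨ρ, hρ, k', hk', h3⟩, subOrder_trans h4 (subOrder_trans h2 hs)⟩
  · rintro G₁ ⟨G', ⟨ρ, hρ, k, -, hk⟩, hs⟩
    obtain ⟨H, h1, h2⟩ := backApply_subset_pred hk
    exact ⟨G', ⟨H, ⟨G, rfl, h2⟩, ρ, hρ, h1⟩, hs⟩

end UGTS

namespace UGTS
open CategoryTheory
variable {Λ : Type} {ar : Λ → ℕ}

/-! ### Minimization -/

/-- Minimization of a list with respect to a preorder: the elements are inserted one by one,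
unless they are represented already; an inserted element replaces those that it represents. -/
def minimize {α : Type} (r : α → α → Bool) : List α → List α
  | [] => []
  | a :: l => if (minimize r l).any (fun x => r x a) then minimize r l
      else a :: (minimize r l).filter (fun x => !r a x)

theorem minimize_subset {α : Type} {r : α → α → Bool} {l : List α} {a : α}
    (h : a ∈ minimize r l) : a ∈ l := by
  induction l with
  | nil => exact h
  | cons b l ih =>
    rw [minimize] at h
    split at h
    · exact List.mem_cons_of_mem _ (ih h)
    · rcases List.mem_cons.1 h with rfl | h
      · exact List.mem_cons_self
      · exact List.mem_cons_of_mem _ (ih (List.mem_filter.1 h).1)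

theorem minimize_antichain {α : Type} {r : α → α → Bool} {l : List α} {a b : α}
    (ha : a ∈ minimize r l) (hb : b ∈ minimize r l) (h : r a b = true) : a = b := by
  induction l generalizing a b with
  | nil => cases ha
  | cons c l ih =>
    rw [minimize] at ha hb
    split at ha
    · rename_i hc
      rw [if_pos hc] at hb
      exact ih ha hb h
    · rename_i hc
      rw [if_neg hc] at hb
      simp only [List.any_eq_true, not_exists, not_and] at hc
      rcases List.mem_cons.1 ha with rfl | ha <;> rcases List.mem_cons.1 hb with rfl | hb
      · rfl
      · have := (List.mem_filter.1 hb).2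
        simp [h] at this
      · exact (hc a (List.mem_filter.1 ha).1 h).elim
      · exact ih (List.mem_filter.1 ha).1 (List.mem_filter.1 hb).1 h

/-- An element is discarded only in favour of one below it, and transitivity carries this through
later replacements. -/
theorem exists_minimize_le {α : Type} {r : α → α → Bool} (hr : ∀ a, r a a = true)
    (ht : ∀ a b c, r a b = true → r b c = true → r a c = true) {l : List α} {a : α} (h : a ∈ l) :
    ∃ b ∈ minimize r l, r b a = true := by
  induction l generalizing a with
  | nil => cases h
  | cons c l ih =>
    rw [minimize]
    split
    · rename_i hc
      rcases List.mem_cons.1 h with rfl | h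
      · simpa using hc
      · exact ih h
    · rcases List.mem_cons.1 h with rfl | h
      · exact ⟨a, List.mem_cons_self, hr a⟩
      · obtain ⟨b, hb, hba⟩ := ih h
        by_cases hcb : r c b = true
        · exact ⟨c, List.mem_cons_self, ht _ _ _ hcb hba⟩
        · exact ⟨b, List.mem_cons_of_mem _ (List.mem_filter.2 ⟨hb, by simp [hcb]⟩), hba⟩

theorem minimize_map {α β : Type} (f : α → β) {r : α → α → Bool} {r' : β → β → Bool}
    (h : ∀ a b, r' (f a) (f b) = r a b) (l : List α) :
    minimize r' (l.map f) = (minimize r l).map f := by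
  induction l with
  | nil => rfl
  | cons a l ih =>
    rw [List.map_cons, minimize, minimize, ih]
    have h1 : (List.map f (minimize r l)).any (fun x => r' x (f a)) =
        (minimize r l).any (fun x => r x a) := by
      rw [List.any_map]
      congr 1
      funext x
      exact h x a
    rw [h1]
    split
    · rfl
    · rw [List.map_cons, List.filter_map]
      congr 3
      funext x
      simp [h]

open Classical in
/-- Minimization of a list of graphs. -/
noncomputable def minimizeGraphs (l : List (HGraph ar)) : List (HGraph ar) :=
  minimize (fun G H => decide (SubOrder G H)) l

theorem isMinimization_minimizeGraphs (l : List (HGraph ar)) :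
    IsMinimization {H | H ∈ l} (minimizeGraphs l) := by
  refine ⟨fun H hH => minimize_subset hH, fun H hH H' hH' h => ?_, fun H hH => ?_⟩
  · exact minimize_antichain hH' hH (by simpa using h)
  · obtain ⟨H', h1, h2⟩ := exists_minimize_le (r := fun G H => @decide (SubOrder G H)
      (Classical.propDecidable _)) (fun a => by simpa using subOrder_refl a)
      (fun a b c h h' => by
        simp only [decide_eq_true_eq] at h h' ⊢
        exact subOrder_trans h h') hH
    exact ⟨H', h1, by simpa using h2⟩

/-! ### The backward search -/

variable {b : URule ar → HGraph ar → ℕ} {rules : List (URule ar)}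

theorem subset_upClosure {S T : Set (HGraph ar)} (h : ∀ G ∈ S, ∃ H ∈ T, SubOrder H G) :
    upClosure S ⊆ upClosure T := by
  rintro G ⟨G', hG', hs⟩
  obtain ⟨H, hH, hs'⟩ := h G' hG'
  exact ⟨H, hH, subOrder_trans hs' hs⟩

theorem SearchStep.upClosure_subset {W W' : List (HGraph ar)} (h : SearchStep b rules W W') :
    upClosure {H | H ∈ W} ⊆ upClosure {H | H ∈ W'} :=
  subset_upClosure fun G hG => h.2.2 G (.inl hG)

theorem SearchStep.pred_subset (hb : ∀ ρ G, IsInstBound ρ G (b ρ G)) {W W' : List (HGraph ar)}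
    (h : SearchStep b rules W W') {G G' : HGraph ar} (hG : G ∈ upClosure {H | H ∈ W})
    (hG' : Rewrites rules G' G) : G' ∈ upClosure {H | H ∈ W'} := by
  obtain ⟨H, hH, hs⟩ := hG
  have h1 : G' ∈ upClosure (Pred rules (upClosure {H})) :=
    ⟨G', ⟨G, ⟨H, rfl, hs⟩, hG'⟩, subOrder_refl G'⟩
  rw [isBasis_predBasis hb rules H] at h1
  obtain ⟨K, hK, hs'⟩ := h1
  obtain ⟨K', hK', hs''⟩ := h.2.2 K (.inr ⟨H, hH, hK⟩)
  exact ⟨K', hK', subOrder_trans hs'' hs'⟩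

/-- The soundness half of the basis property: a round adds nothing but graphs above predecessors. It
yields invariants of the search and, with `SearchStep.pred_subset`, determines the upward closure
after a round. -/
theorem SearchStep.subset_pred (hb : ∀ ρ G, IsInstBound ρ G (b ρ G)) {W W' : List (HGraph ar)}
    (h : SearchStep b rules W W') {G : HGraph ar} (hG : G ∈ W') :
    G ∈ W ∨ G ∈ upClosure (Pred rules (upClosure {H | H ∈ W})) := by
  rcases h.1 G hG with h | ⟨H, hH, h⟩
  · exact .inl h
  · have h1 : G ∈ upClosure (predBasis b rules H) := ⟨G, h, subOrder_refl G⟩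
    rw [← isBasis_predBasis hb rules H] at h1
    obtain ⟨G', ⟨K, ⟨_, rfl, hK⟩, hr⟩, hs⟩ := h1
    exact .inr ⟨G', ⟨K, ⟨_, hH, hK⟩, hr⟩, hs⟩

theorem upClosure_subset_of_reflTransGen {F W : List (HGraph ar)}
    (h : Relation.ReflTransGen (SearchStep b rules) F W) :
    upClosure {H | H ∈ F} ⊆ upClosure {H | H ∈ W} := by
  induction h with
  | refl => exact subset_rfl
  | tail _ h ih => exact ih.trans h.upClosure_subset

/-- Backward induction along the rewriting sequence: its last graph lies above a final graph, and a
stationary set absorbs the predecessors of its upward closure. -/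
theorem SearchResult.canCover_subset (hb : ∀ ρ G, IsInstBound ρ G (b ρ G))
    {F W : List (HGraph ar)} (h : SearchResult b rules F W) :
    {G | ∃ H ∈ F, CanCover rules G H} ⊆ upClosure {H | H ∈ W} := by
  rintro G ⟨H, hH, K, hK, hs⟩
  induction hK using Relation.ReflTransGen.head_induction_on with
  | refl => exact upClosure_subset_of_reflTransGen h.1 ⟨H, hH, hs⟩
  | head h1 _ ih => exact h.2.pred_subset hb ih h1

theorem searchStep_monotone {W : ℕ → List (HGraph ar)}
    (h : ∀ i, SearchStep b rules (W i) (W (i + 1))) :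
    Monotone (fun i => upClosure {H | H ∈ W i}) :=
  monotone_nat_of_le_succ fun i => (h i).upClosure_subset

theorem canCover_subset_iUnion (hb : ∀ ρ G, IsInstBound ρ G (b ρ G)) {W : ℕ → List (HGraph ar)}
    (h : ∀ i, SearchStep b rules (W i) (W (i + 1))) :
    {G | ∃ H ∈ W 0, CanCover rules G H} ⊆ ⋃ i, upClosure {H | H ∈ W i} := by
  rintro G ⟨H, hH, K, hK, hs⟩
  induction hK using Relation.ReflTransGen.head_induction_on with
  | refl => exact Set.mem_iUnion.2 ⟨0, H, hH, hs⟩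
  | head h1 _ ih =>
    obtain ⟨i, hi⟩ := Set.mem_iUnion.1 ih
    exact Set.mem_iUnion.2 ⟨i + 1, (h i).pred_subset hb hi h1⟩

/-- The search closes up after as many rounds as any run of it that stops. -/
theorem searchStep_self_of_searchResult (hb : ∀ ρ G, IsInstBound ρ G (b ρ G))
    {W : ℕ → List (HGraph ar)} (h : ∀ i, SearchStep b rules (W i) (W (i + 1)))
    {V : List (HGraph ar)} (hV : SearchResult b rules (W 0) V) :
    ∃ i, SearchStep b rules (W i) (W i) := by
  -- Any run has the same upward closures as `W`, round by round, although the lists may contain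
  -- different representatives.
  have key : ∀ V, Relation.ReflTransGen (SearchStep b rules) (W 0) V → V = W 0 ∨
      ∃ i, upClosure {H | H ∈ W (i + 1)} = upClosure {H | H ∈ V} := by
    intro V hV
    have mono : ∀ {V₁ V₂ W₁ W₂ : List (HGraph ar)}, upClosure {H | H ∈ V₁} = upClosure {H | H ∈ W₁} →
        SearchStep b rules V₁ V₂ → SearchStep b rules W₁ W₂ →
        upClosure {H | H ∈ V₂} ⊆ upClosure {H | H ∈ W₂} := by
      intro V₁ V₂ W₁ W₂ he hv hw
      apply subset_upClosure
      intro G hG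
      rcases hv.subset_pred hb hG with hG | ⟨G', ⟨K, hK, hr⟩, hs⟩
      · have : G ∈ upClosure {H | H ∈ V₁} := ⟨G, hG, subOrder_refl G⟩
        rw [he] at this
        exact hw.upClosure_subset this
      · rw [he] at hK
        obtain ⟨H, hH, hs'⟩ := hw.pred_subset hb hK hr
        exact ⟨H, hH, subOrder_trans hs' hs⟩
    induction hV with
    | refl => exact .inl rfl
    | tail _ hs ih =>
      right
      rcases ih with rfl | ⟨i, hi⟩
      · exact ⟨0, (mono rfl (h 0) hs).antisymm (mono rfl hs (h 0))⟩
      · exact ⟨i + 1, (mono hi (h _) hs).antisymm (mono hi.symm hs (h _))⟩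
  rcases key V hV.1 with rfl | ⟨i, hi⟩
  · exact ⟨0, hV.2⟩
  -- The index `i + 1` matters: `W (i + 1)` results from a minimization and so has no comparable or
  -- repeated representatives, which need not hold for `W 0`. Closedness under the backward step
  -- depends on the upward closure only, so it is inherited from `V`.
  · refine ⟨i + 1, fun H hH => .inl hH, (h i).2.1, ?_⟩
    rintro H (hH | ⟨G, hG, hH⟩)
    · exact ⟨H, hH, subOrder_refl H⟩
    · have h1 : H ∈ upClosure (predBasis b rules G) := ⟨H, hH, subOrder_refl H⟩
      rw [← isBasis_predBasis hb rules G] at h1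
      obtain ⟨G', ⟨K, ⟨_, rfl, hK⟩, hr⟩, hs⟩ := h1
      have h2 : K ∈ upClosure {H | H ∈ V} := hi ▸ ⟨_, hG, hK⟩
      have h3 := hV.2.pred_subset hb h2 hr
      rw [← hi] at h3
      obtain ⟨K', hK', hs'⟩ := h3
      exact ⟨K', hK', subOrder_trans hs' hs⟩

end UGTS

namespace UGTS
open CategoryTheory

/-! ### A search that does not terminate -/

namespace Walk

/-- Two unary labels (a token and a goal) and a binary one (steps). -/
abbrev arity : Fin 3 → ℕ := ![1, 1, 2]

/-- The directed path of length `n` with the token at the node `i` and the goal at its end. -/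
def path (n : ℕ) (i : Fin (n + 1)) : HGraph arity where
  nV := n + 1
  nE := n + 1 + 1
  lab := Fin.cons 0 (Fin.cons 1 fun _ => 2)
  conn := Fin.cons [i] (Fin.cons [Fin.last n] fun j => [j.castSucc, j.succ])
  length_conn := by
    intro e
    refine Fin.cases ?_ (fun e => Fin.cases ?_ (fun e => ?_) e) e <;> rfl

/-- The rule that moves the token along a step: left-hand side. -/
def lhs : HGraph arity where
  nV := 2
  nE := 2
  lab := ![0, 2]
  conn := ![[0], [0, 1]]
  length_conn := by
    intro e
    fin_cases e <;> rfl

/-- The rule that moves the token along a step: right-hand side. -/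
def rhs : HGraph arity where
  nV := 2
  nE := 2
  lab := ![0, 2]
  conn := ![[1], [0, 1]]
  length_conn := by
    intro e
    fin_cases e <;> rfl

/-- The rule morphism keeps the nodes and the step, and deletes the token. -/
def ruleHom : PHom lhs rhs where
  onV := some
  onE := (![none, some 1] : Fin 2 → Option (Fin 2))
  lab_eq := by
    intro e e' h
    change Fin 2 at e
    fin_cases e <;> cases h
    rfl
  conn_eq := by
    intro e e' h
    change Fin 2 at e
    fin_cases e <;> cases h
    rfl

/-- The rule that moves the token along a step. -/
def rule : URule arity := ⟨lhs, rhs, ruleHom, []⟩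

/-! ### The invariant of the search: a walk from a token to a goal -/

variable {G H : HGraph arity}

/-- The token is at `v`. -/
def Token (G : HGraph arity) (v : Fin G.nV) : Prop := ∃ e, G.lab e = 0 ∧ G.conn e = [v]

/-- The goal is at `v`. -/
def Goal (G : HGraph arity) (v : Fin G.nV) : Prop := ∃ e, G.lab e = 1 ∧ G.conn e = [v]

/-- There is a step from `v` to `w`. -/
def Step (G : HGraph arity) (v w : Fin G.nV) : Prop := ∃ e, G.lab e = 2 ∧ G.conn e = [v, w]

/-- There is a walk from a token to a goal. -/
def HasWalk (G : HGraph arity) : Prop :=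
  ∃ v w, Token G v ∧ Goal G w ∧ Relation.ReflTransGen (Step G) v w

theorem HasWalk.mono (hs : SubOrder G H) (hG : HasWalk G) : HasWalk H := by
  obtain ⟨f, hf, -⟩ := subOrder_iff.1 hs
  choose φ hφ using hf.1
  have key : ∀ e, ∃ d, H.lab d = G.lab e ∧ H.conn d = (G.conn e).map φ := by
    intro e
    obtain ⟨d, hd⟩ := hf.2 e
    refine ⟨d, (f.lab_eq e d hd).symm, ?_⟩
    have h := f.conn_eq e d hd
    have h' : f.onV = fun v => some (φ v) := funext hφ
    rw [h'] at h
    apply List.map_injective_iff.2 (Option.some_injective _)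
    rw [← h, List.map_map]
    rfl
  have hstep : ∀ v w, Step G v w → Step H (φ v) (φ w) := by
    rintro v w ⟨e, h1, h2⟩
    obtain ⟨d, h3, h4⟩ := key e
    exact ⟨d, h3.trans h1, by rw [h4, h2]; rfl⟩
  obtain ⟨v, w, ⟨a, ha, ha'⟩, ⟨c, hc, hc'⟩, hw⟩ := hG
  refine ⟨φ v, φ w, ?_, ?_, hw.lift φ hstep⟩
  · obtain ⟨d, h3, h4⟩ := key a
    exact ⟨d, h3.trans ha, by rw [h4, ha']; rfl⟩
  · obtain ⟨d, h3, h4⟩ := key c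
    exact ⟨d, h3.trans hc, by rw [h4, hc']; rfl⟩

/-- Embedded into the path, the token sits at position `0`, the goal at position `n`, and each step
raises the position by one; so the walk passes through all `n + 1` positions. -/
theorem le_nV_of_hasWalk {n : ℕ} (hs : SubOrder H (path n 0)) (hH : HasWalk H) : n < H.nV := by
  obtain ⟨f, hf, -⟩ := subOrder_iff.1 hs
  choose φ hφ using hf.1
  have key : ∀ e, ∃ d, (path n 0).lab d = H.lab e ∧ (path n 0).conn d = (H.conn e).map φ := by
    intro e
    obtain ⟨d, hd⟩ := hf.2 e
    refine ⟨d, (f.lab_eq e d hd).symm, ?_⟩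
    have h := f.conn_eq e d hd
    have h' : f.onV = fun v => some (φ v) := funext hφ
    rw [h'] at h
    apply List.map_injective_iff.2 (Option.some_injective _)
    rw [← h, List.map_map]
    rfl
  have hcases : ∀ d, ((path n 0).lab d = 0 ∧ (path n 0).conn d = [(0 : Fin (n + 1))]) ∨
      ((path n 0).lab d = 1 ∧ (path n 0).conn d = [Fin.last n]) ∨
      (path n 0).lab d = 2 ∧ ∃ j : Fin n, (path n 0).conn d = [j.castSucc, j.succ] := by
    intro d
    refine Fin.cases ?_ (fun e => Fin.cases ?_ (fun e => ?_) e) d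
    · exact .inl ⟨rfl, rfl⟩
    · exact .inr (.inl ⟨rfl, rfl⟩)
    · exact .inr (.inr ⟨rfl, e, rfl⟩)
  obtain ⟨v, w, ⟨a, ha, ha'⟩, ⟨c, hc, hc'⟩, hw⟩ := hH
  have hv : φ v = (0 : Fin (n + 1)) := by
    obtain ⟨d, h3, h4⟩ := key a
    rw [ha] at h3
    rw [ha'] at h4
    rcases hcases d with ⟨h, h'⟩ | ⟨h, h'⟩ | ⟨h, h'⟩
    · rw [h'] at h4
      exact (List.cons.inj h4).1.symm
    · rw [h] at h3; cases h3
    · rw [h] at h3; cases h3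
  have hw' : φ w = Fin.last n := by
    obtain ⟨d, h3, h4⟩ := key c
    rw [hc] at h3
    rw [hc'] at h4
    rcases hcases d with ⟨h, h'⟩ | ⟨h, h'⟩ | ⟨h, h'⟩
    · rw [h] at h3; cases h3
    · rw [h'] at h4
      exact (List.cons.inj h4).1.symm
    · rw [h] at h3; cases h3
  have hstep : ∀ u u', Step H u u' → ∃ j : Fin n, φ u = j.castSucc ∧ φ u' = j.succ := by
    rintro u u' ⟨e, h1, h2⟩
    obtain ⟨d, h3, h4⟩ := key e
    rw [h1] at h3
    rw [h2] at h4
    rcases hcases d with ⟨h, h'⟩ | ⟨h, h'⟩ | ⟨h, j, h'⟩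
    · rw [h] at h3; cases h3
    · rw [h] at h3; cases h3
    · rw [h'] at h4
      have h5 := List.cons.inj h4
      exact ⟨j, h5.1.symm, (List.cons.inj h5.2).1.symm⟩
  -- A discrete intermediate value argument by induction on the walk: all positions up to the
  -- current one have been visited.
  have hall : ∀ k : Fin (n + 1), k ≤ φ w → ∃ u, φ u = k := by
    clear hw' hc'
    induction hw with
    | refl =>
      intro k hk
      rw [hv] at hk
      exact ⟨v, hv.trans (le_antisymm (Fin.zero_le k) hk)⟩
    | tail _ hs ih =>
      rename_i u u' _
      intro k hk
      obtain ⟨j, h1, h2⟩ := hstep _ _ hs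
      by_cases hkj : k ≤ φ u
      · exact ih k hkj
      · refine ⟨u', le_antisymm ?_ hk⟩
        rw [h2]
        rw [h1, not_le] at hkj
        exact Fin.castSucc_lt_iff_succ_le.1 hkj
  have hsurj : Function.Surjective (fun u => (φ u : Fin (n + 1))) := fun k =>
    hall k (by rw [hw']; exact Fin.le_last k)
  have := Fintype.card_le_of_surjective _ hsurj
  rwa [Fintype.card_fin, Fintype.card_fin] at this

/-- All edges after the step are old ones except the new token, and old edges lift injectively. If
the walk starts at an old token, it lifts as it is; if it starts at the new token, the matched step
is put in front of its lift, starting from the deleted token. -/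
theorem HasWalk.of_applies {G' : HGraph arity} (h : Applies rule G' G) (hG : HasWalk G) :
    HasWalk G' := by
  obtain ⟨k, L', R', π, γ, m, hI, hm, hm', -, n, d, hP⟩ := h
  rw [isPushout_iff_isGluing hm hm'] at hP
  obtain ⟨j, fam, hf, -, hM, hH⟩ := hI.exists_fam
  -- The rule has no quantifications, so `L'` and `R'` are covered by `lhs` and `rhs` alone.
  have hfam : fam = [] := List.eq_nil_iff_forall_not_mem.2 fun c hc => by
    have := (hf.cell c hc).mem
    cases this
  subst hfam
  have hπ : ∀ x, x ∈ ran π := fun x => by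
    rcases hM x with h | ⟨c, hc, -⟩
    · exact h
    · cases hc
  have hj : ∀ x, x ∈ ran j := fun x => by
    rcases hH x with h | ⟨c, hc, -⟩
    · exact h
    · cases hc
  have hr : IsInjHom rule.r := by
    refine ⟨fun v v' w h h' => ?_, ?_⟩
    · cases h; cases h'; rfl
    · change ∀ e e' d : Fin 2, (![none, some 1] : Fin 2 → Option (Fin 2)) e = some d →
        (![none, some 1] : Fin 2 → Option (Fin 2)) e' = some d → e = e'
      decide
  have hγ : IsInjHom γ := by
    rw [isInjHom_iff]
    intro x x' y hx hx'
    obtain ⟨a, ha⟩ := hπ x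
    obtain ⟨a', ha'⟩ := hπ x'
    have h1 : act (rule.r ≫ j) a = some y := by rw [hf.comm, act_comp_of_some ha, hx]
    have h2 : act (rule.r ≫ j) a' = some y := by rw [hf.comm, act_comp_of_some ha', hx']
    cases isInjHom_iff.1 (isInjHom_comp hr hf.inj_h) _ _ _ h1 h2
    exact Option.some_injective _ (ha.symm.trans ha')
  have hd := hP.inj_right hγ
  have hcomm : rule.r ≫ j ≫ n = (π ≫ m) ≫ d := by
    rw [← Category.assoc, hf.comm, Category.assoc, hP.comm, Category.assoc]
  -- Of the two edges of `rhs`, the step is the image of the step of `lhs`; only the token, edge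
  -- `0`, is created.
  have hedge : ∀ e, (∃ e', edgeMap d e' = some e) ∨ edgeMap (j ≫ n) (0 : Fin 2) = some e := by
    intro e
    rcases hP.cover (.inr e) with ⟨x, hx⟩ | ⟨x, -, hx⟩
    · obtain ⟨y, hy⟩ := hj x
      have hyx : act (j ≫ n) y = some (.inr e) := act_comp_some.2 ⟨x, hy, hx⟩
      obtain ⟨y, rfl, hy'⟩ := act_eq_inr hyx
      by_cases h0 : y = (0 : Fin 2)
      · subst h0
        exact .inr hy'
      · have h1 : y = (1 : Fin 2) := (by decide : ∀ y : Fin 2, y ≠ 0 → y = 1) y h0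
        subst h1
        left
        have h2 : act (rule.r ≫ j ≫ n) (.inr (1 : Fin 2)) = some (.inr e) := by
          rw [act_comp_of_some (y := .inr (1 : Fin 2)) rfl, hyx]
        rw [hcomm] at h2
        obtain ⟨z, -, hz⟩ := act_comp_some.1 h2
        obtain ⟨z, rfl, hz'⟩ := act_eq_inr hz
        exact ⟨z, hz'⟩
    · obtain ⟨z, rfl, hz⟩ := act_eq_inr hx
      exact .inl ⟨z, hz⟩
  have hlift : ∀ e' e, edgeMap d e' = some e → G'.lab e' = G.lab e ∧
      (G'.conn e').map (nodeMap d) = (G.conn e).map some :=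
    fun e' e he => ⟨d.lab_eq _ _ he, d.conn_eq _ _ he⟩
  have hlift1 : ∀ e' e v, edgeMap d e' = some e → G.conn e = [v] →
      ∃ v', G'.conn e' = [v'] ∧ nodeMap d v' = some v := by
    intro e' e v he hv
    have h := (hlift e' e he).2
    rw [hv] at h
    obtain ⟨v', h1, h2⟩ := List.map_eq_singleton_iff.1 h
    exact ⟨v', h1, h2⟩
  obtain ⟨v, w, ⟨a, ha, ha'⟩, ⟨c, hc, hc'⟩, hw⟩ := hG
  have hnot : ∀ e, edgeMap (j ≫ n) (0 : Fin 2) = some e → G.lab e = 0 := fun e he =>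
    ((j ≫ n).lab_eq _ _ he).symm
  have hwalk : ∀ v', nodeMap d v' = some v → ∃ w', Goal G' w' ∧
      Relation.ReflTransGen (Step G') v' w' := by
    intro v' hv'
    have hreach : ∃ w', nodeMap d w' = some w ∧ Relation.ReflTransGen (Step G') v' w' := by
      clear hc'
      induction hw with
      | refl => exact ⟨v', hv', .refl⟩
      | tail _ hs ih =>
        obtain ⟨u', hu', hr'⟩ := ih
        obtain ⟨e, h1, h2⟩ := hs
        rcases hedge e with ⟨e', he'⟩ | he
        · have h := hlift e' e he'
          rw [h1, h2] at h
          obtain ⟨u₁, l, h3, h4, h5⟩ := List.map_eq_cons_iff.1 h.2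
          obtain ⟨u₂, rfl, h7⟩ := List.map_eq_singleton_iff.1 h5
          cases hd.1 _ _ _ hu' h4
          exact ⟨u₂, h7, hr'.tail ⟨e', h.1, h3⟩⟩
        · rw [hnot e he] at h1
          cases h1
    obtain ⟨w', hw', hr'⟩ := hreach
    refine ⟨w', ?_, hr'⟩
    rcases hedge c with ⟨e', he'⟩ | he
    · obtain ⟨w₁, h1, h2⟩ := hlift1 e' c w he' hc'
      cases hd.1 _ _ _ hw' h2
      exact ⟨e', (hlift e' c he').1.trans hc, h1⟩
    · rw [hnot c he] at hc
      cases hc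
  rcases hedge a with ⟨e', he'⟩ | he
  · obtain ⟨v', h1, h2⟩ := hlift1 e' a v he' ha'
    obtain ⟨w', hw', hr'⟩ := hwalk v' h2
    exact ⟨v', w', ⟨e', (hlift e' a he').1.trans ha, h1⟩, hw', hr'⟩
  -- The new token sits on the image of node `1` of `rhs`, so `v` lifts to the target `y` of the
  -- matched step from `x`, and `x` carries the token of `G'`.
  · have h1 := (j ≫ n).conn_eq _ _ he
    rw [ha'] at h1
    have h2 : nodeMap (j ≫ n) (1 : Fin 2) = some v := (List.cons.inj h1).1
    have hM := isTotalHom_comp hf.total hm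
    obtain ⟨x, hx⟩ := hM.1 (0 : Fin 2)
    obtain ⟨y, hy⟩ := hM.1 (1 : Fin 2)
    have hyd : nodeMap d y = some v := by
      have h3 : act (rule.r ≫ j ≫ n) (.inl (1 : Fin 2)) = some (.inl v) := by
        rw [act_comp_of_some (y := .inl (1 : Fin 2)) rfl]
        exact act_inl_eq.2 h2
      rw [hcomm, act_comp_of_some (act_inl_eq.2 hy)] at h3
      exact act_inl_eq.1 h3
    obtain ⟨w', hw', hr'⟩ := hwalk y hyd
    obtain ⟨t, ht⟩ := hM.2 (0 : Fin 2)
    obtain ⟨s, hs⟩ := hM.2 (1 : Fin 2)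
    have hone : ∀ z, G'.conn t = z → z = [x] := by
      rintro z rfl
      have h4 := (π ≫ m).conn_eq _ _ ht
      apply List.map_injective_iff.2 (Option.some_injective _)
      rw [← h4]
      exact congrArg (fun o => [o]) hx
    have htwo : G'.conn s = [x, y] := by
      have h4 := (π ≫ m).conn_eq _ _ hs
      apply List.map_injective_iff.2 (Option.some_injective _)
      rw [← h4]
      exact congrArg₂ (fun o o' => [o, o']) hx hy
    exact ⟨x, w', ⟨t, ((π ≫ m).lab_eq _ _ ht).symm, hone _ rfl⟩, hw',
      .head ⟨s, ((π ≫ m).lab_eq _ _ hs).symm, htwo⟩ hr'⟩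

/-! ### Forward moves of the token along a path -/

/-- The match of the rule in a path. -/
def pathMatch (n : ℕ) (i : Fin n) : PHom lhs (path n i.castSucc) where
  onV := (![some i.castSucc, some i.succ] : Fin 2 → Option (Fin (n + 1)))
  onE := (![some 0, some i.succ.succ] : Fin 2 → Option (Fin (n + 1 + 1)))
  lab_eq := by
    intro e e' h
    change Fin 2 at e
    fin_cases e <;> cases h <;> rfl
  conn_eq := by
    intro e e' h
    change Fin 2 at e
    fin_cases e <;> cases h <;> rfl

/-- The match of the right-hand side after the token has been moved. -/
def pathComatch (n : ℕ) (i : Fin n) : PHom rhs (path n i.succ) where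
  onV := (![some i.castSucc, some i.succ] : Fin 2 → Option (Fin (n + 1)))
  onE := (![some 0, some i.succ.succ] : Fin 2 → Option (Fin (n + 1 + 1)))
  lab_eq := by
    intro e e' h
    change Fin 2 at e
    fin_cases e <;> cases h <;> rfl
  conn_eq := by
    intro e e' h
    change Fin 2 at e
    fin_cases e <;> cases h <;> rfl

/-- The move of the token as a partial morphism. -/
def pathMove (n : ℕ) (i : Fin n) : PHom (path n i.castSucc) (path n i.succ) where
  onV := some
  onE := Fin.cons none fun e => some e.succ
  lab_eq := by
    intro e e' h
    change Fin (n + 1 + 1) at e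
    induction e using Fin.cases with
    | zero => cases h
    | succ e => cases h; rfl
  conn_eq := by
    intro e e' h
    change Fin (n + 1 + 1) at e
    induction e using Fin.cases with
    | zero => cases h
    | succ e =>
      cases h
      rfl

/-- The two paths have the same nodes and edges and differ only in the connection of the token edge
`0`, which is matched. Hence `pathMove` is the identity on unmatched elements and the gluing
conditions are those of a complement. -/
theorem applies_path (n : ℕ) (i : Fin n) : Applies rule (path n i.castSucc) (path n i.succ) := by
  have htot : IsTotalHom (H := path n i.castSucc) (pathMatch n i) := by
    refine ⟨fun v => ?_, fun v => ?_⟩ <;>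
    · change Fin 2 at v
      fin_cases v <;> exact ⟨_, rfl⟩
  have hinj : IsInjHom (H := path n i.castSucc) (pathMatch n i) := by
    refine ⟨fun v v' w h h' => ?_, fun v v' w h h' => ?_⟩
    · change Fin 2 at v v'
      have := h.trans h'.symm
      fin_cases v <;> fin_cases v' <;> first | rfl | skip
      · exact absurd (Option.some_injective _ this) (Fin.castSucc_lt_succ).ne
      · exact absurd (Option.some_injective _ this) (Fin.castSucc_lt_succ).ne'
    · change Fin 2 at v v'
      have := h.trans h'.symm
      fin_cases v <;> fin_cases v' <;> first | rfl | skip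
      · exact absurd (Option.some_injective _ this) (Fin.succ_ne_zero _).symm
      · exact absurd (Option.some_injective _ this) (Fin.succ_ne_zero _)
  have hinj' : IsInjHom (H := path n i.succ) (pathComatch n i) := hinj
  have hcov : ∀ v, (Sum.inl v : (path n i.succ).Elt) ∈
      ran (H := path n i.succ) (pathComatch n i) ↔ Sum.inl v ∈
      ran (H := path n i.castSucc) (pathMatch n i) := by
    intro v
    constructor
    · rintro ⟨x, hx⟩
      obtain ⟨x, rfl, h⟩ := act_eq_inl hx
      exact ⟨.inl x, act_inl_eq.2 h⟩
    · rintro ⟨x, hx⟩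
      obtain ⟨x, rfl, h⟩ := act_eq_inl hx
      exact ⟨.inl x, act_inl_eq.2 h⟩
  have hcov' : ∀ v, (Sum.inr v : (path n i.succ).Elt) ∈
      ran (H := path n i.succ) (pathComatch n i) ↔ Sum.inr v ∈
      ran (H := path n i.castSucc) (pathMatch n i) := by
    intro v
    constructor
    · rintro ⟨x, hx⟩
      obtain ⟨x, rfl, h⟩ := act_eq_inr hx
      exact ⟨.inr x, act_inr_eq.2 h⟩
    · rintro ⟨x, hx⟩
      obtain ⟨x, rfl, h⟩ := act_eq_inr hx
      exact ⟨.inr x, act_inr_eq.2 h⟩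
  have hzero : (Sum.inr (0 : Fin (n + 1 + 1)) : (path n i.castSucc).Elt) ∈
      ran (H := path n i.castSucc) (pathMatch n i) := ⟨.inr (0 : Fin 2), rfl⟩
  have hval : ∀ x w, x ∉ ran (H := path n i.castSucc) (pathMatch n i) →
      act (G := path n i.castSucc) (H := path n i.succ) (pathMove n i) x = some w → x = w := by
    rintro (v | e) w hx hw
    · cases hw; rfl
    · change Fin (n + 1 + 1) at e
      induction e using Fin.cases with
      | zero => cases hw
      | succ e => cases hw; rfl
  have hdef : ∀ x, x ∉ ran (H := path n i.castSucc) (pathMatch n i) →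
      act (G := path n i.castSucc) (H := path n i.succ) (pathMove n i) x = some x := by
    rintro (v | e) hx
    · rfl
    · change Fin (n + 1 + 1) at e
      induction e using Fin.cases with
      | zero => exact (hx hzero).elim
      | succ e => rfl
  refine ⟨0, _, _, _, _, pathMatch n i, .base, htot, hinj, ?_, pathComatch n i, pathMove n i,
    IsGluing.isPushout ⟨?_, ?_, hinj', fun v hv => ⟨_, hdef _ hv⟩, fun v hv _ => ⟨_, hdef _ hv⟩,
      ?_, ?_, ?_⟩⟩
  · rintro x ⟨u, hu, -⟩
    cases hu
  · apply hom_ext_act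
    rintro (v | v)
    · change Fin 2 at v
      fin_cases v <;> rfl
    · change Fin 2 at v
      fin_cases v <;> rfl
  · refine ⟨fun v => ?_, fun v => ?_⟩ <;>
    · change Fin 2 at v
      fin_cases v <;> exact ⟨_, rfl⟩
  · intro x x' w hx hx' hw hw'
    exact (hval _ _ hx hw).trans (hval _ _ hx' hw').symm
  · intro x w hx hw
    cases hval _ _ hx hw
    cases x with
    | inl v => exact fun h => hx ((hcov v).1 h)
    | inr v => exact fun h => hx ((hcov' v).1 h)
  · rintro (v | v)
    · by_cases hv : Sum.inl v ∈ ran (H := path n i.castSucc) (pathMatch n i)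
      · exact .inl ((hcov v).2 hv)
      · exact .inr ⟨_, hv, hdef _ hv⟩
    · by_cases hv : Sum.inr v ∈ ran (H := path n i.castSucc) (pathMatch n i)
      · exact .inl ((hcov' v).2 hv)
      · exact .inr ⟨_, hv, hdef _ hv⟩

theorem canCover_path (n : ℕ) : CanCover [rule] (path n 0) (path 0 0) := by
  refine ⟨path n (Fin.last n), ?_, subOrder_iff.2 ?_⟩
  · have : ∀ i : Fin (n + 1), Relation.ReflTransGen (Rewrites [rule]) (path n 0) (path n i) := by
      intro i
      induction i using Fin.induction with
      | zero => exact .refl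
      | succ i ih => exact ih.tail ⟨rule, by simp, applies_path n i⟩
    exact this _
  · let f : PHom (path 0 0) (path n (Fin.last n)) :=
      { onV := fun _ => some (Fin.last n)
        onE := (![some 0, some (Fin.succ 0)] : Fin 2 → Option (Fin (n + 1 + 1)))
        lab_eq := by
          intro e e' h
          change Fin 2 at e
          fin_cases e <;> cases h <;> rfl
        conn_eq := by
          intro e e' h
          change Fin 2 at e
          fin_cases e <;> cases h <;> rfl }
    refine ⟨f, ⟨fun v => ⟨_, rfl⟩, fun e => ?_⟩, ⟨fun v v' w _ _ => ?_, fun e e' w h h' => ?_⟩⟩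
    · change Fin 2 at e
      fin_cases e <;> exact ⟨_, rfl⟩
    · change Fin 1 at v v'
      exact Subsingleton.elim v v'
    · change Fin 2 at e e'
      have := h.trans h'.symm
      fin_cases e <;> fin_cases e' <;> first | rfl | cases this

/-- Having a walk is inherited by predecessors and by larger graphs, so it holds throughout the
search. A result would also have to contain a subgraph of every path, and such a subgraph has as
many nodes as the path. -/
theorem not_searchResult {b : URule arity → HGraph arity → ℕ}
    (hb : ∀ ρ G, IsInstBound ρ G (b ρ G)) (W : List (HGraph arity)) :
    ¬ SearchResult b [rule] [path 0 0] W := by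
  intro h
  have hW : ∀ H ∈ W, HasWalk H := by
    have h1 := h.1
    clear h
    induction h1 with
    | refl =>
      intro H hH
      rw [List.mem_singleton.1 hH]
      exact ⟨(0 : Fin 1), (0 : Fin 1), ⟨(0 : Fin 2), rfl, rfl⟩, ⟨(1 : Fin 2), rfl, rfl⟩, .refl⟩
    | tail _ hs ih =>
      intro H hH
      rcases hs.subset_pred hb hH with hH | ⟨G', ⟨K, ⟨K', hK', hs'⟩, ρ, hρ, hr⟩, hs''⟩
      · exact ih H hH
      · rw [List.mem_singleton.1 hρ] at hr
        exact (HasWalk.of_applies hr ((ih K' hK').mono hs')).mono hs''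
  -- The total number of nodes in `W` bounds each member and serves as the length of a path that `W`
  -- cannot represent.
  have hle : ∀ H ∈ W, H.nV ≤ (W.map HGraph.nV).sum := fun H hH =>
    List.single_le_sum (fun _ _ => Nat.zero_le _) _ (List.mem_map_of_mem hH)
  obtain ⟨H, hH, hs⟩ := h.canCover_subset hb
    ⟨path 0 0, List.mem_singleton.2 rfl, canCover_path (W.map HGraph.nV).sum⟩
  exact absurd (le_nV_of_hasWalk hs (hW H hH)) (not_lt.2 (hle H hH))

end Walk
end UGTS

namespace UGTS

/-! ### Primitive recursive operations on lists -/

section Combinators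

variable {α β γ σ : Type} [Primcodable α] [Primcodable β] [Primcodable γ] [Primcodable σ]

/-- Boolean equality test. -/
def eqb {α : Type} [DecidableEq α] (a b : α) : Bool := decide (a = b)

@[simp] theorem eqb_iff {α : Type} [DecidableEq α] {a b : α} : eqb a b = true ↔ a = b := by
  simp [eqb]

/-- Here and below, `α` is the context of free variables, and a binder extends it to a product.
Proofs of primitive recursiveness can then follow the syntax of a definition, outer variables being
reached through `Primrec.fst`. -/
theorem primrec_eqb [DecidableEq β] {f g : α → β} (hf : Primrec f) (hg : Primrec g) :
    Primrec fun a => eqb (f a) (g a) :=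
  (Primrec.eq.decide.comp hf hg).of_eq fun a => by simp [eqb]

theorem primrec_self : Primrec fun a : α => a :=
  Primrec.id

theorem primrec_fst {f : α → β × γ} (hf : Primrec f) : Primrec fun a => (f a).1 :=
  Primrec.fst.comp hf

theorem primrec_snd {f : α → β × γ} (hf : Primrec f) : Primrec fun a => (f a).2 :=
  Primrec.snd.comp hf

theorem primrec_not {f : α → Bool} (hf : Primrec f) : Primrec fun a => !f a :=
  Primrec.not.comp hf

theorem primrec_and {f g : α → Bool} (hf : Primrec f) (hg : Primrec g) :
    Primrec fun a => f a && g a :=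
  Primrec.and.comp hf hg

theorem primrec_or {f g : α → Bool} (hf : Primrec f) (hg : Primrec g) :
    Primrec fun a => f a || g a :=
  Primrec.or.comp hf hg

theorem primrec_cons {f : α → β} {g : α → List β} (hf : Primrec f) (hg : Primrec g) :
    Primrec fun a => f a :: g a :=
  Primrec.list_cons.comp hf hg

theorem primrec_append {f g : α → List β} (hf : Primrec f) (hg : Primrec g) :
    Primrec fun a => f a ++ g a :=
  Primrec.list_append.comp hf hg

theorem primrec_some {f : α → β} (hf : Primrec f) : Primrec fun a => some (f a) :=
  Primrec.option_some.comp hf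

theorem primrec_range {f : α → ℕ} (hf : Primrec f) : Primrec fun a => List.range (f a) :=
  Primrec.list_range.comp hf

theorem primrec_length {f : α → List β} (hf : Primrec f) : Primrec fun a => (f a).length :=
  Primrec.list_length.comp hf

theorem primrec_toList {f : α → Option β} (hf : Primrec f) : Primrec fun a => (f a).toList :=
  Primrec.optionToList.comp hf

theorem primrec_getElem? {f : α → List β} {g : α → ℕ} (hf : Primrec f) (hg : Primrec g) :
    Primrec fun a => (f a)[g a]? :=
  Primrec.list_getElem?.comp hf hg

theorem primrec_add {f g : α → ℕ} (hf : Primrec f) (hg : Primrec g) : Primrec fun a => f a + g a :=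
  Primrec.nat_add.comp hf hg

theorem primrec_mul {f g : α → ℕ} (hf : Primrec f) (hg : Primrec g) : Primrec fun a => f a * g a :=
  Primrec.nat_mul.comp hf hg

theorem primrec_map {l : α → List β} {f : α → β → γ} (hl : Primrec l)
    (hf : Primrec fun x : α × β => f x.1 x.2) : Primrec fun a => (l a).map (f a) :=
  Primrec.list_map hl hf

theorem primrec_flatMap {l : α → List β} {f : α → β → List γ} (hl : Primrec l)
    (hf : Primrec fun x : α × β => f x.1 x.2) : Primrec fun a => (l a).flatMap (f a) :=
  Primrec.list_flatMap hl hf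

theorem primrec_bind {l : α → Option β} {f : α → β → Option γ} (hl : Primrec l)
    (hf : Primrec fun x : α × β => f x.1 x.2) : Primrec fun a => (l a).bind (f a) :=
  Primrec.option_bind hl hf

theorem primrec_optionMap {l : α → Option β} {f : α → β → γ} (hl : Primrec l)
    (hf : Primrec fun x : α × β => f x.1 x.2) : Primrec fun a => (l a).map (f a) :=
  Primrec.option_map hl hf

theorem primrec_cond {c : α → Bool} {f g : α → β} (hc : Primrec c) (hf : Primrec f)
    (hg : Primrec g) : Primrec fun a => bif c a then f a else g a :=
  Primrec.cond hc hf hg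

theorem primrec_all {l : α → List β} {p : α → β → Bool} (hl : Primrec l)
    (hp : Primrec fun x : α × β => p x.1 x.2) : Primrec fun a => (l a).all (p a) := by
  refine (Primrec.list_foldr (h := fun a x => p a x.1 && x.2) hl (Primrec.const true) ?_).of_eq
    fun a => ?_
  · exact Primrec.and.comp (hp.comp (Primrec.fst.pair (Primrec.fst.comp Primrec.snd)))
      (Primrec.snd.comp Primrec.snd)
  · induction l a with
    | nil => rfl
    | cons b l ih => simp only [List.foldr_cons, List.all_cons, ih]

theorem primrec_any {l : α → List β} {p : α → β → Bool} (hl : Primrec l)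
    (hp : Primrec fun x : α × β => p x.1 x.2) : Primrec fun a => (l a).any (p a) := by
  refine (Primrec.list_foldr (h := fun a x => p a x.1 || x.2) hl (Primrec.const false) ?_).of_eq
    fun a => ?_
  · exact Primrec.or.comp (hp.comp (Primrec.fst.pair (Primrec.fst.comp Primrec.snd)))
      (Primrec.snd.comp Primrec.snd)
  · induction l a with
    | nil => rfl
    | cons b l ih => simp only [List.foldr_cons, List.any_cons, ih]

theorem primrec_filter {l : α → List β} {p : α → β → Bool} (hl : Primrec l)
    (hp : Primrec fun x : α × β => p x.1 x.2) : Primrec fun a => (l a).filter (p a) := by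
  refine (primrec_flatMap (f := fun a b => bif p a b then [b] else []) hl
    (primrec_cond hp (primrec_cons Primrec.snd (Primrec.const [])) (Primrec.const []))).of_eq
    fun a => ?_
  induction l a with
  | nil => rfl
  | cons b l ih =>
    rw [List.flatMap_cons, ih, List.filter_cons]
    cases p a b <;> rfl

/-- The lists of a given length over a list, such that `r` holds between each entry and the later
ones. -/
def pairwiseLists {α : Type} (r : α → α → Bool) (l : List α) : ℕ → List (List α)
  | 0 => [[]]
  | k + 1 => (pairwiseLists r l k).flatMap fun t => (l.filter fun a => t.all (r a)).map fun a => a :: t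

theorem mem_pairwiseLists {α : Type} {r : α → α → Bool} {l : List α} {k : ℕ} {t : List α} :
    t ∈ pairwiseLists r l k ↔
      t.length = k ∧ (∀ a ∈ t, a ∈ l) ∧ t.Pairwise fun a b => r a b = true := by
  induction k generalizing t with
  | zero =>
    simp only [pairwiseLists, List.mem_singleton, List.length_eq_zero_iff]
    constructor
    · rintro rfl
      simp
    · exact fun h => h.1
  | succ k ih =>
    simp only [pairwiseLists, List.mem_flatMap, List.mem_map, List.mem_filter, List.all_eq_true]
    constructor
    · rintro ⟨t, ht, a, ⟨ha, har⟩, rfl⟩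
      obtain ⟨h1, h2, h3⟩ := ih.1 ht
      exact ⟨by simp [h1], by simpa [ha] using h2, List.pairwise_cons.2 ⟨har, h3⟩⟩
    · rintro ⟨h1, h2, h3⟩
      cases t with
      | nil => simp at h1
      | cons a t =>
        rw [List.pairwise_cons] at h3
        exact ⟨t, ih.2 ⟨by simpa using h1, fun b hb => h2 b (List.mem_cons_of_mem _ hb), h3.2⟩, a,
          ⟨h2 a List.mem_cons_self, h3.1⟩, rfl⟩

theorem primrec_pairwiseLists {r : γ → α → α → Bool} {l : γ → List α} {n : γ → ℕ}
    (hr : Primrec fun x : (γ × α) × α => r x.1.1 x.1.2 x.2) (hl : Primrec l) (hn : Primrec n) :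
    Primrec fun c => pairwiseLists (r c) (l c) (n c) := by
  have hstep : Primrec fun x : γ × ℕ × List (List α) => x.2.2.flatMap fun t =>
      ((l x.1).filter fun a => t.all (r x.1 a)).map fun a => a :: t := by
    refine primrec_flatMap (primrec_snd Primrec.snd) (primrec_map (primrec_filter
      (hl.comp (primrec_fst Primrec.fst)) (primrec_all (primrec_snd Primrec.fst) ?_)) ?_)
    · exact hr.comp (Primrec.pair (Primrec.pair (primrec_fst (primrec_fst (primrec_fst
        Primrec.fst))) (primrec_snd Primrec.fst)) Primrec.snd)
    · exact primrec_cons Primrec.snd (primrec_snd Primrec.fst)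
  refine (Primrec.nat_rec' hn (Primrec.const [[]]) hstep.to₂).of_eq fun c => ?_
  induction n c with
  | zero => rfl
  | succ k ih => simp only [pairwiseLists, ← ih]

/-- The lists of a given length over a list. -/
def listsOf {α : Type} (l : List α) (k : ℕ) : List (List α) := pairwiseLists (fun _ _ => true) l k

theorem mem_listsOf {α : Type} {l : List α} {k : ℕ} {t : List α} :
    t ∈ listsOf l k ↔ t.length = k ∧ ∀ a ∈ t, a ∈ l := by
  rw [listsOf, mem_pairwiseLists]
  simp [List.pairwise_iff_getElem]

theorem primrec_listsOf {l : γ → List α} {n : γ → ℕ} (hl : Primrec l) (hn : Primrec n) :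
    Primrec fun c => listsOf (l c) (n c) :=
  primrec_pairwiseLists (Primrec.const true) hl hn

end Combinators

/-! ### Codes of elements and morphisms -/

/-- Codes of elements: `(false, v)` for the node `v` and `(true, e)` for the edge `e`. -/
abbrev Pt := Bool × ℕ

section Codes

variable {Λ : Type}

/-- The codes of the elements of a graph. -/
def pts (c : GCode Λ) : List Pt :=
  (List.range c.1).map (fun v => (false, v)) ++ (List.range c.2.length).map fun e => (true, e)

/-- Lookup in a table of values. -/
def lookTable (t : List (Option ℕ)) (v : ℕ) : Option ℕ := (t[v]?).bind fun o => o

/-- The action of a coded morphism on codes of elements. -/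
def look (t : MCode) (x : Pt) : Option Pt :=
  (lookTable (bif x.1 then t.2 else t.1) x.2).map fun y => (x.1, y)

/-- Composition of coded morphisms. -/
def compCode (s t : MCode) : MCode :=
  (s.1.map fun o => o.bind fun v => lookTable t.1 v, s.2.map fun o => o.bind fun v => lookTable t.2 v)

/-- The coded morphism `t`, defined on the graph `G`, has the value `y`. -/
def inRan (G : GCode Λ) (t : MCode) (y : Pt) : Bool := (pts G).any fun x => eqb (look t x) (some y)

/-- The coded morphism is total. -/
def totalCode (G : GCode Λ) (t : MCode) : Bool := (pts G).all fun x => !eqb (look t x) none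

/-- The coded morphism is injective. -/
def injCode (G : GCode Λ) (t : MCode) : Bool :=
  (pts G).all fun x => (pts G).all fun x' =>
    eqb (look t x) none || (!eqb (look t x) (look t x') || eqb x x')

/-- The value tables for morphisms from `G` to `H`. -/
def tables (G H : GCode Λ) : List MCode :=
  (listsOf (none :: (List.range H.1).map some) G.1).flatMap fun s =>
    (listsOf (none :: (List.range H.2.length).map some) G.2.length).map fun t => (s, t)

section Decidable

variable [DecidableEq Λ]

/-- A pair of value tables preserves labels and connections. -/
def isHomCode (G H : GCode Λ) (t : MCode) : Bool :=
  (List.range G.2.length).all fun i => (lookTable t.2 i).toList.all fun j =>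
    (G.2[i]?).toList.all fun d => (H.2[j]?).toList.all fun d' =>
      eqb d.1 d'.1 && eqb (d.2.map fun v => lookTable t.1 v) (d'.2.map some)

/-- The codes of the morphisms from `G` to `H`. -/
def homs (G H : GCode Λ) : List MCode := (tables G H).filter fun t => isHomCode G H t

/-- `G` is a subgraph of `H`. -/
def subCode (G H : GCode Λ) : Bool := (homs G H).any fun t => totalCode G t && injCode G t

end Decidable

/-! ### Primitive recursiveness of the operations on coded morphisms -/

variable [Primcodable Λ] {α : Type} [Primcodable α]

theorem primrec_pts {f_c : α → GCode Λ} (h_c : Primrec f_c) : Primrec fun a => pts (f_c a) := by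
  unfold pts
  exact primrec_append (primrec_map (primrec_range (primrec_fst h_c)) (Primrec.pair (Primrec.const
    _) Primrec.snd)) (primrec_map (primrec_range (primrec_length (primrec_snd h_c))) (Primrec.pair
    (Primrec.const _) Primrec.snd))

theorem primrec_lookTable {f_t : α → List (Option ℕ)} {f_v : α → ℕ} (h_t : Primrec f_t) (h_v :
    Primrec f_v) : Primrec fun a => lookTable (f_t a) (f_v a) := by
  unfold lookTable
  exact primrec_bind (primrec_getElem? h_t h_v) Primrec.snd

theorem primrec_look {f_t : α → MCode} {f_x : α → Pt} (h_t : Primrec f_t) (h_x : Primrec f_x) :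
    Primrec fun a => look (f_t a) (f_x a) := by
  unfold look
  exact primrec_optionMap (primrec_lookTable (primrec_cond (primrec_fst h_x) (primrec_snd h_t)
    (primrec_fst h_t)) (primrec_snd h_x)) (Primrec.pair (primrec_fst (h_x.comp Primrec.fst))
    Primrec.snd)

theorem primrec_compCode {f_s f_t : α → MCode} (h_s : Primrec f_s) (h_t : Primrec f_t) : Primrec
    fun a => compCode (f_s a) (f_t a) := by
  unfold compCode
  exact Primrec.pair (primrec_map (primrec_fst h_s) (primrec_bind Primrec.snd (primrec_lookTable
    (primrec_fst (h_t.comp (primrec_fst Primrec.fst))) Primrec.snd))) (primrec_map (primrec_snd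
    h_s) (primrec_bind Primrec.snd (primrec_lookTable (primrec_snd (h_t.comp (primrec_fst
    Primrec.fst))) Primrec.snd)))

theorem primrec_inRan {f_G : α → GCode Λ} {f_t : α → MCode} {f_y : α → Pt} (h_G : Primrec f_G)
    (h_t : Primrec f_t) (h_y : Primrec f_y) : Primrec fun a => inRan (f_G a) (f_t a) (f_y a) := by
  unfold inRan
  exact primrec_any (primrec_pts h_G) (primrec_eqb (primrec_look (h_t.comp Primrec.fst)
    Primrec.snd) (primrec_some (h_y.comp Primrec.fst)))

theorem primrec_totalCode {f_G : α → GCode Λ} {f_t : α → MCode} (h_G : Primrec f_G) (h_t : Primrec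
    f_t) : Primrec fun a => totalCode (f_G a) (f_t a) := by
  unfold totalCode
  exact primrec_all (primrec_pts h_G) (primrec_not (primrec_eqb (primrec_look (h_t.comp
    Primrec.fst) Primrec.snd) (Primrec.const _)))

theorem primrec_injCode {f_G : α → GCode Λ} {f_t : α → MCode} (h_G : Primrec f_G) (h_t : Primrec
    f_t) : Primrec fun a => injCode (f_G a) (f_t a) := by
  unfold injCode
  exact primrec_all (primrec_pts h_G) (primrec_all (primrec_pts (h_G.comp Primrec.fst))
    (primrec_or (primrec_eqb (primrec_look (h_t.comp (primrec_fst Primrec.fst)) (primrec_snd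
    Primrec.fst)) (Primrec.const _)) (primrec_or (primrec_not (primrec_eqb (primrec_look (h_t.comp
    (primrec_fst Primrec.fst)) (primrec_snd Primrec.fst)) (primrec_look (h_t.comp (primrec_fst
    Primrec.fst)) Primrec.snd))) (primrec_eqb (primrec_snd Primrec.fst) Primrec.snd))))

theorem primrec_tables {f_G f_H : α → GCode Λ} (h_G : Primrec f_G) (h_H : Primrec f_H) : Primrec
    fun a => tables (f_G a) (f_H a) := by
  unfold tables
  exact primrec_flatMap (primrec_listsOf (primrec_cons (Primrec.const _) (primrec_map
    (primrec_range (primrec_fst h_H)) (primrec_some Primrec.snd))) (primrec_fst h_G)) (primrec_map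
    (primrec_listsOf (primrec_cons (Primrec.const _) (primrec_map (primrec_range (primrec_length
    (primrec_snd (h_H.comp Primrec.fst)))) (primrec_some Primrec.snd))) (primrec_length
    (primrec_snd (h_G.comp Primrec.fst)))) (Primrec.pair (primrec_snd Primrec.fst) Primrec.snd))

variable [DecidableEq Λ]

theorem primrec_isHomCode {f_G f_H : α → GCode Λ} {f_t : α → MCode} (h_G : Primrec f_G) (h_H :
    Primrec f_H) (h_t : Primrec f_t) : Primrec fun a => isHomCode (f_G a) (f_H a) (f_t a) := by
  unfold isHomCode
  exact primrec_all (primrec_range (primrec_length (primrec_snd h_G))) (primrec_all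
    (primrec_toList (primrec_lookTable (primrec_snd (h_t.comp Primrec.fst)) Primrec.snd))
    (primrec_all (primrec_toList (primrec_getElem? (primrec_snd (h_G.comp (primrec_fst
    Primrec.fst))) (primrec_snd Primrec.fst))) (primrec_all (primrec_toList (primrec_getElem?
    (primrec_snd (h_H.comp (primrec_fst (primrec_fst Primrec.fst)))) (primrec_snd Primrec.fst)))
    (primrec_and (primrec_eqb (primrec_fst (primrec_snd Primrec.fst)) (primrec_fst Primrec.snd))
    (primrec_eqb (primrec_map (primrec_snd (primrec_snd Primrec.fst)) (primrec_lookTable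
    (primrec_fst (h_t.comp (primrec_fst (primrec_fst (primrec_fst (primrec_fst Primrec.fst))))))
    Primrec.snd)) (primrec_map (primrec_snd Primrec.snd) (primrec_some Primrec.snd)))))))

theorem primrec_homs {f_G f_H : α → GCode Λ} (h_G : Primrec f_G) (h_H : Primrec f_H) : Primrec fun
    a => homs (f_G a) (f_H a) := by
  unfold homs
  exact primrec_filter (primrec_tables h_G h_H) (primrec_isHomCode (h_G.comp Primrec.fst)
    (h_H.comp Primrec.fst) Primrec.snd)

theorem primrec_subCode {f_G f_H : α → GCode Λ} (h_G : Primrec f_G) (h_H : Primrec f_H) : Primrec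
    fun a => subCode (f_G a) (f_H a) := by
  unfold subCode
  exact primrec_any (primrec_homs h_G h_H) (primrec_and (primrec_totalCode (h_G.comp Primrec.fst)
    Primrec.snd) (primrec_injCode (h_G.comp Primrec.fst) Primrec.snd))

end Codes

end UGTS

namespace UGTS

/-! ### Codes of backward steps -/

/-- Codes of universal quantifications. -/
abbrev UCode (Λ : Type) := GCode Λ × GCode Λ × MCode × MCode

/-- Codes of cells. -/
abbrev CCode (Λ : Type) := UCode Λ × MCode × MCode

section BackCodes

variable {Λ : Type}

/-- The composition of the two morphisms of a coded quantification. -/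
def pqCode (u : UCode Λ) : MCode := compCode u.2.2.1 u.2.2.2

/-- Coded version of `IsCell.inj_new`. -/
def injNewCode (ρ : RCode Λ) (c : CCode Λ) : Bool :=
  (pts c.1.2.1).all fun y => (pts c.1.2.1).all fun y' =>
    inRan ρ.1.1 (pqCode c.1) y || (inRan ρ.1.1 (pqCode c.1) y' ||
      (eqb (look c.2.2 y) none || (!eqb (look c.2.2 y) (look c.2.2 y') || eqb y y')))

/-- Coded version of `IsCell.disj_new`. -/
def disjNewCode (ρ : RCode Λ) (h : MCode) (c : CCode Λ) : Bool :=
  (pts c.1.2.1).all fun y => inRan ρ.1.1 (pqCode c.1) y ||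
    (look c.2.2 y).toList.all fun w => !inRan ρ.1.2.1 h w

/-- Coded version of `IsCell`. -/
def isCellCode (ρ : RCode Λ) (m h g : MCode) (c : CCode Λ) : Bool :=
  totalCode c.1.1 c.2.1 && (injCode c.1.1 c.2.1 && (eqb (compCode c.1.2.2.1 c.2.1) m &&
    (eqb (compCode (pqCode c.1) c.2.2) (compCode ρ.1.2.2 h) &&
      (eqb (compCode c.2.1 g) (compCode c.1.2.2.2 c.2.2) &&
        (injNewCode ρ c && disjNewCode ρ h c)))))

/-- Coded version of `Cell.Disj`. -/
def disjCode (ρ : RCode Λ) (c c' : CCode Λ) : Bool :=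
  ((pts c.1.1).all fun y => inRan ρ.1.1 c.1.2.2.1 y ||
    !(look c.2.1 y).toList.any fun w => inRan c'.1.1 c'.2.1 w) &&
  ((pts c.1.2.1).all fun y => inRan ρ.1.1 (pqCode c.1) y ||
    !(look c.2.2 y).toList.any fun w => inRan c'.1.2.1 c'.2.2 w)

/-- Coded version of `covM`. -/
def covMCode (ρ : RCode Λ) (m : MCode) (t : List (CCode Λ)) (x : Pt) : Bool :=
  inRan ρ.1.1 m x || t.any fun c => inRan c.1.1 c.2.1 x

/-- Coded version of `covH`. -/
def covHCode (ρ : RCode Λ) (h : MCode) (t : List (CCode Λ)) (y : Pt) : Bool :=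
  inRan ρ.1.2.1 h y || t.any fun c => inRan c.1.2.1 c.2.2 y

/-- Coded version of incidence. -/
def incCode (G : GCode Λ) (e v : ℕ) : Bool :=
  (G.2[e]?).toList.any fun d => d.2.any fun w => eqb w v

/-- Coded version of `URule.qNodes`. -/
def qNodeCode (ρ : RCode Λ) (v : ℕ) : Bool :=
  ρ.2.any fun u => (look u.2.2.1 (false, v)).toList.any fun y =>
    (List.range u.1.2.length).any fun d => incCode u.1 d y.2 && !inRan ρ.1.1 u.2.2.1 (true, d)

/-- Coded version of `IsBackFam.defined`. -/
def definedCode (ρ : RCode Λ) (X : GCode Λ) (m h g : MCode) (t : List (CCode Λ)) : Bool :=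
  (pts X).all fun x => covMCode ρ m t x || (look g x).toList.any fun w => !covHCode ρ h t w

/-- Coded version of `IsBackFam.inj_outside`. -/
def injOutCode (ρ : RCode Λ) (X : GCode Λ) (m g : MCode) (t : List (CCode Λ)) : Bool :=
  (pts X).all fun x => (pts X).all fun x' => covMCode ρ m t x || (covMCode ρ m t x' ||
    (!eqb (look g x) (look g x') || eqb x x'))

/-- Coded version of `IsBackFam.cover`. -/
def coverCode (ρ : RCode Λ) (X Y : GCode Λ) (m h g : MCode) (t : List (CCode Λ)) : Bool :=
  (pts Y).all fun w => covHCode ρ h t w ||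
    (pts X).any fun x => !covMCode ρ m t x && eqb (look g x) (some w)

/-- Coded version of `IsBackFam.app`. -/
def appCode (ρ : RCode Λ) (X : GCode Λ) (m : MCode) (t : List (CCode Λ)) : Bool :=
  (List.range ρ.1.1.1).all fun v => !qNodeCode ρ v ||
    (look m (false, v)).toList.all fun y => (List.range X.2.length).all fun e =>
      !incCode X e y.2 || covMCode ρ m t (true, e)

/-- A bound on the size of the results of backward steps from `Y` with `n` cells. -/
def sizeBound (ρ : RCode Λ) (Y : GCode Λ) (n : ℕ) : ℕ :=
  (pts ρ.1.1).length + n * (ρ.2.flatMap fun u => pts u.1).length + (pts Y).length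

section Decidable

variable [DecidableEq Λ]

/-- The coded cells that are attached to `m`, `h` and `g`. -/
def cells (ρ : RCode Λ) (X Y : GCode Λ) (m h g : MCode) : List (CCode Λ) :=
  (ρ.2.flatMap fun u => (homs u.1 X).flatMap fun s => (homs u.2.1 Y).map fun t => (u, s, t)).filter
    fun c => isCellCode ρ m h g c

/-- There is a coded family of at most `n` cells that represents a backward step. -/
def backFamCode (ρ : RCode Λ) (X Y : GCode Λ) (m h g : MCode) (n : ℕ) : Bool :=
  (List.range (n + 1)).any fun k => (pairwiseLists (disjCode ρ) (cells ρ X Y m h g) k).any fun t =>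
    definedCode ρ X m h g t && (injOutCode ρ X m g t && (coverCode ρ X Y m h g t && appCode ρ X m t))

/-- The graph `X` results from `Y` by a backward step with at most `n` cells. -/
def backCode (ρ : RCode Λ) (X Y : GCode Λ) (n : ℕ) : Bool :=
  (homs ρ.1.1 X).any fun m => (homs ρ.1.2.1 Y).any fun h => (homs X Y).any fun g =>
    totalCode ρ.1.1 m && (injCode ρ.1.1 m && (injCode ρ.1.2.1 h &&
      (eqb (compCode ρ.1.2.2 h) (compCode m g) && backFamCode ρ X Y m h g n)))

end Decidable

/-! ### Primitive recursiveness of the test for backward steps -/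

variable [Primcodable Λ] {α : Type} [Primcodable α]

theorem primrec_pqCode {f_u : α → UCode Λ} (h_u : Primrec f_u) : Primrec fun a => pqCode (f_u a)
    := by
  unfold pqCode
  exact primrec_compCode (primrec_fst (primrec_snd (primrec_snd h_u))) (primrec_snd (primrec_snd
    (primrec_snd h_u)))

theorem primrec_injNewCode {f_ρ : α → RCode Λ} {f_c : α → CCode Λ} (h_ρ : Primrec f_ρ) (h_c :
    Primrec f_c) : Primrec fun a => injNewCode (f_ρ a) (f_c a) := by
  unfold injNewCode
  exact primrec_all (primrec_pts (primrec_fst (primrec_snd (primrec_fst h_c)))) (primrec_all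
    (primrec_pts (primrec_fst (primrec_snd (primrec_fst (h_c.comp Primrec.fst))))) (primrec_or
    (primrec_inRan (primrec_fst (primrec_fst (h_ρ.comp (primrec_fst Primrec.fst))))
    (primrec_pqCode (primrec_fst (h_c.comp (primrec_fst Primrec.fst)))) (primrec_snd Primrec.fst))
    (primrec_or (primrec_inRan (primrec_fst (primrec_fst (h_ρ.comp (primrec_fst Primrec.fst))))
    (primrec_pqCode (primrec_fst (h_c.comp (primrec_fst Primrec.fst)))) Primrec.snd) (primrec_or
    (primrec_eqb (primrec_look (primrec_snd (primrec_snd (h_c.comp (primrec_fst Primrec.fst))))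
    (primrec_snd Primrec.fst)) (Primrec.const _)) (primrec_or (primrec_not (primrec_eqb
    (primrec_look (primrec_snd (primrec_snd (h_c.comp (primrec_fst Primrec.fst)))) (primrec_snd
    Primrec.fst)) (primrec_look (primrec_snd (primrec_snd (h_c.comp (primrec_fst Primrec.fst))))
    Primrec.snd))) (primrec_eqb (primrec_snd Primrec.fst) Primrec.snd))))))

theorem primrec_disjNewCode {f_ρ : α → RCode Λ} {f_h : α → MCode} {f_c : α → CCode Λ} (h_ρ :
    Primrec f_ρ) (h_h : Primrec f_h) (h_c : Primrec f_c) : Primrec fun a => disjNewCode (f_ρ a)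
    (f_h a) (f_c a) := by
  unfold disjNewCode
  exact primrec_all (primrec_pts (primrec_fst (primrec_snd (primrec_fst h_c)))) (primrec_or
    (primrec_inRan (primrec_fst (primrec_fst (h_ρ.comp Primrec.fst))) (primrec_pqCode (primrec_fst
    (h_c.comp Primrec.fst))) Primrec.snd) (primrec_all (primrec_toList (primrec_look (primrec_snd
    (primrec_snd (h_c.comp Primrec.fst))) Primrec.snd)) (primrec_not (primrec_inRan (primrec_fst
    (primrec_snd (primrec_fst (h_ρ.comp (primrec_fst Primrec.fst))))) (h_h.comp (primrec_fst
    Primrec.fst)) Primrec.snd))))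

theorem primrec_isCellCode {f_ρ : α → RCode Λ} {f_m f_h f_g : α → MCode} {f_c : α → CCode Λ} (h_ρ
    : Primrec f_ρ) (h_m : Primrec f_m) (h_h : Primrec f_h) (h_g : Primrec f_g) (h_c : Primrec f_c)
    : Primrec fun a => isCellCode (f_ρ a) (f_m a) (f_h a) (f_g a) (f_c a) := by
  unfold isCellCode
  exact primrec_and (primrec_totalCode (primrec_fst (primrec_fst h_c)) (primrec_fst (primrec_snd
    h_c))) (primrec_and (primrec_injCode (primrec_fst (primrec_fst h_c)) (primrec_fst (primrec_snd
    h_c))) (primrec_and (primrec_eqb (primrec_compCode (primrec_fst (primrec_snd (primrec_snd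
    (primrec_fst h_c)))) (primrec_fst (primrec_snd h_c))) h_m) (primrec_and (primrec_eqb
    (primrec_compCode (primrec_pqCode (primrec_fst h_c)) (primrec_snd (primrec_snd h_c)))
    (primrec_compCode (primrec_snd (primrec_snd (primrec_fst h_ρ))) h_h)) (primrec_and
    (primrec_eqb (primrec_compCode (primrec_fst (primrec_snd h_c)) h_g) (primrec_compCode
    (primrec_snd (primrec_snd (primrec_snd (primrec_fst h_c)))) (primrec_snd (primrec_snd h_c))))
    (primrec_and (primrec_injNewCode h_ρ h_c) (primrec_disjNewCode h_ρ h_h h_c))))))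

theorem primrec_disjCode {f_ρ : α → RCode Λ} {f_c f_d : α → CCode Λ} (h_ρ : Primrec f_ρ) (h_c :
    Primrec f_c) (h_d : Primrec f_d) : Primrec fun a => disjCode (f_ρ a) (f_c a) (f_d a) := by
  unfold disjCode
  exact primrec_and (primrec_all (primrec_pts (primrec_fst (primrec_fst h_c))) (primrec_or
    (primrec_inRan (primrec_fst (primrec_fst (h_ρ.comp Primrec.fst))) (primrec_fst (primrec_snd
    (primrec_snd (primrec_fst (h_c.comp Primrec.fst))))) Primrec.snd) (primrec_not (primrec_any
    (primrec_toList (primrec_look (primrec_fst (primrec_snd (h_c.comp Primrec.fst))) Primrec.snd))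
    (primrec_inRan (primrec_fst (primrec_fst (h_d.comp (primrec_fst Primrec.fst)))) (primrec_fst
    (primrec_snd (h_d.comp (primrec_fst Primrec.fst)))) Primrec.snd))))) (primrec_all (primrec_pts
    (primrec_fst (primrec_snd (primrec_fst h_c)))) (primrec_or (primrec_inRan (primrec_fst
    (primrec_fst (h_ρ.comp Primrec.fst))) (primrec_pqCode (primrec_fst (h_c.comp Primrec.fst)))
    Primrec.snd) (primrec_not (primrec_any (primrec_toList (primrec_look (primrec_snd (primrec_snd
    (h_c.comp Primrec.fst))) Primrec.snd)) (primrec_inRan (primrec_fst (primrec_snd (primrec_fst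
    (h_d.comp (primrec_fst Primrec.fst))))) (primrec_snd (primrec_snd (h_d.comp (primrec_fst
    Primrec.fst)))) Primrec.snd)))))

theorem primrec_covMCode {f_ρ : α → RCode Λ} {f_m : α → MCode} {f_t : α → List (CCode Λ)} {f_x : α
    → Pt} (h_ρ : Primrec f_ρ) (h_m : Primrec f_m) (h_t : Primrec f_t) (h_x : Primrec f_x) :
    Primrec fun a => covMCode (f_ρ a) (f_m a) (f_t a) (f_x a) := by
  unfold covMCode
  exact primrec_or (primrec_inRan (primrec_fst (primrec_fst h_ρ)) h_m h_x) (primrec_any h_t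
    (primrec_inRan (primrec_fst (primrec_fst Primrec.snd)) (primrec_fst (primrec_snd Primrec.snd))
    (h_x.comp Primrec.fst)))

theorem primrec_covHCode {f_ρ : α → RCode Λ} {f_h : α → MCode} {f_t : α → List (CCode Λ)} {f_y : α
    → Pt} (h_ρ : Primrec f_ρ) (h_h : Primrec f_h) (h_t : Primrec f_t) (h_y : Primrec f_y) :
    Primrec fun a => covHCode (f_ρ a) (f_h a) (f_t a) (f_y a) := by
  unfold covHCode
  exact primrec_or (primrec_inRan (primrec_fst (primrec_snd (primrec_fst h_ρ))) h_h h_y)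
    (primrec_any h_t (primrec_inRan (primrec_fst (primrec_snd (primrec_fst Primrec.snd)))
    (primrec_snd (primrec_snd Primrec.snd)) (h_y.comp Primrec.fst)))

theorem primrec_incCode {f_G : α → GCode Λ} {f_e f_v : α → ℕ} (h_G : Primrec f_G) (h_e : Primrec
    f_e) (h_v : Primrec f_v) : Primrec fun a => incCode (f_G a) (f_e a) (f_v a) := by
  unfold incCode
  exact primrec_any (primrec_toList (primrec_getElem? (primrec_snd h_G) h_e)) (primrec_any
    (primrec_snd Primrec.snd) (primrec_eqb Primrec.snd (h_v.comp (primrec_fst Primrec.fst))))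

theorem primrec_qNodeCode {f_ρ : α → RCode Λ} {f_v : α → ℕ} (h_ρ : Primrec f_ρ) (h_v : Primrec
    f_v) : Primrec fun a => qNodeCode (f_ρ a) (f_v a) := by
  unfold qNodeCode
  exact primrec_any (primrec_snd h_ρ) (primrec_any (primrec_toList (primrec_look (primrec_fst
    (primrec_snd (primrec_snd Primrec.snd))) (Primrec.pair (Primrec.const _) (h_v.comp
    Primrec.fst)))) (primrec_any (primrec_range (primrec_length (primrec_snd (primrec_fst
    (primrec_snd Primrec.fst))))) (primrec_and (primrec_incCode (primrec_fst (primrec_snd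
    (primrec_fst Primrec.fst))) Primrec.snd (primrec_snd (primrec_snd Primrec.fst))) (primrec_not
    (primrec_inRan (primrec_fst (primrec_fst (h_ρ.comp (primrec_fst (primrec_fst Primrec.fst)))))
    (primrec_fst (primrec_snd (primrec_snd (primrec_snd (primrec_fst Primrec.fst)))))
    (Primrec.pair (Primrec.const _) Primrec.snd))))))

theorem primrec_definedCode {f_ρ : α → RCode Λ} {f_X : α → GCode Λ} {f_m f_h f_g : α → MCode} {f_t
    : α → List (CCode Λ)} (h_ρ : Primrec f_ρ) (h_X : Primrec f_X) (h_m : Primrec f_m) (h_h :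
    Primrec f_h) (h_g : Primrec f_g) (h_t : Primrec f_t) : Primrec fun a => definedCode (f_ρ a)
    (f_X a) (f_m a) (f_h a) (f_g a) (f_t a) := by
  unfold definedCode
  exact primrec_all (primrec_pts h_X) (primrec_or (primrec_covMCode (h_ρ.comp Primrec.fst)
    (h_m.comp Primrec.fst) (h_t.comp Primrec.fst) Primrec.snd) (primrec_any (primrec_toList
    (primrec_look (h_g.comp Primrec.fst) Primrec.snd)) (primrec_not (primrec_covHCode (h_ρ.comp
    (primrec_fst Primrec.fst)) (h_h.comp (primrec_fst Primrec.fst)) (h_t.comp (primrec_fst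
    Primrec.fst)) Primrec.snd))))

theorem primrec_injOutCode {f_ρ : α → RCode Λ} {f_X : α → GCode Λ} {f_m f_g : α → MCode} {f_t : α
    → List (CCode Λ)} (h_ρ : Primrec f_ρ) (h_X : Primrec f_X) (h_m : Primrec f_m) (h_g : Primrec
    f_g) (h_t : Primrec f_t) : Primrec fun a => injOutCode (f_ρ a) (f_X a) (f_m a) (f_g a) (f_t a)
    := by
  unfold injOutCode
  exact primrec_all (primrec_pts h_X) (primrec_all (primrec_pts (h_X.comp Primrec.fst))
    (primrec_or (primrec_covMCode (h_ρ.comp (primrec_fst Primrec.fst)) (h_m.comp (primrec_fst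
    Primrec.fst)) (h_t.comp (primrec_fst Primrec.fst)) (primrec_snd Primrec.fst)) (primrec_or
    (primrec_covMCode (h_ρ.comp (primrec_fst Primrec.fst)) (h_m.comp (primrec_fst Primrec.fst))
    (h_t.comp (primrec_fst Primrec.fst)) Primrec.snd) (primrec_or (primrec_not (primrec_eqb
    (primrec_look (h_g.comp (primrec_fst Primrec.fst)) (primrec_snd Primrec.fst)) (primrec_look
    (h_g.comp (primrec_fst Primrec.fst)) Primrec.snd))) (primrec_eqb (primrec_snd Primrec.fst)
    Primrec.snd)))))

theorem primrec_coverCode {f_ρ : α → RCode Λ} {f_X f_Y : α → GCode Λ} {f_m f_h f_g : α → MCode}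
    {f_t : α → List (CCode Λ)} (h_ρ : Primrec f_ρ) (h_X : Primrec f_X) (h_Y : Primrec f_Y) (h_m :
    Primrec f_m) (h_h : Primrec f_h) (h_g : Primrec f_g) (h_t : Primrec f_t) : Primrec fun a =>
    coverCode (f_ρ a) (f_X a) (f_Y a) (f_m a) (f_h a) (f_g a) (f_t a) := by
  unfold coverCode
  exact primrec_all (primrec_pts h_Y) (primrec_or (primrec_covHCode (h_ρ.comp Primrec.fst)
    (h_h.comp Primrec.fst) (h_t.comp Primrec.fst) Primrec.snd) (primrec_any (primrec_pts (h_X.comp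
    Primrec.fst)) (primrec_and (primrec_not (primrec_covMCode (h_ρ.comp (primrec_fst Primrec.fst))
    (h_m.comp (primrec_fst Primrec.fst)) (h_t.comp (primrec_fst Primrec.fst)) Primrec.snd))
    (primrec_eqb (primrec_look (h_g.comp (primrec_fst Primrec.fst)) Primrec.snd) (primrec_some
    (primrec_snd Primrec.fst))))))

theorem primrec_appCode {f_ρ : α → RCode Λ} {f_X : α → GCode Λ} {f_m : α → MCode} {f_t : α → List
    (CCode Λ)} (h_ρ : Primrec f_ρ) (h_X : Primrec f_X) (h_m : Primrec f_m) (h_t : Primrec f_t) :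
    Primrec fun a => appCode (f_ρ a) (f_X a) (f_m a) (f_t a) := by
  unfold appCode
  exact primrec_all (primrec_range (primrec_fst (primrec_fst (primrec_fst h_ρ)))) (primrec_or
    (primrec_not (primrec_qNodeCode (h_ρ.comp Primrec.fst) Primrec.snd)) (primrec_all
    (primrec_toList (primrec_look (h_m.comp Primrec.fst) (Primrec.pair (Primrec.const _)
    Primrec.snd))) (primrec_all (primrec_range (primrec_length (primrec_snd (h_X.comp (primrec_fst
    Primrec.fst))))) (primrec_or (primrec_not (primrec_incCode (h_X.comp (primrec_fst (primrec_fst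
    Primrec.fst))) Primrec.snd (primrec_snd (primrec_snd Primrec.fst)))) (primrec_covMCode
    (h_ρ.comp (primrec_fst (primrec_fst Primrec.fst))) (h_m.comp (primrec_fst (primrec_fst
    Primrec.fst))) (h_t.comp (primrec_fst (primrec_fst Primrec.fst))) (Primrec.pair (Primrec.const
    _) Primrec.snd))))))

theorem primrec_sizeBound {f_ρ : α → RCode Λ} {f_Y : α → GCode Λ} {f_n : α → ℕ} (h_ρ : Primrec
    f_ρ) (h_Y : Primrec f_Y) (h_n : Primrec f_n) : Primrec fun a => sizeBound (f_ρ a) (f_Y a) (f_n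
    a) := by
  unfold sizeBound
  exact primrec_add (primrec_add (primrec_length (primrec_pts (primrec_fst (primrec_fst h_ρ))))
    (primrec_mul h_n (primrec_length (primrec_flatMap (primrec_snd h_ρ) (primrec_pts (primrec_fst
    Primrec.snd)))))) (primrec_length (primrec_pts h_Y))

variable [DecidableEq Λ]

theorem primrec_cells {f_ρ : α → RCode Λ} {f_X f_Y : α → GCode Λ} {f_m f_h f_g : α → MCode} (h_ρ :
    Primrec f_ρ) (h_X : Primrec f_X) (h_Y : Primrec f_Y) (h_m : Primrec f_m) (h_h : Primrec f_h)
    (h_g : Primrec f_g) : Primrec fun a => cells (f_ρ a) (f_X a) (f_Y a) (f_m a) (f_h a) (f_g a)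
    := by
  unfold cells
  exact primrec_filter (primrec_flatMap (primrec_snd h_ρ) (primrec_flatMap (primrec_homs
    (primrec_fst Primrec.snd) (h_X.comp Primrec.fst)) (primrec_map (primrec_homs (primrec_fst
    (primrec_snd (primrec_snd Primrec.fst))) (h_Y.comp (primrec_fst Primrec.fst))) (Primrec.pair
    (primrec_snd (primrec_fst Primrec.fst)) (Primrec.pair (primrec_snd Primrec.fst)
    Primrec.snd))))) (primrec_isCellCode (h_ρ.comp Primrec.fst) (h_m.comp Primrec.fst) (h_h.comp
    Primrec.fst) (h_g.comp Primrec.fst) Primrec.snd)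

theorem primrec_backFamCode {f_ρ : α → RCode Λ} {f_X f_Y : α → GCode Λ} {f_m f_h f_g : α → MCode}
    {f_n : α → ℕ} (h_ρ : Primrec f_ρ) (h_X : Primrec f_X) (h_Y : Primrec f_Y) (h_m : Primrec f_m)
    (h_h : Primrec f_h) (h_g : Primrec f_g) (h_n : Primrec f_n) : Primrec fun a => backFamCode
    (f_ρ a) (f_X a) (f_Y a) (f_m a) (f_h a) (f_g a) (f_n a) := by
  unfold backFamCode
  exact primrec_any (primrec_range (primrec_add h_n (Primrec.const _))) (primrec_any
    (primrec_pairwiseLists (primrec_disjCode (h_ρ.comp (primrec_fst (primrec_fst Primrec.fst)))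
    (primrec_snd Primrec.fst) Primrec.snd) (primrec_cells (h_ρ.comp Primrec.fst) (h_X.comp
    Primrec.fst) (h_Y.comp Primrec.fst) (h_m.comp Primrec.fst) (h_h.comp Primrec.fst) (h_g.comp
    Primrec.fst)) Primrec.snd) (primrec_and (primrec_definedCode (h_ρ.comp (primrec_fst
    Primrec.fst)) (h_X.comp (primrec_fst Primrec.fst)) (h_m.comp (primrec_fst Primrec.fst))
    (h_h.comp (primrec_fst Primrec.fst)) (h_g.comp (primrec_fst Primrec.fst)) Primrec.snd)
    (primrec_and (primrec_injOutCode (h_ρ.comp (primrec_fst Primrec.fst)) (h_X.comp (primrec_fst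
    Primrec.fst)) (h_m.comp (primrec_fst Primrec.fst)) (h_g.comp (primrec_fst Primrec.fst))
    Primrec.snd) (primrec_and (primrec_coverCode (h_ρ.comp (primrec_fst Primrec.fst)) (h_X.comp
    (primrec_fst Primrec.fst)) (h_Y.comp (primrec_fst Primrec.fst)) (h_m.comp (primrec_fst
    Primrec.fst)) (h_h.comp (primrec_fst Primrec.fst)) (h_g.comp (primrec_fst Primrec.fst))
    Primrec.snd) (primrec_appCode (h_ρ.comp (primrec_fst Primrec.fst)) (h_X.comp (primrec_fst
    Primrec.fst)) (h_m.comp (primrec_fst Primrec.fst)) Primrec.snd)))))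

theorem primrec_backCode {f_ρ : α → RCode Λ} {f_X f_Y : α → GCode Λ} {f_n : α → ℕ} (h_ρ : Primrec
    f_ρ) (h_X : Primrec f_X) (h_Y : Primrec f_Y) (h_n : Primrec f_n) : Primrec fun a => backCode
    (f_ρ a) (f_X a) (f_Y a) (f_n a) := by
  unfold backCode
  exact primrec_any (primrec_homs (primrec_fst (primrec_fst h_ρ)) h_X) (primrec_any (primrec_homs
    (primrec_fst (primrec_snd (primrec_fst (h_ρ.comp Primrec.fst)))) (h_Y.comp Primrec.fst))
    (primrec_any (primrec_homs (h_X.comp (primrec_fst Primrec.fst)) (h_Y.comp (primrec_fst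
    Primrec.fst))) (primrec_and (primrec_totalCode (primrec_fst (primrec_fst (h_ρ.comp
    (primrec_fst (primrec_fst Primrec.fst))))) (primrec_snd (primrec_fst Primrec.fst)))
    (primrec_and (primrec_injCode (primrec_fst (primrec_fst (h_ρ.comp (primrec_fst (primrec_fst
    Primrec.fst))))) (primrec_snd (primrec_fst Primrec.fst))) (primrec_and (primrec_injCode
    (primrec_fst (primrec_snd (primrec_fst (h_ρ.comp (primrec_fst (primrec_fst Primrec.fst))))))
    (primrec_snd Primrec.fst)) (primrec_and (primrec_eqb (primrec_compCode (primrec_snd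
    (primrec_snd (primrec_fst (h_ρ.comp (primrec_fst (primrec_fst Primrec.fst)))))) (primrec_snd
    Primrec.fst)) (primrec_compCode (primrec_snd (primrec_fst Primrec.fst)) Primrec.snd))
    (primrec_backFamCode (h_ρ.comp (primrec_fst (primrec_fst Primrec.fst))) (h_X.comp (primrec_fst
    (primrec_fst Primrec.fst))) (h_Y.comp (primrec_fst (primrec_fst Primrec.fst))) (primrec_snd
    (primrec_fst Primrec.fst)) (primrec_snd Primrec.fst) Primrec.snd (h_n.comp (primrec_fst
    (primrec_fst Primrec.fst))))))))))

end BackCodes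

end UGTS

namespace UGTS
open CategoryTheory

/-! ### Correctness of the codes -/

section Semantics

variable {Λ : Type} {ar : Λ → ℕ} {G H K : HGraph ar}

/-- The code of an element. -/
def emb : G.Elt → Pt
  | .inl v => (false, v.val)
  | .inr e => (true, e.val)

theorem emb_injective : Function.Injective (emb : G.Elt → Pt) := by
  rintro (v | v) (w | w) h <;> simp only [emb, Prod.mk.injEq] at h
  · rw [Fin.ext h.2]
  · cases h.1
  · cases h.1
  · rw [Fin.ext h.2]

theorem mem_pts {x : Pt} : x ∈ pts G.code ↔ ∃ y : G.Elt, emb y = x := by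
  simp only [pts, HGraph.code, List.mem_append, List.mem_map, List.mem_range, List.length_ofFn]
  constructor
  · rintro (⟨v, hv, rfl⟩ | ⟨v, hv, rfl⟩)
    · exact ⟨.inl ⟨v, hv⟩, rfl⟩
    · exact ⟨.inr ⟨v, hv⟩, rfl⟩
  · rintro ⟨v | v, rfl⟩
    · exact .inl ⟨v, v.2, rfl⟩
    · exact .inr ⟨v, v.2, rfl⟩

theorem length_pts : (pts G.code).length = G.size := by
  simp [pts, HGraph.code, HGraph.size]

theorem pts_all {p : Pt → Bool} :
    (pts G.code).all p = true ↔ ∀ x : G.Elt, p (emb x) = true := by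
  simp only [List.all_eq_true, mem_pts]
  exact ⟨fun h x => h _ ⟨x, rfl⟩, fun h _ ⟨x, hx⟩ => hx ▸ h x⟩

theorem pts_any {p : Pt → Bool} :
    (pts G.code).any p = true ↔ ∃ x : G.Elt, p (emb x) = true := by
  simp only [List.any_eq_true, mem_pts]
  exact ⟨fun ⟨_, ⟨x, hx⟩, h⟩ => ⟨x, hx ▸ h⟩, fun ⟨x, h⟩ => ⟨_, ⟨x, rfl⟩, h⟩⟩

theorem lookTable_ofFn {n k : ℕ} (o : Fin n → Option (Fin k)) (i : Fin n) :
    lookTable (List.ofFn fun v => (o v).map Fin.val) i = (o i).map Fin.val := by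
  simp [lookTable]

theorem look_homCode (f : G ⟶ H) (x : G.Elt) : look (homCode f) (emb x) = (act f x).map emb := by
  cases x with
  | inl v =>
    change (lookTable (List.ofFn fun v => (nodeMap f v).map Fin.val) v.val).map _ = _
    rw [lookTable_ofFn]
    simp [act, Function.comp_def, emb]
  | inr v =>
    change (lookTable (List.ofFn fun v => (edgeMap f v).map Fin.val) v.val).map _ = _
    rw [lookTable_ofFn]
    simp [act, Function.comp_def, emb]

theorem look_eq_some {f : G ⟶ H} {x : G.Elt} {y : H.Elt} :
    look (homCode f) (emb x) = some (emb y) ↔ act f x = some y := by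
  rw [look_homCode, Option.map_eq_some_iff]
  exact ⟨fun ⟨z, h1, h2⟩ => emb_injective h2 ▸ h1, fun h => ⟨y, h, rfl⟩⟩

theorem look_eq_none {f : G ⟶ H} {x : G.Elt} :
    look (homCode f) (emb x) = none ↔ act f x = none := by
  rw [look_homCode, Option.map_eq_none_iff]

theorem look_eq_look {f : G ⟶ H} {x x' : G.Elt} :
    look (homCode f) (emb x) = look (homCode f) (emb x') ↔ act f x = act f x' := by
  rw [look_homCode, look_homCode]
  exact (Option.map_injective emb_injective).eq_iff

theorem look_any {f : G ⟶ H} {x : G.Elt} {p : Pt → Bool} :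
    (look (homCode f) (emb x)).toList.any p = true ↔ ∃ y, act f x = some y ∧ p (emb y) = true := by
  rw [look_homCode]
  cases act f x <;> simp

theorem look_all {f : G ⟶ H} {x : G.Elt} {p : Pt → Bool} :
    (look (homCode f) (emb x)).toList.all p = true ↔ ∀ y, act f x = some y → p (emb y) = true := by
  rw [look_homCode]
  cases act f x <;> simp

/-- This allows commutativity of diagrams to be tested by comparing value tables. -/
theorem homCode_injective : Function.Injective (homCode : (G ⟶ H) → MCode) := by
  intro f g h
  apply hom_ext_act
  intro x
  apply Option.map_injective emb_injective
  rw [← look_homCode, ← look_homCode, h]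

theorem compCode_homCode (f : G ⟶ H) (g : H ⟶ K) :
    compCode (homCode f) (homCode g) = homCode (f ≫ g) := by
  apply Prod.ext
  · change (List.ofFn fun v => (nodeMap f v).map Fin.val).map _ =
      List.ofFn fun v => (nodeMap (f ≫ g) v).map Fin.val
    rw [List.map_ofFn]
    congr 1
    funext v
    change ((nodeMap f v).map Fin.val).bind
      (fun v => lookTable (List.ofFn fun v => (nodeMap g v).map Fin.val) v) =
        ((nodeMap f v).bind (nodeMap g)).map Fin.val
    cases nodeMap f v with
    | none => rfl
    | some w => exact lookTable_ofFn _ w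
  · change (List.ofFn fun v => (edgeMap f v).map Fin.val).map _ =
      List.ofFn fun v => (edgeMap (f ≫ g) v).map Fin.val
    rw [List.map_ofFn]
    congr 1
    funext v
    change ((edgeMap f v).map Fin.val).bind
      (fun v => lookTable (List.ofFn fun v => (edgeMap g v).map Fin.val) v) =
        ((edgeMap f v).bind (edgeMap g)).map Fin.val
    cases edgeMap f v with
    | none => rfl
    | some w => exact lookTable_ofFn _ w

theorem inRan_iff {f : G ⟶ H} {y : H.Elt} :
    inRan G.code (homCode f) (emb y) = true ↔ y ∈ ran f := by
  simp only [inRan, pts_any, eqb_iff, look_eq_some]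
  rfl

theorem totalCode_iff {f : G ⟶ H} : totalCode G.code (homCode f) = true ↔ IsTotalHom f := by
  simp only [totalCode, pts_all, isTotalHom_iff, Bool.not_eq_true', ← Bool.not_eq_true, eqb_iff,
    look_eq_none]
  exact forall_congr' fun x => Option.ne_none_iff_exists'

theorem injCode_iff {f : G ⟶ H} : injCode G.code (homCode f) = true ↔ IsInjHom f := by
  simp only [injCode, pts_all, isInjHom_iff, Bool.or_eq_true, Bool.not_eq_true', ← Bool.not_eq_true,
    eqb_iff, look_eq_none, look_eq_look, emb_injective.eq_iff]
  constructor
  · intro h x x' y hx hx'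
    rcases h x x' with h | h | h
    · rw [hx] at h; cases h
    · exact (h (hx.trans hx'.symm)).elim
    · exact h
  · intro h x x'
    cases hx : act f x with
    | none => exact .inl rfl
    | some y =>
      by_cases hx' : act f x' = some y
      · exact .inr (.inr (h x x' y hx hx'))
      · exact .inr (.inl fun h => hx' h.symm)

theorem mem_listsOf_option {n k : ℕ} {l : List (Option ℕ)} :
    l ∈ listsOf (none :: (List.range k).map some) n ↔
      ∃ o : Fin n → Option (Fin k), l = List.ofFn fun v => (o v).map Fin.val := by
  rw [mem_listsOf]
  constructor
  · rintro ⟨rfl, h⟩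
    have h' : ∀ v : Fin l.length, ∃ o : Option (Fin k), l[v] = o.map Fin.val := by
      intro v
      have := h l[v] (List.getElem_mem _)
      simp only [List.mem_cons, List.mem_map, List.mem_range] at this
      rcases this with h | ⟨a, ha, h⟩
      · exact ⟨none, h⟩
      · exact ⟨some ⟨a, ha⟩, h.symm⟩
    choose o ho using h'
    refine ⟨o, ?_⟩
    rw [← funext ho]
    exact List.ofFn_getElem.symm
  · rintro ⟨o, rfl⟩
    refine ⟨List.length_ofFn, ?_⟩
    intro a ha
    obtain ⟨v, rfl⟩ := (List.mem_ofFn' _ _).1 ha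
    change (o v).map Fin.val ∈ _
    cases o v with
    | none => exact List.mem_cons_self
    | some w => exact List.mem_cons_of_mem _ (List.mem_map_of_mem (List.mem_range.2 w.2))

theorem code_getElem? (G : HGraph ar) (e : Fin G.nE) :
    G.code.2[e.val]? = some (G.lab e, (G.conn e).map Fin.val) := by
  simp [HGraph.code]

theorem length_code (G : HGraph ar) : G.code.2.length = G.nE := by
  simp [HGraph.code]

theorem map_lookTable_iff {n k : ℕ} (o : Fin n → Option (Fin k)) (l : List (Fin n))
    (l' : List (Fin k)) :
    ((l.map Fin.val).map fun v => lookTable (List.ofFn fun v => (o v).map Fin.val) v) =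
      (l'.map Fin.val).map some ↔ l.map o = l'.map some := by
  have h1 : ((l.map Fin.val).map fun v => lookTable (List.ofFn fun v => (o v).map Fin.val) v) =
      (l.map o).map (Option.map Fin.val) := by
    rw [List.map_map, List.map_map]
    exact List.map_congr_left fun v _ => lookTable_ofFn o v
  have h2 : (l'.map Fin.val).map some = (l'.map some).map (Option.map Fin.val) := by
    rw [List.map_map, List.map_map]
    rfl
  rw [h1, h2]
  exact (List.map_injective_iff.2 (Option.map_injective Fin.val_injective)).eq_iff

section Decidable

variable [DecidableEq Λ]

/-- Formulated for raw tables, because this test is what makes a pair of tables a morphism in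
`mem_homs`. -/
theorem isHomCode_iff {oV : Fin G.nV → Option (Fin H.nV)} {oE : Fin G.nE → Option (Fin H.nE)} :
    isHomCode G.code H.code (List.ofFn fun v => (oV v).map Fin.val,
      List.ofFn fun e => (oE e).map Fin.val) = true ↔
    ∀ e e', oE e = some e' → G.lab e = H.lab e' ∧ (G.conn e).map oV = (H.conn e').map some := by
  simp only [isHomCode, List.all_eq_true, List.mem_range, length_code, Option.mem_toList,
    Bool.and_eq_true, eqb_iff]
  constructor
  · intro h e e' he
    have h1 := h e.val e.2 e'.val (by rw [lookTable_ofFn, he]; rfl) _ (code_getElem? G e) _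
      (code_getElem? H e')
    exact ⟨h1.1, (map_lookTable_iff _ _ _).1 h1.2⟩
  · intro h i hi j hj d hd d' hd'
    have hj' : (oE ⟨i, hi⟩).map Fin.val = some j := (lookTable_ofFn oE ⟨i, hi⟩).symm.trans hj
    obtain ⟨e', he', rfl⟩ := Option.map_eq_some_iff.1 hj'
    cases (code_getElem? G ⟨i, hi⟩).symm.trans hd
    cases (code_getElem? H e').symm.trans hd'
    obtain ⟨h1, h2⟩ := h _ _ he'
    exact ⟨h1, (map_lookTable_iff _ _ _).2 h2⟩

theorem mem_homs {t : MCode} : t ∈ homs G.code H.code ↔ ∃ f : G ⟶ H, homCode f = t := by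
  simp only [homs, List.mem_filter, tables, List.mem_flatMap, List.mem_map]
  rw [length_code, length_code]
  change ((∃ a ∈ listsOf (none :: (List.range H.nV).map some) G.nV, _) ∧ _) ↔ _
  constructor
  · rintro ⟨⟨s, hs, t, ht, rfl⟩, h⟩
    obtain ⟨oV, rfl⟩ := mem_listsOf_option.1 hs
    obtain ⟨oE, rfl⟩ := mem_listsOf_option.1 ht
    have h' := isHomCode_iff.1 h
    exact ⟨⟨oV, oE, fun e e' he => (h' e e' he).1, fun e e' he => (h' e e' he).2⟩, rfl⟩
  · rintro ⟨f, rfl⟩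
    exact ⟨⟨_, mem_listsOf_option.2 ⟨nodeMap f, rfl⟩, _, mem_listsOf_option.2 ⟨edgeMap f, rfl⟩, rfl⟩,
      isHomCode_iff.2 fun e e' he => ⟨f.lab_eq e e' he, f.conn_eq e e' he⟩⟩

theorem homs_any {p : MCode → Bool} :
    (homs G.code H.code).any p = true ↔ ∃ f : G ⟶ H, p (homCode f) = true := by
  simp only [List.any_eq_true, mem_homs]
  exact ⟨fun ⟨_, ⟨f, hf⟩, h⟩ => ⟨f, hf ▸ h⟩, fun ⟨f, h⟩ => ⟨_, ⟨f, rfl⟩, h⟩⟩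

theorem subCode_iff : subCode G.code H.code = true ↔ SubOrder G H := by
  simp only [subCode, homs_any, Bool.and_eq_true, totalCode_iff, injCode_iff, subOrder_iff]

end Decidable

theorem code_injective : Function.Injective (HGraph.code : HGraph ar → GCode Λ) := by
  rintro ⟨nV, nE, lab, conn, hl⟩ ⟨nV', nE', lab', conn', hl'⟩ h
  obtain ⟨h1, h2⟩ := Prod.ext_iff.1 h
  change nV = nV' at h1
  subst h1
  have h3 : nE = nE' := by simpa [HGraph.code] using congrArg List.length h2
  subst h3
  have h4 := List.ofFn_injective h2
  have h5 : lab = lab' := funext fun e => (Prod.ext_iff.1 (congrFun h4 e)).1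
  subst h5
  have h6 : conn = conn' := funext fun e =>
    List.map_injective_iff.2 Fin.val_injective (Prod.ext_iff.1 (congrFun h4 e)).2
  subst h6
  rfl

/-! ### Enumeration of graphs -/

/-- The coded edges on `n` nodes. -/
def edgesOn (ar : Λ → ℕ) (labels : List Λ) (n : ℕ) : List (Λ × List ℕ) :=
  labels.flatMap fun l => (listsOf (List.range n) (ar l)).map fun t => (l, t)

/-- The coded graphs with at most `n` nodes and at most `n` edges. -/
def graphsUpTo (ar : Λ → ℕ) (labels : List Λ) (n : ℕ) : List (GCode Λ) :=
  (List.range (n + 1)).flatMap fun v => (List.range (n + 1)).flatMap fun k =>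
    (listsOf (edgesOn ar labels v) k).map fun t => (v, t)

theorem mem_edgesOn {labels : List Λ} (hl : ∀ l, l ∈ labels) {n : ℕ} {d : Λ × List ℕ} :
    d ∈ edgesOn ar labels n ↔ ∃ c : List (Fin n), c.length = ar d.1 ∧ d.2 = c.map Fin.val := by
  simp only [edgesOn, List.mem_flatMap, List.mem_map, mem_listsOf, List.mem_range]
  constructor
  · rintro ⟨l, -, t, ⟨h1, h2⟩, rfl⟩
    refine ⟨t.pmap Fin.mk h2, by simpa using h1, ?_⟩
    simp [List.map_pmap]
  · rintro ⟨c, h1, h2⟩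
    refine ⟨d.1, hl _, d.2, ⟨by rw [h2, List.length_map, h1], ?_⟩, rfl⟩
    rw [h2]
    intro a ha
    obtain ⟨v, -, rfl⟩ := List.mem_map.1 ha
    exact v.2

theorem mem_graphsUpTo {labels : List Λ} (hl : ∀ l, l ∈ labels) {n : ℕ} {c : GCode Λ} :
    c ∈ graphsUpTo ar labels n ↔ ∃ G : HGraph ar, G.code = c ∧ G.nV ≤ n ∧ G.nE ≤ n := by
  simp only [graphsUpTo, List.mem_flatMap, List.mem_map, mem_listsOf, List.mem_range,
    Nat.lt_succ_iff]
  constructor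
  · rintro ⟨v, hv, k, hk, t, ⟨rfl, ht⟩, rfl⟩
    have h' : ∀ e : Fin t.length, ∃ c : List (Fin v), c.length = ar t[e].1 ∧
        t[e].2 = c.map Fin.val := fun e => (mem_edgesOn hl).1 (ht _ (List.getElem_mem _))
    choose conn h1 h2 using h'
    refine ⟨⟨v, t.length, fun e => t[e].1, conn, h1⟩, ?_, hv, hk⟩
    apply Prod.ext
    · rfl
    · change List.ofFn (fun e => (t[e].1, (conn e).map Fin.val)) = t
      simp only [← h2]
      exact List.ofFn_getElem
  · rintro ⟨G, rfl, h1, h2⟩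
    refine ⟨G.nV, h1, G.nE, h2, G.code.2, ⟨length_code G, ?_⟩, rfl⟩
    intro d hd
    obtain ⟨e, rfl⟩ := (List.mem_ofFn' _ _).1 hd
    exact (mem_edgesOn hl).2 ⟨G.conn e, G.length_conn e, rfl⟩

end Semantics

end UGTS

namespace UGTS
open CategoryTheory

/-! ### Correctness of the codes of backward steps -/

section BackSemantics

variable {Λ : Type} {ar : Λ → ℕ} {ρ : URule ar} {X Y : HGraph ar} {m₀ : ρ.L ⟶ X} {h₀ : ρ.R ⟶ Y}
  {g : X ⟶ Y} {fam : List (Cell ρ X Y)}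

/-- The code of a cell. -/
def Cell.code (c : Cell ρ X Y) : CCode Λ := (c.u.code, homCode c.m, homCode c.h)

theorem pqCode_code {L : HGraph ar} (u : UQuant L) : pqCode u.code = homCode (u.p ≫ u.q) :=
  compCode_homCode u.p u.q

theorem inRan_pq {L : HGraph ar} (u : UQuant L) {y : u.Ru.Elt} :
    inRan L.code (pqCode u.code) (emb y) = true ↔ y ∈ ran (u.p ≫ u.q) := by
  rw [pqCode_code, inRan_iff]

theorem injNewCode_iff {c : Cell ρ X Y} : injNewCode ρ.code c.code = true ↔
    ∀ y y' w, y ∉ ran (c.u.p ≫ c.u.q) → y' ∉ ran (c.u.p ≫ c.u.q) →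
      act c.h y = some w → act c.h y' = some w → y = y' := by
  change ((pts c.u.Ru.code).all fun y => (pts c.u.Ru.code).all fun y' =>
    inRan ρ.L.code (pqCode c.u.code) y || (inRan ρ.L.code (pqCode c.u.code) y' ||
      (eqb (look (homCode c.h) y) none ||
        (!eqb (look (homCode c.h) y) (look (homCode c.h) y') || eqb y y')))) = true ↔ _
  simp only [pts_all, Bool.or_eq_true, Bool.not_eq_true', ← Bool.not_eq_true, eqb_iff, inRan_pq,
    look_eq_none, look_eq_look, emb_injective.eq_iff]
  constructor
  · intro h y y' w hy hy' hw hw'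
    rcases h y y' with h | h | h | h | h
    · exact (hy h).elim
    · exact (hy' h).elim
    · rw [hw] at h; cases h
    · exact (h (hw.trans hw'.symm)).elim
    · exact h
  · intro h y y'
    by_cases hy : y ∈ ran (c.u.p ≫ c.u.q)
    · exact .inl hy
    by_cases hy' : y' ∈ ran (c.u.p ≫ c.u.q)
    · exact .inr (.inl hy')
    cases hw : act c.h y with
    | none => exact .inr (.inr (.inl rfl))
    | some w =>
      by_cases hw' : act c.h y' = some w
      · exact .inr (.inr (.inr (.inr (h y y' w hy hy' hw hw'))))
      · exact .inr (.inr (.inr (.inl fun h => hw' h.symm)))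

theorem disjNewCode_iff {c : Cell ρ X Y} : disjNewCode ρ.code (homCode h₀) c.code = true ↔
    ∀ y w, y ∉ ran (c.u.p ≫ c.u.q) → act c.h y = some w → w ∉ ran h₀ := by
  change ((pts c.u.Ru.code).all fun y => inRan ρ.L.code (pqCode c.u.code) y ||
    (look (homCode c.h) y).toList.all fun w => !inRan ρ.R.code (homCode h₀) w) = true ↔ _
  simp only [pts_all, Bool.or_eq_true, Bool.not_eq_true', ← Bool.not_eq_true, inRan_pq, look_all,
    inRan_iff]
  exact ⟨fun h y w hy hw => (h y).elim (fun h' => (hy h').elim) fun h' => h' w hw,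
    fun h y => or_iff_not_imp_left.2 fun hy w hw => h y w hy hw⟩

/-- Membership of the quantification in the rule stays outside the test: `cells` guarantees it by
drawing the codes from the rule. -/
theorem isCellCode_iff {c : Cell ρ X Y} :
    c.u ∈ ρ.U ∧ isCellCode ρ.code (homCode m₀) (homCode h₀) (homCode g) c.code = true ↔
      IsCell m₀ h₀ g c := by
  have h : isCellCode ρ.code (homCode m₀) (homCode h₀) (homCode g) c.code = true ↔
      (IsTotalHom c.m ∧ IsInjHom c.m ∧ c.u.p ≫ c.m = m₀ ∧
        (c.u.p ≫ c.u.q) ≫ c.h = ρ.r ≫ h₀ ∧ c.m ≫ g = c.u.q ≫ c.h ∧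
        injNewCode ρ.code c.code = true ∧ disjNewCode ρ.code (homCode h₀) c.code = true) := by
    change (totalCode c.u.Lu.code (homCode c.m) && (injCode c.u.Lu.code (homCode c.m) &&
      (eqb (compCode (homCode c.u.p) (homCode c.m)) (homCode m₀) &&
      (eqb (compCode (pqCode c.u.code) (homCode c.h)) (compCode (homCode ρ.r) (homCode h₀)) &&
      (eqb (compCode (homCode c.m) (homCode g)) (compCode (homCode c.u.q) (homCode c.h)) &&
        (injNewCode ρ.code c.code && disjNewCode ρ.code (homCode h₀) c.code)))))) = true ↔ _
    simp only [Bool.and_eq_true, totalCode_iff, injCode_iff, eqb_iff, pqCode_code,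
      compCode_homCode, homCode_injective.eq_iff]
  rw [h, injNewCode_iff, disjNewCode_iff]
  exact ⟨fun ⟨h0, h1, h2, h3, h4, h5, h6, h7⟩ => ⟨h0, h1, h2, h3, h4, h5, h6, h7⟩,
    fun ⟨h0, h1, h2, h3, h4, h5, h6, h7⟩ => ⟨h0, h1, h2, h3, h4, h5, h6, h7⟩⟩

theorem disjCode_iff {c c' : Cell ρ X Y} : disjCode ρ.code c.code c'.code = true ↔ c.Disj c' := by
  change (((pts c.u.Lu.code).all fun y => inRan ρ.L.code (homCode c.u.p) y ||
      !(look (homCode c.m) y).toList.any fun w => inRan c'.u.Lu.code (homCode c'.m) w) &&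
    ((pts c.u.Ru.code).all fun y => inRan ρ.L.code (pqCode c.u.code) y ||
      !(look (homCode c.h) y).toList.any fun w => inRan c'.u.Ru.code (homCode c'.h) w)) = true ↔ _
  simp only [Bool.and_eq_true, pts_all, Bool.or_eq_true, Bool.not_eq_true', ← Bool.not_eq_true,
    inRan_pq, look_any, inRan_iff, Cell.Disj]
  refine and_congr ?_ ?_
  · exact ⟨fun h y z w hy hz => (h y).elim (fun h => h) fun h => (h ⟨w, hy, z, hz⟩).elim,
      fun h y => or_iff_not_imp_right.2 fun hn => by
        obtain ⟨w, hy, z, hz⟩ := not_not.1 hn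
        exact h y z w hy hz⟩
  · exact ⟨fun h y z w hy hz => (h y).elim (fun h => h) fun h => (h ⟨w, hy, z, hz⟩).elim,
      fun h y => or_iff_not_imp_right.2 fun hn => by
        obtain ⟨w, hy, z, hz⟩ := not_not.1 hn
        exact h y z w hy hz⟩

theorem covMCode_iff {x : X.Elt} :
    covMCode ρ.code (homCode m₀) (fam.map Cell.code) (emb x) = true ↔ x ∈ covM m₀ fam := by
  change (inRan ρ.L.code (homCode m₀) (emb x) || (fam.map Cell.code).any fun c =>
    inRan c.1.1 c.2.1 (emb x)) = true ↔ _
  simp only [Bool.or_eq_true, inRan_iff, List.any_map, List.any_eq_true]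
  refine or_congr Iff.rfl (exists_congr fun c => and_congr Iff.rfl ?_)
  exact inRan_iff (f := c.m)

theorem covHCode_iff {y : Y.Elt} :
    covHCode ρ.code (homCode h₀) (fam.map Cell.code) (emb y) = true ↔ y ∈ covH h₀ fam := by
  change (inRan ρ.R.code (homCode h₀) (emb y) || (fam.map Cell.code).any fun c =>
    inRan c.1.2.1 c.2.2 (emb y)) = true ↔ _
  simp only [Bool.or_eq_true, inRan_iff, List.any_map, List.any_eq_true]
  refine or_congr Iff.rfl (exists_congr fun c => and_congr Iff.rfl ?_)
  exact inRan_iff (f := c.h)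

theorem incCode_iff {G : HGraph ar} {e : Fin G.nE} {v : Fin G.nV} :
    incCode G.code e.val v.val = true ↔ v ∈ G.conn e := by
  simp only [incCode, code_getElem?, Option.toList_some, List.any_cons, List.any_nil, Bool.or_false,
    List.any_eq_true, eqb_iff, List.mem_map]
  constructor
  · rintro ⟨_, ⟨w, hw, rfl⟩, h⟩
    rwa [← Fin.ext h]
  · intro h
    exact ⟨_, ⟨v, h, rfl⟩, rfl⟩

theorem range_all {n : ℕ} {p : ℕ → Bool} :
    (List.range n).all p = true ↔ ∀ i : Fin n, p i.val = true := by
  simp only [List.all_eq_true, List.mem_range]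
  exact ⟨fun h i => h i.val i.2, fun h i hi => h ⟨i, hi⟩⟩

theorem range_any {n : ℕ} {p : ℕ → Bool} :
    (List.range n).any p = true ↔ ∃ i : Fin n, p i.val = true := by
  simp only [List.any_eq_true, List.mem_range]
  exact ⟨fun ⟨i, hi, h⟩ => ⟨⟨i, hi⟩, h⟩, fun ⟨i, h⟩ => ⟨i.val, i.2, h⟩⟩

theorem qNodeCode_iff {v : Fin ρ.L.nV} : qNodeCode ρ.code v.val = true ↔ v ∈ ρ.qNodes := by
  change ((ρ.U.map UQuant.code).any fun u => (look u.2.2.1 (false, v.val)).toList.any fun y =>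
    (List.range u.1.2.length).any fun d => incCode u.1 d y.2 &&
      !inRan ρ.L.code u.2.2.1 (true, d)) = true ↔ _
  rw [List.any_map, List.any_eq_true]
  refine exists_congr fun u => and_congr Iff.rfl ?_
  change ((look (homCode u.p) (emb (.inl v))).toList.any fun y =>
    (List.range u.Lu.code.2.length).any fun d => incCode u.Lu.code d y.2 &&
      !inRan ρ.L.code (homCode u.p) (true, d)) = true ↔ _
  rw [length_code]
  simp only [look_any, range_any, Bool.and_eq_true, Bool.not_eq_true', ← Bool.not_eq_true]
  constructor
  · rintro ⟨y, hy, d, hd, hr⟩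
    obtain ⟨y, rfl, hy'⟩ := act_inl_some hy
    refine ⟨y, hy', d, incCode_iff.1 hd, fun e he => hr ?_⟩
    exact inRan_iff (y := .inr d).2 ⟨.inr e, act_inr_eq.2 he⟩
  · rintro ⟨y, hy, d, hd, hr⟩
    refine ⟨.inl y, act_inl_eq.2 hy, d, incCode_iff.2 hd, fun h => ?_⟩
    obtain ⟨x, hx⟩ := inRan_iff (y := .inr d).1 h
    obtain ⟨e, rfl, he⟩ := act_eq_inr hx
    exact hr e he

theorem definedCode_iff :
    definedCode ρ.code X.code (homCode m₀) (homCode h₀) (homCode g) (fam.map Cell.code) = true ↔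
      ∀ x, x ∉ covM m₀ fam → ∃ w, act g x = some w ∧ w ∉ covH h₀ fam := by
  simp only [definedCode, pts_all, Bool.or_eq_true, covMCode_iff, look_any, Bool.not_eq_true',
    ← Bool.not_eq_true, covHCode_iff, or_iff_not_imp_left]

/-- The coded test compares looked-up values and would treat two undefined ones as equal; `hd`
excludes this on the uncovered elements. -/
theorem injOutCode_iff (hd : ∀ x, x ∉ covM m₀ fam → ∃ w, act g x = some w) :
    injOutCode ρ.code X.code (homCode m₀) (homCode g) (fam.map Cell.code) = true ↔
      ∀ x x' w, x ∉ covM m₀ fam → x' ∉ covM m₀ fam → act g x = some w →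
        act g x' = some w → x = x' := by
  simp only [injOutCode, pts_all, Bool.or_eq_true, covMCode_iff, Bool.not_eq_true',
    ← Bool.not_eq_true, eqb_iff, look_eq_look, emb_injective.eq_iff]
  constructor
  · intro h x x' w hx hx' hw hw'
    rcases h x x' with h | h | h | h
    · exact (hx h).elim
    · exact (hx' h).elim
    · exact (h (hw.trans hw'.symm)).elim
    · exact h
  · intro h x x'
    by_cases hx : x ∈ covM m₀ fam
    · exact .inl hx
    by_cases hx' : x' ∈ covM m₀ fam
    · exact .inr (.inl hx')
    by_cases hw : act g x = act g x'
    · obtain ⟨w, hw'⟩ := hd x hx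
      exact .inr (.inr (.inr (h x x' w hx hx' hw' (hw ▸ hw'))))
    · exact .inr (.inr (.inl hw))

theorem coverCode_iff :
    coverCode ρ.code X.code Y.code (homCode m₀) (homCode h₀) (homCode g) (fam.map Cell.code) = true ↔
      ∀ w, w ∈ covH h₀ fam ∨ ∃ x, x ∉ covM m₀ fam ∧ act g x = some w := by
  simp only [coverCode, pts_all, pts_any, Bool.or_eq_true, Bool.and_eq_true, covMCode_iff,
    Bool.not_eq_true', ← Bool.not_eq_true, covHCode_iff, eqb_iff, look_eq_some]

theorem appCode_iff :
    appCode ρ.code X.code (homCode m₀) (fam.map Cell.code) = true ↔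
      ∀ x ∈ ρ.qNodes, ∀ v, act m₀ (.inl x) = some (.inl v) →
        ∀ e, v ∈ X.conn e → Sum.inr e ∈ covM m₀ fam := by
  change ((List.range ρ.L.nV).all fun v => !qNodeCode ρ.code v ||
    (look (homCode m₀) (false, v)).toList.all fun y => (List.range X.code.2.length).all fun e =>
      !incCode X.code e y.2 || covMCode ρ.code (homCode m₀) (fam.map Cell.code) (true, e)) = true ↔ _
  rw [length_code, range_all]
  refine forall_congr' fun x => ?_
  rw [Bool.or_eq_true, Bool.not_eq_true', ← Bool.not_eq_true, qNodeCode_iff, ← imp_iff_not_or]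
  refine imp_congr Iff.rfl ?_
  change ((look (homCode m₀) (emb (.inl x))).toList.all _ = true) ↔ _
  simp only [look_all, range_all, Bool.or_eq_true, Bool.not_eq_true', ← Bool.not_eq_true,
    ← imp_iff_not_or]
  constructor
  · intro h v hv e he
    exact covMCode_iff.1 (h _ hv e (incCode_iff.2 he))
  · intro h y hy e he
    obtain ⟨v, rfl, -⟩ := act_inl_some hy
    exact covMCode_iff (x := .inr e).2 (h v hy e (incCode_iff.1 he))

/-- The elements of `X` are listed from three sources, one for each summand of `sizeBound`: the copy
of `L`, the cells, and the uncovered elements, which are recovered from their images in `Y` by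
injectivity of `g`. -/
theorem IsBackFam.size_le (hf : IsBackFam m₀ h₀ g fam) :
    X.size ≤ sizeBound ρ.code Y.code fam.length := by
  classical
  let inv : Y.Elt → Option X.Elt := fun y =>
    if h : ∃ x, x ∉ covM m₀ fam ∧ act g x = some y then some h.choose else none
  let l : List X.Elt := (Finset.univ : Finset ρ.L.Elt).toList.filterMap (act m₀) ++
    (fam.flatMap fun c => (Finset.univ : Finset c.u.Lu.Elt).toList.filterMap (act c.m)) ++
    (Finset.univ : Finset Y.Elt).toList.filterMap inv
  have hl : ∀ x, x ∈ l := by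
    intro x
    simp only [l, List.mem_append, List.mem_filterMap, List.mem_flatMap, Finset.mem_toList,
      Finset.mem_univ, true_and]
    by_cases hx : x ∈ covM m₀ fam
    · rcases hx with ⟨a, ha⟩ | ⟨c, hc, a, ha⟩
      · exact .inl (.inl ⟨a, ha⟩)
      · exact .inl (.inr ⟨c, hc, a, ha⟩)
    · obtain ⟨w, hw, -⟩ := hf.defined x hx
      have hex : ∃ x, x ∉ covM m₀ fam ∧ act g x = some w := ⟨x, hx, hw⟩
      refine .inr ⟨w, ?_⟩
      simp only [inv]
      rw [dif_pos hex]
      exact congrArg some (hf.inj_outside _ _ w hex.choose_spec.1 hx hex.choose_spec.2 hw)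
  have hcard : X.size ≤ l.length := by
    rw [← card_elt, ← Finset.card_univ]
    exact (Finset.card_le_card fun x _ => List.mem_toFinset.2 (hl x)).trans l.toFinset_card_le
  refine hcard.trans ?_
  have hlen : ∀ G : HGraph ar, (Finset.univ : Finset G.Elt).toList.length = (pts G.code).length := by
    intro G
    rw [Finset.length_toList, Finset.card_univ, card_elt, length_pts]
  have hsum : ∀ {α β : Type} (f : α → List β) (S : ℕ) (l : List α), (∀ a ∈ l, (f a).length ≤ S) →
      (l.flatMap f).length ≤ l.length * S := by
    intro α β f S l h
    induction l with
    | nil => simp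
    | cons a l ih =>
      rw [List.flatMap_cons, List.length_append, List.length_cons, Nat.succ_mul, Nat.add_comm]
      exact Nat.add_le_add (ih fun b hb => h b (List.mem_cons_of_mem _ hb)) (h a List.mem_cons_self)
  have hmem : ∀ {α β : Type} (f : α → List β) (l : List α) (a : α), a ∈ l →
      (f a).length ≤ (l.flatMap f).length := by
    intro α β f l a ha
    rw [List.length_flatMap]
    exact List.single_le_sum (fun _ _ => Nat.zero_le _) _ (List.mem_map_of_mem (f := fun a =>
      (f a).length) ha)
  simp only [l, List.length_append]
  refine Nat.add_le_add (Nat.add_le_add ?_ ?_) ?_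
  · exact (List.length_filterMap_le _ _).trans (hlen _).le
  · apply hsum
    intro c hc
    refine (List.length_filterMap_le _ _).trans ((hlen _).le.trans ?_)
    -- A single cell is estimated by the sum of the sizes of all quantified left-hand graphs of the
    -- rule, which does not depend on the family.
    exact hmem (fun u : UCode Λ => pts u.1) _ c.u.code (List.mem_map_of_mem (hf.cell c hc).mem)
  · exact (List.length_filterMap_le _ _).trans (hlen _).le

variable [DecidableEq Λ]

theorem mem_cells {x : CCode Λ} :
    x ∈ cells ρ.code X.code Y.code (homCode m₀) (homCode h₀) (homCode g) ↔
      ∃ c : Cell ρ X Y, IsCell m₀ h₀ g c ∧ c.code = x := by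
  simp only [cells, List.mem_filter, List.mem_flatMap, List.mem_map]
  constructor
  · rintro ⟨⟨u', hu', s, hs, t, ht, rfl⟩, h⟩
    obtain ⟨u, hu, rfl⟩ := List.mem_map.1 hu'
    obtain ⟨m, rfl⟩ := mem_homs.1 hs
    obtain ⟨k, rfl⟩ := mem_homs.1 ht
    exact ⟨⟨u, m, k⟩, isCellCode_iff.1 ⟨hu, h⟩, rfl⟩
  · rintro ⟨c, hc, rfl⟩
    obtain ⟨hu, h⟩ := isCellCode_iff.2 hc
    exact ⟨⟨c.u.code, List.mem_map_of_mem hu, _, mem_homs.2 ⟨c.m, rfl⟩, _,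
      mem_homs.2 ⟨c.h, rfl⟩, rfl⟩, h⟩

theorem backFamCode_iff {n : ℕ} :
    (IsTotalHom m₀ ∧ IsInjHom m₀ ∧ IsInjHom h₀ ∧ ρ.r ≫ h₀ = m₀ ≫ g ∧
      backFamCode ρ.code X.code Y.code (homCode m₀) (homCode h₀) (homCode g) n = true) ↔
      ∃ fam : List (Cell ρ X Y), fam.length ≤ n ∧ IsBackFam m₀ h₀ g fam := by
  simp only [backFamCode, List.any_eq_true, List.mem_range, Nat.lt_succ_iff, mem_pairwiseLists,
    Bool.and_eq_true]
  constructor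
  · rintro ⟨h1, h2, h3, h4, k, hk, t, ⟨rfl, ht, hp⟩, h5, h6, h7, h8⟩
    -- Each entry of `t` is drawn from `cells`, hence codes an actual cell; decoding entrywise turns
    -- `t` into a family.
    have hex : ∃ fam : List (Cell ρ X Y), (∀ c ∈ fam, IsCell m₀ h₀ g c) ∧ fam.map Cell.code = t := by
      clear hk hp h5 h6 h7 h8
      induction t with
      | nil => exact ⟨[], by simp, rfl⟩
      | cons a t ih =>
        obtain ⟨fam, h5, rfl⟩ := ih fun b hb => ht b (List.mem_cons_of_mem _ hb)
        obtain ⟨c, hc, rfl⟩ := mem_cells.1 (ht a List.mem_cons_self)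
        exact ⟨c :: fam, by simpa [hc] using h5, rfl⟩
    obtain ⟨fam, hc, rfl⟩ := hex
    rw [List.pairwise_map] at hp
    rw [definedCode_iff] at h5
    rw [injOutCode_iff fun x hx => (h5 x hx).imp fun _ h => h.1] at h6
    exact ⟨fam, by simpa using hk, ⟨h1, h2, h3, h4, hc, hp.imp disjCode_iff.1⟩, h5, h6,
      coverCode_iff.1 h7, appCode_iff.1 h8⟩
  · rintro ⟨fam, hk, hf⟩
    refine ⟨hf.total, hf.inj, hf.inj_h, hf.comm, fam.length, hk, fam.map Cell.code,
      ⟨by simp, ?_, ?_⟩, definedCode_iff.2 hf.defined, ?_, coverCode_iff.2 hf.cover,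
      appCode_iff.2 hf.app⟩
    · intro a ha
      obtain ⟨c, hc, rfl⟩ := List.mem_map.1 ha
      exact mem_cells.2 ⟨c, hf.cell c hc, rfl⟩
    · rw [List.pairwise_map]
      exact hf.pairwise.imp disjCode_iff.2
    · exact (injOutCode_iff fun x hx => (hf.defined x hx).imp fun _ h => h.1).2 hf.inj_outside

theorem backCode_iff {n : ℕ} :
    backCode ρ.code X.code Y.code n = true ↔ ∃ k ≤ n, X ∈ backApply ρ Y k := by
  have h : backCode ρ.code X.code Y.code n = true ↔ ∃ (m₀ : ρ.L ⟶ X) (h₀ : ρ.R ⟶ Y) (g : X ⟶ Y),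
      (IsTotalHom m₀ ∧ IsInjHom m₀ ∧ IsInjHom h₀ ∧ ρ.r ≫ h₀ = m₀ ≫ g ∧
        backFamCode ρ.code X.code Y.code (homCode m₀) (homCode h₀) (homCode g) n = true) := by
    change ((homs ρ.L.code X.code).any fun m => (homs ρ.R.code Y.code).any fun h =>
      (homs X.code Y.code).any fun g => totalCode ρ.L.code m && (injCode ρ.L.code m &&
        (injCode ρ.R.code h && (eqb (compCode (homCode ρ.r) h) (compCode m g) &&
          backFamCode ρ.code X.code Y.code m h g n)))) = true ↔ _
    simp only [homs_any, Bool.and_eq_true, totalCode_iff, injCode_iff, eqb_iff, compCode_homCode,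
      homCode_injective.eq_iff]
  simp only [h, backFamCode_iff, mem_backApply_iff_fam]
  constructor
  · rintro ⟨m₀, h₀, g, fam, hk, hf⟩
    exact ⟨fam.length, hk, m₀, h₀, g, fam, rfl, hf⟩
  · rintro ⟨k, hk, m₀, h₀, g, fam, rfl, hf⟩
    exact ⟨m₀, h₀, g, fam, hk, hf⟩

end BackSemantics

end UGTS

namespace UGTS

/-! ### Computability of the backward step and of the search -/

section Computability

variable {α β γ : Type} [Primcodable α] [Primcodable β] [Primcodable γ]

/-- Recursion on the length of a prefix of the list. The function `f` is only computable, as is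
necessary because it will involve an arbitrary bounding function. -/
theorem computable_map {l : α → List β} {f : α → β → γ} (hl : Computable l)
    (hf : Computable fun x : α × β => f x.1 x.2) : Computable fun a => (l a).map (f a) := by
  have hstep : Computable fun x : α × ℕ × List γ =>
      x.2.2 ++ (((l x.1)[x.2.1]?).map (f x.1)).toList := by
    refine Computable.list_append.comp (Computable.snd.comp Computable.snd)
      (Primrec.optionToList.to_comp.comp (Computable.option_map (Computable.list_getElem?.comp
        (hl.comp Computable.fst) (Computable.fst.comp Computable.snd)) ?_))
    exact hf.comp ((Computable.fst.comp Computable.fst).pair Computable.snd)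
  have h : ∀ a n, Nat.rec (motive := fun _ => List γ) []
      (fun y IH => IH ++ (((l a)[y]?).map (f a)).toList) n = ((l a).take n).map (f a) := by
    intro a n
    induction n with
    | zero => simp
    | succ n ih =>
      simp only [ih, List.take_add_one, List.map_append]
      cases (l a)[n]? <;> rfl
  refine (Computable.nat_rec (Computable.list_length.comp hl) (Computable.const [])
    hstep.to₂).of_eq fun a => ?_
  exact (h a _).trans (by rw [List.take_length])

theorem computable_flatMap {l : α → List β} {f : α → β → List γ} (hl : Computable l)
    (hf : Computable fun x : α × β => f x.1 x.2) : Computable fun a => (l a).flatMap (f a) :=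
  Primrec.list_flatten.to_comp.comp (computable_map hl hf)

theorem primrec_minimize {r : β → β → Bool} (hr : Primrec fun x : β × β => r x.1 x.2) :
    Primrec (minimize r) := by
  have h : Primrec fun x : List β × β × List β => bif x.2.2.any (fun y => r y x.2.1) then x.2.2
      else x.2.1 :: x.2.2.filter fun y => !r x.2.1 y := by
    refine primrec_cond (primrec_any (primrec_snd Primrec.snd) (hr.comp (Primrec.snd.pair
      (primrec_fst (primrec_snd Primrec.fst))))) (primrec_snd Primrec.snd) (primrec_cons
      (primrec_fst Primrec.snd) (primrec_filter (primrec_snd Primrec.snd) (primrec_not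
        (hr.comp ((primrec_fst (primrec_snd Primrec.fst)).pair Primrec.snd)))))
  refine (Primrec.list_foldr Primrec.id (Primrec.const []) h.to₂).of_eq fun l => ?_
  induction l with
  | nil => rfl
  | cons a l ih =>
    simp only [id, List.foldr_cons] at ih ⊢
    rw [ih, minimize, cond_eq_ite]

theorem computable_flatMap_bounded {h : β × α × ℕ → List γ} (hh : Computable h) {f : β × α → ℕ}
    (hf : Computable f) :
    Computable fun x : List β × α => x.1.flatMap fun r => h (r, x.2, f (r, x.2)) := by
  have hG : Computable fun x : (List β × α) × β => x.1.2 := Computable.snd.comp Computable.fst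
  exact computable_flatMap Computable.fst (hh.comp (Computable.snd.pair (hG.pair
    (hf.comp (Computable.snd.pair hG)))))

/-! ### The search procedure -/

/-- The working set with the results of the backward step `f` added. -/
def expand {α : Type} (f : α → List α) (W : List α) : List α := W ++ W.flatMap f

/-- The working set after `n` rounds. -/
def rounds {α : Type} (r : α → α → Bool) (f : α → List α) (F : List α) : ℕ → List α
  | 0 => F
  | n + 1 => minimize r (expand f (rounds r f F n))

/-- A further round does not change the working set. -/
def isStationary {α : Type} [DecidableEq α] (r : α → α → Bool) (f : α → List α) (W : List α) :
    Bool :=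
  (W.all fun H => W.all fun H' => !r H' H || eqb H' H) &&
    (expand f W).all fun H => W.any fun H' => r H' H

/-- The search procedure, with parameters in `β`. -/
def search {α β : Type} [DecidableEq α] (r : α → α → Bool) (f : β × α → List α)
    (x : β × List α) : Part (List α) :=
  Nat.rfindOpt fun n => bif isStationary r (fun G => f (x.1, G)) (rounds r (fun G => f (x.1, G)) x.2 n)
    then some (rounds r (fun G => f (x.1, G)) x.2 n) else none

theorem partrec_search [DecidableEq α] {r : α → α → Bool}
    (hr : Primrec fun x : α × α => r x.1 x.2) {f : β × α → List α} (hf : Computable f) :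
    Partrec (search r f) := by
  have hC : Computable fun x : β × List α => expand (fun G => f (x.1, G)) x.2 :=
    Computable.list_append.comp Computable.snd (computable_flatMap Computable.snd
      (hf.comp ((Computable.fst.comp Computable.fst).pair Computable.snd)))
  have hW : Computable fun x : (β × List α) × ℕ => rounds r (fun G => f (x.1.1, G)) x.1.2 x.2 := by
    have hp : Computable fun x : ((β × List α) × ℕ) × ℕ × List α => (x.1.1.1, x.2.2) :=
      (Computable.fst.comp (Computable.fst.comp Computable.fst)).pair
        (Computable.snd.comp Computable.snd)
    have hstep : Computable fun x : ((β × List α) × ℕ) × ℕ × List α =>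
        minimize r (expand (fun G => f (x.1.1.1, G)) x.2.2) := by
      have h1 := hC.comp hp
      have h2 := (primrec_minimize hr).to_comp
      exact h2.comp h1
    refine (Computable.nat_rec Computable.snd (Computable.snd.comp Computable.fst)
      hstep.to₂).of_eq fun x => ?_
    induction x.2 with
    | zero => rfl
    | succ n ih => simp only [rounds, ← ih]
  have hS : Computable fun x : β × List α => isStationary r (fun G => f (x.1, G)) x.2 := by
    have h1 : Primrec fun W : List α => W.all fun H => W.all fun H' => !r H' H || eqb H' H :=
      primrec_all primrec_self (primrec_all Primrec.fst (primrec_or (primrec_not (hr.comp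
        (Primrec.snd.pair (primrec_snd Primrec.fst)))) (primrec_eqb Primrec.snd
          (primrec_snd Primrec.fst))))
    have h2 : Primrec fun x : List α × List α => x.1.all fun H => x.2.any fun H' => r H' H :=
      primrec_all Primrec.fst (primrec_any (primrec_snd Primrec.fst) (hr.comp
        (Primrec.snd.pair (primrec_snd Primrec.fst))))
    exact Primrec.and.to_comp.comp (h1.to_comp.comp Computable.snd)
      (h2.to_comp.comp (hC.pair Computable.snd))
  exact Partrec.rfindOpt (Computable.cond (hS.comp ((Computable.fst.comp
    Computable.fst).pair hW)) (Computable.option_some.comp hW) (Computable.const none)).to₂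

end Computability

/-! ### The pred-basis and the search on codes of graphs -/

section PredCode

variable {Λ : Type} {ar : Λ → ℕ}

theorem searchStep_minimizeGraphs {b : URule ar → HGraph ar → ℕ} {rules : List (URule ar)}
    {P : HGraph ar → List (HGraph ar)} (hP : ∀ G H, H ∈ P G ↔ H ∈ predBasis b rules G)
    (W : List (HGraph ar)) : SearchStep b rules W (minimizeGraphs (W ++ W.flatMap P)) := by
  have h := isMinimization_minimizeGraphs (W ++ W.flatMap P)
  simp only [List.mem_append, List.mem_flatMap, hP] at h
  exact h

theorem expand_map {f : GCode Λ → List (GCode Λ)} {P : HGraph ar → List (HGraph ar)}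
    (hf : ∀ G, f G.code = (P G).map HGraph.code) (W : List (HGraph ar)) :
    expand f (W.map HGraph.code) = (W ++ W.flatMap P).map HGraph.code := by
  simp [expand, List.flatMap_map, List.map_flatMap, hf]

section Decidable

variable [DecidableEq Λ]

/-- The coded graphs that are computed from the coded graph `Y` by backward application of
instantiations of length at most `n`. -/
def backStepCode (ar : Λ → ℕ) (labels : List Λ) (ρ : RCode Λ) (Y : GCode Λ) (n : ℕ) :
    List (GCode Λ) :=
  (graphsUpTo ar labels (sizeBound ρ Y n)).filter fun X => backCode ρ X Y n

theorem mem_backStepCode {labels : List Λ} (hl : ∀ l, l ∈ labels) {ρ : URule ar} {Y : HGraph ar}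
    {n : ℕ} {c : GCode Λ} : c ∈ backStepCode ar labels ρ.code Y.code n ↔
      ∃ X : HGraph ar, X.code = c ∧ ∃ k ≤ n, X ∈ backApply ρ Y k := by
  rw [backStepCode, List.mem_filter, mem_graphsUpTo hl]
  constructor
  · rintro ⟨⟨X, rfl, -⟩, h⟩
    exact ⟨X, rfl, backCode_iff.1 h⟩
  · rintro ⟨X, rfl, k, hk, h⟩
    refine ⟨⟨X, rfl, ?_⟩, backCode_iff.2 ⟨k, hk, h⟩⟩
    obtain ⟨m₀, h₀, g, fam, rfl, hf⟩ := mem_backApply_iff_fam.1 h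
    -- The bound increases with the number of cells, so one enumeration serves all lengths up to
    -- `n`.
    have h1 : X.nV + X.nE ≤ sizeBound ρ.code Y.code n := by
      refine hf.size_le.trans ?_
      unfold sizeBound
      gcongr
    omega

/-- The backward step on codes, with the lengths of instantiations bounded by `β`. -/
def predCode (ar : Λ → ℕ) (labels : List Λ) (β : RCode Λ × GCode Λ → ℕ)
    (x : List (RCode Λ) × GCode Λ) : List (GCode Λ) :=
  x.1.flatMap fun ρ => backStepCode ar labels ρ x.2 (β (ρ, x.2))

theorem exists_predCode_eq {labels : List Λ} (hl : ∀ l, l ∈ labels) {b : URule ar → HGraph ar → ℕ}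
    {β : RCode Λ × GCode Λ → ℕ} (hβ : ∀ ρ G, β (ρ.code, G.code) = b ρ G) (rules : List (URule ar))
    (G : HGraph ar) : ∃ l : List (HGraph ar),
      predCode ar labels β (rules.map URule.code, G.code) = l.map HGraph.code ∧
      ∀ H, H ∈ l ↔ H ∈ predBasis b rules G := by
  have hmem : ∀ c, c ∈ predCode ar labels β (rules.map URule.code, G.code) ↔
      ∃ X : HGraph ar, X.code = c ∧ X ∈ predBasis b rules G := by
    intro c
    change c ∈ (rules.map URule.code).flatMap _ ↔ _
    rw [List.mem_flatMap]
    constructor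
    · rintro ⟨_, h, hc⟩
      obtain ⟨ρ, hρ, rfl⟩ := List.mem_map.1 h
      obtain ⟨X, hX, k, hk, h⟩ := (mem_backStepCode hl).1 hc
      exact ⟨X, hX, ρ, hρ, k, hβ ρ G ▸ hk, h⟩
    · rintro ⟨X, hX, ρ, hρ, k, hk, h⟩
      exact ⟨_, List.mem_map_of_mem hρ, (mem_backStepCode hl).2 ⟨X, hX, k, (hβ ρ G).symm ▸ hk, h⟩⟩
  -- All entries are codes of graphs, so the whole list is the image of a list of graphs.
  have h : predCode ar labels β (rules.map URule.code, G.code) ∈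
      Set.range (List.map (HGraph.code : HGraph ar → GCode Λ)) := by
    rw [Set.range_list_map]
    intro c hc
    obtain ⟨X, hX, -⟩ := (hmem c).1 hc
    exact ⟨X, hX⟩
  obtain ⟨l, h⟩ := h
  refine ⟨l, h.symm, fun H => ?_⟩
  rw [← List.mem_map_of_injective code_injective, h, hmem]
  constructor
  · rintro ⟨X, hX, h⟩
    exact code_injective hX ▸ h
  · exact fun h => ⟨H, rfl, h⟩

theorem minimize_subCode_map (l : List (HGraph ar)) :
    minimize subCode (l.map HGraph.code) = (minimizeGraphs l).map HGraph.code := by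
  classical
  refine minimize_map _ (fun G H => ?_) l
  rw [Bool.eq_iff_iff, subCode_iff, decide_eq_true_iff]

/-- For a round from `W` to itself the inclusion required by minimization is automatic, so
incomparability of the members and representation of the expanded set remain. -/
theorem isStationary_iff {b : URule ar → HGraph ar → ℕ} {rules : List (URule ar)}
    {f : GCode Λ → List (GCode Λ)} {P : HGraph ar → List (HGraph ar)}
    (hP : ∀ G H, H ∈ P G ↔ H ∈ predBasis b rules G)
    (hf : ∀ G, f G.code = (P G).map HGraph.code) (W : List (HGraph ar)) :
    isStationary subCode f (W.map HGraph.code) = true ↔ SearchStep b rules W W := by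
  rw [isStationary, expand_map hf]
  simp only [Bool.and_eq_true, List.all_eq_true, List.any_eq_true, List.forall_mem_map,
    Bool.or_eq_true, Bool.not_eq_true', eqb_iff, code_injective.eq_iff, SearchStep, IsMinimization]
  have h1 : ∀ H : HGraph ar, (∃ x ∈ W.map HGraph.code, subCode x H.code = true) ↔
      ∃ H' ∈ W, SubOrder H' H := by
    intro H
    constructor
    · rintro ⟨x, hx, h⟩
      obtain ⟨H', hH', rfl⟩ := List.mem_map.1 hx
      exact ⟨H', hH', subCode_iff.1 h⟩
    · rintro ⟨H', hH', h⟩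
      exact ⟨_, List.mem_map_of_mem hH', subCode_iff.2 h⟩
  have h2 : ∀ H H' : HGraph ar, (subCode H'.code H.code = false ∨ H' = H) ↔
      (SubOrder H' H → H' = H) := by
    intro H H'
    rw [← subCode_iff]
    cases subCode H'.code H.code <;> simp
  simp only [h1, h2, List.mem_append, List.mem_flatMap, hP]
  exact ⟨fun h => ⟨fun H hH => .inl hH, h.1, h.2⟩, fun h => h.2⟩

/-- The procedure follows one particular run. That it halts whenever any run stops is
`searchStep_self_of_searchResult`. -/
theorem search_spec {b : URule ar → HGraph ar → ℕ} (hb : ∀ ρ G, IsInstBound ρ G (b ρ G))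
    {f : List (RCode Λ) × GCode Λ → List (GCode Λ)} {rules : List (URule ar)}
    (hf : ∀ G : HGraph ar, ∃ l : List (HGraph ar),
      f (rules.map URule.code, G.code) = l.map HGraph.code ∧ ∀ H, H ∈ l ↔ H ∈ predBasis b rules G)
    (F : List (HGraph ar)) :
    ((search subCode f (rules.map URule.code, F.map HGraph.code)).Dom ↔
      ∃ W, SearchResult b rules F W) ∧
    ∀ out ∈ search subCode f (rules.map URule.code, F.map HGraph.code),
      ∃ W, SearchResult b rules F W ∧ out = W.map HGraph.code := by
  choose P hf hP using hf
  let W : ℕ → List (HGraph ar) := fun n =>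
    Nat.rec F (fun _ V => minimizeGraphs (V ++ V.flatMap P)) n
  have hstep : ∀ n, SearchStep b rules (W n) (W (n + 1)) := fun n =>
    searchStep_minimizeGraphs hP (W n)
  have hW : ∀ n, rounds subCode (fun G => f (rules.map URule.code, G)) (F.map HGraph.code) n =
      (W n).map HGraph.code := by
    intro n
    induction n with
    | zero => rfl
    | succ n ih => rw [rounds, ih, expand_map (f := fun G => f (rules.map URule.code, G)) hf, minimize_subCode_map]
  have hreach : ∀ n, Relation.ReflTransGen (SearchStep b rules) F (W n) := by
    intro n
    induction n with
    | zero => exact .refl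
    | succ n ih => exact ih.tail (hstep n)
  have hmem : ∀ n out, out ∈ (bif isStationary subCode (fun G => f (rules.map URule.code, G))
      (rounds subCode (fun G => f (rules.map URule.code, G)) (F.map HGraph.code) n)
      then some (rounds subCode (fun G => f (rules.map URule.code, G)) (F.map HGraph.code) n)
      else none) ↔ SearchStep b rules (W n) (W n) ∧ out = (W n).map HGraph.code := by
    intro n out
    rw [hW, ← isStationary_iff (f := fun G => f (rules.map URule.code, G)) hP hf]
    cases isStationary subCode (fun G => f (rules.map URule.code, G)) ((W n).map HGraph.code) <;>
      simp [eq_comm]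
  refine ⟨?_, fun out hout => ?_⟩
  · rw [search, Nat.rfindOpt_dom]
    simp only [hmem]
    constructor
    · rintro ⟨n, _, h, -⟩
      exact ⟨W n, hreach n, h⟩
    · rintro ⟨V, hV⟩
      obtain ⟨n, h⟩ := searchStep_self_of_searchResult hb hstep hV
      exact ⟨n, _, h, rfl⟩
  · obtain ⟨n, h⟩ := Nat.rfindOpt_spec hout
    obtain ⟨h, ho⟩ := (hmem n out).1 h
    exact ⟨W n, ⟨hreach n, h⟩, ho⟩

end Decidable

variable [Primcodable Λ] [Finite Λ]

/-- Finiteness of `Λ` makes the arity function primitive recursive; the list of labels is a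
constant. -/
theorem primrec_graphsUpTo {α : Type} [Primcodable α] {labels : List Λ} {n : α → ℕ} (hn : Primrec n) :
    Primrec fun a => graphsUpTo ar labels (n a) := by
  have h : Primrec fun n => edgesOn ar labels n :=
    primrec_flatMap (Primrec.const labels) (primrec_map (primrec_listsOf (primrec_range Primrec.fst)
      ((Primrec.dom_finite ar).comp Primrec.snd)) ((primrec_snd Primrec.fst).pair Primrec.snd))
  have hr {δ : Type} [Primcodable δ] {k : δ → ℕ} (hk : Primrec k) :
      Primrec fun a => List.range (k a + 1) := primrec_range (Primrec.succ.comp hk)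
  exact primrec_flatMap (hr hn) (primrec_flatMap (hr (hn.comp Primrec.fst)) (primrec_map
    (primrec_listsOf (h.comp (primrec_snd Primrec.fst)) Primrec.snd)
    ((primrec_snd (primrec_fst Primrec.fst)).pair Primrec.snd)))

variable [DecidableEq Λ]

/-- Enumeration and test are primitive recursive in the bound; only the value of `β` that is
substituted for it is merely computable. -/
theorem computable_predCode {labels : List Λ} {β : RCode Λ × GCode Λ → ℕ}
    (hβ : Computable β) : Computable (predCode ar labels β) := by
  have h : Primrec fun x : RCode Λ × GCode Λ × ℕ => backStepCode ar labels x.1 x.2.1 x.2.2 :=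
    primrec_filter (primrec_graphsUpTo (primrec_sizeBound Primrec.fst (primrec_fst Primrec.snd)
      (primrec_snd Primrec.snd))) (primrec_backCode (primrec_fst Primrec.fst) Primrec.snd
        (primrec_fst (primrec_snd Primrec.fst)) (primrec_snd (primrec_snd Primrec.fst)))
  exact computable_flatMap_bounded h.to_comp hβ

end PredCode

theorem isBoundingFunction_size {Λ : Type} [Primcodable Λ] (ar : Λ → ℕ) :
    IsBoundingFunction (fun (_ : URule ar) (G : HGraph ar) => G.size) := by
  refine ⟨isInstBound_size, fun x => x.2.1 + x.2.2.length, ?_, fun ρ G => ?_⟩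
  · exact (primrec_add (primrec_fst Primrec.snd)
      (primrec_length (primrec_snd Primrec.snd))).to_comp
  · exact congrArg (G.nV + ·) (length_code G)

end UGTS

theorem mainTheorem3 :
    (∀ (Λ : Type) [Finite Λ] [Primcodable Λ] (ar : Λ → ℕ),
      -- bounding functions exist: the number of nodes and edges is one
      IsBoundingFunction (fun (_ : URule ar) (G : HGraph ar) => G.size) ∧
      ∀ b : URule ar → HGraph ar → ℕ, IsBoundingFunction b →
        -- `predBasis` yields a finite basis of the upward closure of the predecessors
        (∀ (rules : List (URule ar)) (G : HGraph ar),
          (predBasis b rules G).Finite ∧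
          IsBasis (predBasis b rules G) (upClosure (Pred rules (upClosure {G})))) ∧
        -- and is computable from the rules and the graph
        (∃ f : List (RCode Λ) × GCode Λ → List (GCode Λ), Computable f ∧
          ∀ (rules : List (URule ar)) (G : HGraph ar), ∃ l : List (HGraph ar),
            f (rules.map URule.code, G.code) = l.map HGraph.code ∧
            ∀ H, H ∈ l ↔ H ∈ predBasis b rules G) ∧
        -- every round of the backward search can be carried out
        (∀ (rules : List (URule ar)) (W : List (HGraph ar)), ∃ W', SearchStep b rules W W') ∧
        -- if the search stops, its result represents every graph from which some final graph
        -- is coverable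
        (∀ (rules : List (URule ar)) (F W : List (HGraph ar)), SearchResult b rules F W →
          {G | ∃ H ∈ F, CanCover rules G H} ⊆ upClosure {H | H ∈ W}) ∧
        -- in any case, the represented sets increase and exhaust such a superset
        (∀ (rules : List (URule ar)) (F : List (HGraph ar)) (W : ℕ → List (HGraph ar)),
          W 0 = F → (∀ i, SearchStep b rules (W i) (W (i + 1))) →
          Monotone (fun i => upClosure {H | H ∈ W i}) ∧
          {G | ∃ H ∈ F, CanCover rules G H} ⊆ ⋃ i, upClosure {H | H ∈ W i}) ∧
        -- the search is an algorithm: it halts exactly if the working sets become stationary,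
        -- with the stationary working set as its result
        (∃ s : List (RCode Λ) × List (GCode Λ) →. List (GCode Λ), Partrec s ∧
          ∀ (rules : List (URule ar)) (F : List (HGraph ar)),
            ((s (rules.map URule.code, F.map HGraph.code)).Dom ↔
              ∃ W, SearchResult b rules F W) ∧
            ∀ out ∈ s (rules.map URule.code, F.map HGraph.code),
              ∃ W, SearchResult b rules F W ∧ out = W.map HGraph.code)) ∧
    -- termination is not guaranteed
    (∃ (n : ℕ) (ar : Fin n → ℕ) (rules : List (URule ar)) (F : List (HGraph ar)),
      ∀ b : URule ar → HGraph ar → ℕ, IsBoundingFunction b →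
        ¬ ∃ W, SearchResult b rules F W) := by
  refine ⟨?_, 3, Walk.arity, [Walk.rule], [Walk.path 0 0], fun b hb ⟨W, hW⟩ =>
    Walk.not_searchResult hb.1 W hW⟩
  intro Λ _ _ ar
  refine ⟨isBoundingFunction_size ar, ?_⟩
  rintro b ⟨hb, β, hβ, hβb⟩
  classical
  -- A complete list of labels, over which coded graphs are enumerated. It does not depend on rules
  -- or graphs, so it is a constant of the algorithm.
  obtain ⟨labels, -, hl⟩ := Finite.exists_univ_list Λ
  have hpred := exists_predCode_eq hl hβb
  refine ⟨fun rules G => ⟨?_, isBasis_predBasis hb rules G⟩,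
    ⟨predCode ar labels β, computable_predCode hβ, hpred⟩, fun rules W => ?_,
    fun rules F W h => h.canCover_subset hb, ?_,
    ⟨search subCode (predCode ar labels β), partrec_search (primrec_subCode Primrec.fst Primrec.snd)
      (computable_predCode hβ), fun rules F => search_spec hb (hpred rules) F⟩⟩
  · obtain ⟨l, -, h⟩ := hpred rules G
    exact (List.finite_toSet l).subset fun H hH => (h H).2 hH
  · choose P _ hP using hpred rules
    exact ⟨_, searchStep_minimizeGraphs hP W⟩
  · rintro rules F W rfl h
    exact ⟨searchStep_monotone h, canCover_subset_iUnion hb h⟩
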